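/- Let $p$ be a prime, $q$ a power of $p$, and let $A$ be the ring of functions on a nonsingular projective curve over $\mathbb{F}_q$ that are regular away from a fixed closed point $\infty$. Let $V$ be a normal projective variety over a finite field containing $\mathbb{F}_q$, embedded in some $\mathbb{P}^M$, with function field $K$. Put $\tau(x)=x^q$. Let $\phi:A\to K\{\tau\}$ be a Drinfeld module, i.e. a ring morphism such that the coefficient of $\tau^0$ in $\phi_a$ is $i(a)$ for a fixed morphism of $\mathbb{F}_q$-algebras $i:A\to K$; assume that $\phi$ has finite characteristic, i.e. $\ker(i)\neq\{0\}$. Let $M_K$ be the set of normalized discrete valuations of $K$ attached to the irreducible divisors of $V$, and for $v_0\in M_K$ let $\deg(v_0)$ be the projective degree of the divisor. For a finite extension $L/K$ let $M_L$ be the set of normalized discrete valuations of $L$ that lie above some $v_0\in M_K$ (those attached to the irreducible divisors of the normalization of $V$ in $L$). For $v\in M_L$ above $v_0$ with ramification index $e(v|v_0)$ and residue degree $f(v|v_0)$, and for $x\in L$, the local height is $$\hat h_v(x)=-\frac{\deg(v_0)f(v|v_0)}{[L:K]}\lim_{n\to\infty}\frac{\min\{0,v(\phi_{a^n}(x))\}}{\deg(\phi_{a^n})},$$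 where $a\in A$ is any nonconstant element (the value does not depend on $a$) and $\deg(\phi_{a^n})$ is the degree of $\phi_{a^n}$ as a polynomial in $x$. (1) There is a constant $C>0$, depending only on $\phi$ (and on the given data $A$, $K$ and $V\subset\mathbb{P}^M$), such that the following holds. Let $t\in A$ be such that $\phi_t=\sum_{i=r_0}^{r}a_i\tau^i$ with $a_{r_0}\ne0\ne a_r$ and $r_0\ge 1$ (i.e. $\phi_t$ is nonzero and inseparable). Let $x\in K^{\mathrm{alg}}$, let $v\in M_{K(x)}$ and let $v_0\in M_K$ be the valuation below $v$. If $p\nmid e(v|v_0)$ and $\hat h_v(x)>0$, then $$\hat h_v(x)\ \ge\ \frac{C}{e(v|v_0)^{\frac{r}{r_0}-1}\,[K(x):K]}.$$ (2) The exponent $r/r_0$ is optimal: let $1\le r_0<r$, $A=\mathbb{F}_q[t]$, $K=\mathbb{F}_q(t)$, $V=\mathbb{P}^1$ over $\mathbb{F}_q$ with its standard coordinates, and let $\phi$ be the Drinfeld module with $\phi_t=\tau^r-t^{1-q^{r_0}}\tau^{r_0}$. Then for every real $\kappa<r/r_0$ and every $C>0$ there are $x\in K^{\mathrm{alg}}$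 and $v\in M_{K(x)}$ above some $v_0\in M_K$ such that $p\nmid e(v|v_0)$ and $$0<\hat h_v(x)<\frac{C}{e(v|v_0)^{\kappa-1}\,[K(x):K]}.$$ -/

import Mathlib

open Filter Topology

noncomputable section

namespace LocalLehmer

/-! ### The coefficient ring of a Drinfeld module -/

/-- `F` is a function field of one variable over `Fq`, that is, the function field of a nonsingular
projective curve over `Fq`. -/
def IsCurveFunctionField (Fq F : Type*) [Field Fq] [Field F] [Algebra Fq F] : Prop :=
  (⊤ : IntermediateField Fq F).FG ∧ Algebra.trdeg Fq F = 1

/-- The closed points of the nonsingular projective curve with function field `F`, given by their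
local rings: the valuation rings of `F` which contain `Fq` and differ from `F`. -/
def IsClosedPoint (Fq : Type*) {F : Type*} [Field Fq] [Field F] [Algebra Fq F]
    (P : ValuationSubring F) : Prop :=
  P ≠ ⊤ ∧ ∀ c : Fq, algebraMap Fq F c ∈ P

/-- The ring of the functions that are regular at every closed point other than `infty`. -/
def regularAway (Fq : Type*) {F : Type*} [Field Fq] [Field F] [Algebra Fq F]
    (infty : ValuationSubring F) : Subalgebra Fq F where
  carrier := {f | ∀ P : ValuationSubring F, IsClosedPoint Fq P → P ≠ infty → f ∈ P}
  mul_mem' hf hg P hP hne := P.mul_mem _ _ (hf P hP hne) (hg P hP hne)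
  add_mem' hf hg P hP hne := P.add_mem _ _ (hf P hP hne) (hg P hP hne)
  algebraMap_mem' c _ hP _ := hP.2 c

/-! ### Twisted polynomials and Drinfeld modules -/

theorem add_pow_card_pow (Fq : Type*) {K : Type*} [Field Fq] [Finite Fq] [Field K] [Algebra Fq K]
    (n : ℕ) (x y : K) :
    (x + y) ^ (Nat.card Fq ^ n) = x ^ (Nat.card Fq ^ n) + y ^ (Nat.card Fq ^ n) := by
  obtain ⟨p, hp⟩ := CharP.exists Fq
  let _ := Fintype.ofFinite Fq
  obtain ⟨m, hpr, hm⟩ := FiniteField.card Fq p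
  have : Fact p.Prime := ⟨hpr⟩
  have : CharP K p := charP_of_injective_algebraMap (algebraMap Fq K).injective p
  rw [Nat.card_eq_fintype_card, hm, ← pow_mul]
  exact add_pow_char_pow x y p (m * n)

/-- The action of the powers of `τ` on `K`, where `τ x = x ^ q` and `q` is the cardinality
of `Fq`. -/
@[reducible]
def frobeniusAction (Fq K : Type*) [Field Fq] [Finite Fq] [Field K] [Algebra Fq K] :
    MulSemiringAction (Multiplicative ℕ) K where
  smul n x := x ^ (Nat.card Fq ^ n.toAdd)
  one_smul x := by
    change x ^ (Nat.card Fq ^ 0) = x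
    simp
  mul_smul m n x := by
    change x ^ (Nat.card Fq ^ (m.toAdd + n.toAdd)) =
      (x ^ (Nat.card Fq ^ n.toAdd)) ^ (Nat.card Fq ^ m.toAdd)
    rw [← pow_mul, ← pow_add, add_comm]
  smul_zero n := zero_pow (pow_ne_zero _ Nat.card_pos.ne')
  smul_add n x y := add_pow_card_pow Fq n.toAdd x y
  smul_one n := one_pow _
  smul_mul n x y := mul_pow _ _ _

/-- The ring `K{τ}` of polynomials in `τ` with coefficients (on the left) in `K`,
where `τ * c = c ^ q * τ` for `c` in `K`. -/
def TwistedPolynomial (_Fq K : Type*) [Field K] : Type _ := SkewPolynomial K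

namespace TwistedPolynomial

variable {Fq K : Type*} [Field Fq] [Finite Fq] [Field K] [Algebra Fq K]

instance instRing : Ring (TwistedPolynomial Fq K) :=
  letI := frobeniusAction Fq K
  inferInstanceAs (Ring (SkewPolynomial K))

/-- The coefficient of `τ ^ n`. -/
def coeff (P : TwistedPolynomial Fq K) (n : ℕ) : K := SkewPolynomial.coeff P n

/-- The twisted polynomial `c * τ ^ n`. -/
def monomial (n : ℕ) (c : K) : TwistedPolynomial Fq K := SkewPolynomial.monomial n c

/-- The degree in `τ`. -/
def natDegree (P : TwistedPolynomial Fq K) : ℕ := (SkewPolynomial.support P).sup id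

/-- The value `∑ cₙ y ^ (q ^ n)` of `∑ cₙ τ ^ n` at an element `y` of an extension of `K`. -/
def eval {L : Type*} [Field L] [Algebra K L] (P : TwistedPolynomial Fq K) (y : L) : L :=
  ∑ n ∈ SkewPolynomial.support P, algebraMap K L (P.coeff n) * y ^ (Nat.card Fq ^ n)

end TwistedPolynomial

/-- A Drinfeld module over `K`: a ring morphism `φ : A → K{τ}` such that the coefficient of `τ ^ 0`
in `φ a` is `i a`, where `i : A → K` is a morphism of `Fq`-algebras. -/
structure DrinfeldModule (Fq A K : Type*) [Field Fq] [Finite Fq] [CommRing A] [Algebra Fq A]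
    [Field K] [Algebra Fq K] where
  i : A →ₐ[Fq] K
  φ : A →+* TwistedPolynomial Fq K
  coeff_zero : ∀ a : A, (φ a).coeff 0 = i a

/-- `φ` has finite characteristic if `i` is not injective. -/
def DrinfeldModule.HasFiniteCharacteristic {Fq A K : Type*} [Field Fq] [Finite Fq] [CommRing A]
    [Algebra Fq A] [Field K] [Algebra Fq K] (D : DrinfeldModule Fq A K) : Prop :=
  RingHom.ker D.i ≠ ⊥

/-! ### Projective models of `K` and their prime divisors -/

/-- An integral projective variety over `k`, embedded in `ℙ^M`, with function field `K`. It is given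
by the homogeneous coordinates of its generic point: it is the closure of this point. -/
structure ProjectiveVariety (k K : Type*) [Field k] [Field K] [Algebra k K] (M : ℕ) where
  coord : Fin (M + 1) → K
  exists_coord_ne_zero : ∃ i, coord i ≠ 0
  adjoin_eq_top : IntermediateField.adjoin k {z : K | ∃ i j, z = coord i / coord j} = ⊤

namespace ProjectiveVariety

variable {k K : Type*} [Field k] [Field K] [Algebra k K] {M : ℕ}

/-- A (scheme-theoretic) point of `V`: a homogeneous prime ideal of `k[X₀, …, X_M]` which contains
the homogeneous ideal of `V` and does not contain all the `Xᵢ`. -/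
structure Point (V : ProjectiveVariety k K M) where
  ideal : Ideal (MvPolynomial (Fin (M + 1)) k)
  isPrime : ideal.IsPrime
  isHomogeneous : ∀ G ∈ ideal, ∀ n : ℕ, MvPolynomial.homogeneousComponent n G ∈ ideal
  mem_of_aeval_eq_zero : ∀ (n : ℕ) (G : MvPolynomial (Fin (M + 1)) k), G.IsHomogeneous n →
    MvPolynomial.aeval V.coord G = 0 → G ∈ ideal
  exists_X_notMem : ∃ i, (MvPolynomial.X i : MvPolynomial (Fin (M + 1)) k) ∉ ideal

variable {V : ProjectiveVariety k K M}

/-- The local ring of `V` at a point, as a subring of the function field `K`. -/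
def Point.localRing (Q : V.Point) : Subring K where
  carrier := {z | ∃ (n : ℕ) (G H : MvPolynomial (Fin (M + 1)) k), G.IsHomogeneous n ∧
    H.IsHomogeneous n ∧ H ∉ Q.ideal ∧
    z = MvPolynomial.aeval V.coord G / MvPolynomial.aeval V.coord H}
  one_mem' := ⟨0, 1, 1, MvPolynomial.isHomogeneous_one _ _, MvPolynomial.isHomogeneous_one _ _,
    fun h => Q.isPrime.ne_top ((Ideal.eq_top_iff_one _).2 h), by simp⟩
  zero_mem' := ⟨0, 0, 1, MvPolynomial.isHomogeneous_zero _ _ _, MvPolynomial.isHomogeneous_one _ _,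
    fun h => Q.isPrime.ne_top ((Ideal.eq_top_iff_one _).2 h), by simp⟩
  mul_mem' := by
    rintro _ _ ⟨m, G, H, hG, hH, hQ, rfl⟩ ⟨n, G', H', hG', hH', hQ', rfl⟩
    refine ⟨m + n, G * G', H * H', hG.mul hG', hH.mul hH',
      fun h => (Q.isPrime.mem_or_mem h).elim hQ hQ', ?_⟩
    rw [map_mul, map_mul, div_mul_div_comm]
  add_mem' := by
    rintro _ _ ⟨m, G, H, hG, hH, hQ, rfl⟩ ⟨n, G', H', hG', hH', hQ', rfl⟩
    have h1 : MvPolynomial.aeval V.coord H ≠ 0 := fun h => hQ (Q.mem_of_aeval_eq_zero m H hH h)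
    have h2 : MvPolynomial.aeval V.coord H' ≠ 0 := fun h => hQ' (Q.mem_of_aeval_eq_zero n H' hH' h)
    refine ⟨m + n, G * H' + H * G', H * H', (hG.mul hH').add (hH.mul hG'), hH.mul hH',
      fun h => (Q.isPrime.mem_or_mem h).elim hQ hQ', ?_⟩
    rw [map_add, map_mul, map_mul, map_mul, div_add_div _ _ h1 h2]
  neg_mem' := by
    rintro _ ⟨m, G, H, hG, hH, hQ, rfl⟩
    refine ⟨m, -G, H, hG.neg, hH, hQ, ?_⟩
    rw [map_neg, neg_div]

/-- `V` is normal: all its local rings are integrally closed. -/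
def IsNormal (V : ProjectiveVariety k K M) : Prop :=
  ∀ Q : V.Point, IsIntegrallyClosed Q.localRing

/-- The generic point of an irreducible divisor (an irreducible closed subset of codimension `1`)
of `V`. -/
def Point.IsDivisor (Q : V.Point) : Prop := ringKrullDim Q.localRing = 1

/-- The Hilbert function of the closure of `Q` in `ℙ^M`: its value at `n` is the dimension over `k`
of the part of degree `n` of the homogeneous coordinate ring. -/
def Point.hilbertFunction (Q : V.Point) (n : ℕ) : ℕ :=
  Module.finrank k ((MvPolynomial.homogeneousSubmodule (Fin (M + 1)) k n).map
    (Ideal.Quotient.mkₐ k Q.ideal).toLinearMap)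

open Classical in
/-- The projective degree of the closure of `Q` in `ℙ^M`: `(deg P)!` times the leading coefficient
of its Hilbert polynomial `P`. -/
def Point.degree (Q : V.Point) : ℚ :=
  if h : ∃ P : Polynomial ℚ, ∀ᶠ n : ℕ in atTop, P.eval (n : ℚ) = Q.hilbertFunction n then
    h.choose.leadingCoeff * (h.choose.natDegree.factorial : ℚ)
  else 0

/-! ### Places and local heights -/

/-- The set `M_L` of a finite extension `L` of `K`: the normalized valuations of `L` (with value
group `ℤ`, written multiplicatively) attached to the irreducible divisors of the normalization
of `V` in `L`, that is, those extending the normalized valuation of `K` attached to an irreducible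
divisor of `V`. The valuation `base` of `K` below `val` and the divisor are uniquely determined
by `val`. -/
structure Place (V : ProjectiveVariety k K M) (L : Type*) [Field L] [Algebra K L] where
  divisor : V.Point
  isDivisor : divisor.IsDivisor
  base : Valuation K (WithZero (Multiplicative ℤ))
  base_surjective : Function.Surjective base
  base_integer : base.integer = divisor.localRing
  val : Valuation L (WithZero (Multiplicative ℤ))
  val_surjective : Function.Surjective val
  hasExtension : base.HasExtension val

namespace Place

variable {L : Type*} [Field L] [Algebra K L]

/-- The ramification index `e(w|v)`: the positive integer `e` such that `w` restricts to `e • v`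
on `K` (in multiplicative notation, `w = v ^ e` on `K`). -/
def ramificationIndex (w : V.Place L) : ℕ :=
  sInf {e : ℕ | 0 < e ∧ ∀ c : K, w.val (algebraMap K L c) = w.base c ^ e}

/-- The relative residue degree `f(w|v)`. -/
def residueDegree (w : V.Place L) : ℕ :=
  haveI := w.hasExtension
  Module.finrank (IsLocalRing.ResidueField w.base.valuationSubring)
    (IsLocalRing.ResidueField w.val.valuationSubring)

/-- `min {0, w(y)}`, for the additively written valuation `w`. -/
def truncVal (w : V.Place L) (y : L) : ℝ :=
  min 0 (-((WithZero.log (w.val y) : ℤ) : ℝ))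

variable {Fq A : Type*} [Field Fq] [Finite Fq] [CommRing A] [Algebra Fq A] [Algebra Fq K]

/-- `V_w(y) = lim min {0, w(φ_{a ^ n}(y))} / deg φ_{a ^ n}`, where `deg φ_{a ^ n}` is the degree
of `φ_{a ^ n}` as a polynomial in the variable `y`; here `a` is a nonconstant element of `A`. -/
def limitVal (w : V.Place L) (D : DrinfeldModule Fq A K) (a : A) (y : L) : ℝ :=
  limUnder atTop (fun n : ℕ => w.truncVal ((D.φ (a ^ n)).eval y) /
    ((Nat.card Fq : ℝ) ^ (D.φ (a ^ n)).natDegree))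

/-- The local height `ĥ_w(y) = - (deg(v) f(w|v) / [L : K]) V_w(y)`, computed by means of a
nonconstant element `a` of `A` (on which it does not depend). -/
def localHeight (w : V.Place L) (D : DrinfeldModule Fq A K) (a : A) (y : L) : ℝ :=
  -((w.divisor.degree : ℝ) * w.residueDegree / Module.finrank K L) * w.limitVal D a y

end Place

end ProjectiveVariety

end LocalLehmer

end

/-! ### The ring `K{τ}`: coefficients, degree, values. -/

noncomputable section

namespace LocalLehmer

set_option linter.unusedSectionVars false

namespace TwistedPolynomial

variable {Fq K : Type*} [Field Fq] [Finite Fq] [Field K] [Algebra Fq K]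

/-! Lower bound. Fix one nonzero `P = φ_{t₁}` with vanishing constant coefficient, of degree `D` in
`τ`, and a place `v` of `K`. Put `G(R) = max |aᵢ| R^(q^i)` (`gauss`). Since every exponent exceeds
1, there is exactly one `R > 0` with `G(R) = R`. The disc of radius `R` is mapped to itself, so
heights vanish there. Let `i` be the last index whose term is maximal at `R`. Just outside the disc,
`|P y| = R s^(q^i)` if `|y| = R s`: the quantity `log s` is multiplied by `q^i` at each step,
whereas the height is multiplied by `q^D`. A point with `log s` about `1/e` escapes after about `log
e / log q^i` steps, which leads to a height of order `e^(-D/i)`.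

Two obstacles remain. First, once outside the initial zone the orbit can reach a radius where two
terms tie and cancellation occurs. Finitely many radii have to be avoided. Reaching one of them
after `m` steps forces `q^(im)` to divide a fixed integer, because `p ∤ e`; hence `m` is bounded and
`s` is bounded away from 1. This gives `FixedRadius.exists_dichotomy`: a point outside the disc
satisfies the bound or lies at distance at least `R B`, for some fixed `B > 1`.

Secondly, a point far from the disc may be close to a root of an iterate of `P` and fall back. One
therefore takes `x, P x, …, P^M x`, where `M` bounds the number of roots of a suitable iterate
`P^n`. Their heights are distinct, so all differences lie outside the disc, and the height of a
difference is at most `q^(DM)` times that of `x`. If some difference is within `R B`, the dichotomy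
applies to it. Otherwise the points are so far apart that by pigeonhole one of them is far from
every root of `P^n`, and `P^n` maps it to a large element (`exists_le_abs_iterate`). This is
`FixedRadius.exists_height_lower_bound`.

The exponent is brought to the form `r/r₀` by commutativity: if `Q` commutes with `P`, both have the
same `R`, and `D/i = r/j` where `j` is the corresponding index of `Q`
(`FixedRadius.exists_of_commute`); clearly `j ≥ r₀`. The constant is uniform in `v` because for all
but finitely many divisors the nonzero coefficients of `P` are units; there the height is `log⁺`, at
least `1/e` when positive.

Optimality. For `τ^r - t^(1-q^r₀) τ^r₀` at the zero of `t`, the fixed radius is `|t|`. The element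
`x = t^((E-1)/E)`, with `p ∤ E`, starts at `|t|^(1-1/E)`, slightly outside. Its orbit can be
computed exactly: the lower term governs until the tie is passed, the leading term afterwards, and
`p ∤ E` prevents an exact tie. The height is then `O(E^(-r/r₀))`. -/

theorem ext_coeff {P Q : TwistedPolynomial Fq K} (h : ∀ n, P.coeff n = Q.coeff n) : P = Q := by
  apply SkewMonoidAlgebra.ext
  exact fun a => h a.toAdd

@[simp] theorem coeff_zero (n : ℕ) : (0 : TwistedPolynomial Fq K).coeff n = 0 := rfl

@[simp] theorem coeff_add (P Q : TwistedPolynomial Fq K) (n : ℕ) :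
    (P + Q).coeff n = P.coeff n + Q.coeff n :=
  DFunLike.congr_fun (SkewMonoidAlgebra.coeff_add P Q) (Multiplicative.ofAdd n)

@[simp] theorem coeff_neg (P : TwistedPolynomial Fq K) (n : ℕ) :
    (-P).coeff n = -P.coeff n := rfl

@[simp] theorem coeff_sub (P Q : TwistedPolynomial Fq K) (n : ℕ) :
    (P - Q).coeff n = P.coeff n - Q.coeff n := by
  rw [sub_eq_add_neg, coeff_add, coeff_neg, sub_eq_add_neg]

theorem coeff_monomial (m n : ℕ) (c : K) :
    (monomial m c : TwistedPolynomial Fq K).coeff n = if m = n then c else 0 :=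
  SkewPolynomial.coeff_monomial

theorem monomial_mul_monomial (m n : ℕ) (c d : K) :
    (monomial m c * monomial n d : TwistedPolynomial Fq K) =
      monomial (m + n) (c * d ^ (Nat.card Fq ^ m)) := by
  let := frobeniusAction Fq K
  exact SkewMonoidAlgebra.single_mul_single

theorem one_eq_monomial : (1 : TwistedPolynomial Fq K) = monomial 0 1 := rfl

theorem induction_monomial {motive : TwistedPolynomial Fq K → Prop} (P : TwistedPolynomial Fq K)
    (zero : motive 0)
    (monomial_add : ∀ n c Q, motive Q → motive (monomial n c + Q)) : motive P :=
  SkewPolynomial.induction P zero fun n r q _ _ h => monomial_add n r q h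

theorem monomial_zero_right (n : ℕ) : (monomial n 0 : TwistedPolynomial Fq K) = 0 := by
  apply ext_coeff
  intro k
  simp [coeff_monomial]

theorem card_pow_ne_zero (Fq : Type*) [Field Fq] [Finite Fq] (n : ℕ) : Nat.card Fq ^ n ≠ 0 :=
  pow_ne_zero _ Nat.card_pos.ne'

theorem zero_pow_card_pow (Fq K : Type*) [Field Fq] [Finite Fq] [Field K] (n : ℕ) :
    (0 : K) ^ (Nat.card Fq ^ n) = 0 :=
  zero_pow (card_pow_ne_zero Fq n)

theorem coeff_mul (P Q : TwistedPolynomial Fq K) (n : ℕ) :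
    (P * Q).coeff n =
      ∑ x ∈ Finset.HasAntidiagonal.antidiagonal n, P.coeff x.1 * Q.coeff x.2 ^ (Nat.card Fq ^ x.1) := by
  induction P using induction_monomial with
  | zero => simp
  | monomial_add i c P ih =>
    rw [add_mul, coeff_add, ih]
    simp only [coeff_add, add_mul, Finset.sum_add_distrib]
    congr 1
    clear ih P
    induction Q using induction_monomial with
    | zero => simp only [mul_zero, coeff_zero, zero_pow_card_pow, Finset.sum_const_zero]
    | monomial_add j d Q ih =>
      rw [mul_add, coeff_add, ih]
      simp only [coeff_add, add_pow_card_pow, mul_add, Finset.sum_add_distrib]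
      congr 1
      rw [monomial_mul_monomial, coeff_monomial]
      split_ifs with h
      · rw [Finset.sum_eq_single (i, j)]
        · simp [coeff_monomial]
        · rintro ⟨a, b⟩ hab hne
          simp only [Finset.HasAntidiagonal.mem_antidiagonal] at hab
          simp only [coeff_monomial]
          split_ifs with h1 h2
          · exact absurd (by simp [h1, h2]) hne
          · rw [zero_pow_card_pow, mul_zero]
          · simp
          · simp
        · intro h'
          exact absurd (Finset.HasAntidiagonal.mem_antidiagonal.2 h) h'
      · symm
        apply Finset.sum_eq_zero
        rintro ⟨a, b⟩ hab
        simp only [Finset.HasAntidiagonal.mem_antidiagonal] at hab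
        simp only [coeff_monomial]
        split_ifs with h1 h2
        · exact absurd (by rw [h1, h2, hab]) h
        · rw [zero_pow_card_pow, mul_zero]
        · simp
        · simp

theorem mem_support {P : TwistedPolynomial Fq K} {n : ℕ} :
    n ∈ SkewPolynomial.support P ↔ P.coeff n ≠ 0 :=
  SkewPolynomial.mem_support_iff

theorem le_natDegree {P : TwistedPolynomial Fq K} {n : ℕ} (h : P.coeff n ≠ 0) :
    n ≤ P.natDegree :=
  Finset.le_sup (f := id) (mem_support.2 h)

theorem coeff_eq_zero_of_natDegree_lt {P : TwistedPolynomial Fq K} {n : ℕ}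
    (h : P.natDegree < n) : P.coeff n = 0 := by
  by_contra h'
  exact absurd (le_natDegree h') (not_le.2 h)

theorem exists_coeff_ne_zero {P : TwistedPolynomial Fq K} (h : P ≠ 0) : ∃ n, P.coeff n ≠ 0 := by
  by_contra! h'
  exact h (ext_coeff h')

theorem coeff_natDegree_ne_zero {P : TwistedPolynomial Fq K} (h : P ≠ 0) :
    P.coeff P.natDegree ≠ 0 := by
  obtain ⟨n, hn⟩ := exists_coeff_ne_zero h
  obtain ⟨i, hi, h2⟩ := Finset.exists_mem_eq_sup (SkewPolynomial.support P)
    ⟨n, mem_support.2 hn⟩ id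
  have h3 : P.natDegree = i := h2
  rw [h3]
  exact mem_support.1 hi

theorem natDegree_eq {P : TwistedPolynomial Fq K} {n : ℕ} (h : P.coeff n ≠ 0)
    (h' : ∀ m, n < m → P.coeff m = 0) : P.natDegree = n := by
  apply le_antisymm
  · by_contra! h2
    exact coeff_natDegree_ne_zero (fun h0 => h (by rw [h0]; rfl)) (h' _ h2)
  · exact le_natDegree h

theorem coeff_mul_add {P Q : TwistedPolynomial Fq K} {m n : ℕ}
    (hP : ∀ i, m < i → P.coeff i = 0) (hQ : ∀ i, n < i → Q.coeff i = 0) :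
    (P * Q).coeff (m + n) = P.coeff m * Q.coeff n ^ (Nat.card Fq ^ m) := by
  rw [coeff_mul, Finset.sum_eq_single (m, n)]
  · rintro ⟨a, b⟩ hab hne
    simp only [Finset.HasAntidiagonal.mem_antidiagonal] at hab
    rcases lt_trichotomy a m with h | h | h
    · rw [hQ b (by omega)]
      rw [zero_pow_card_pow, mul_zero]
    · exact absurd (by rw [h, show b = n by omega]) hne
    · rw [hP a h, zero_mul]
  · intro h
    simp at h

theorem coeff_mul_of_lt {P Q : TwistedPolynomial Fq K} {m n k : ℕ}
    (hP : ∀ i, m < i → P.coeff i = 0) (hQ : ∀ i, n < i → Q.coeff i = 0) (hk : m + n < k) :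
    (P * Q).coeff k = 0 := by
  rw [coeff_mul]
  apply Finset.sum_eq_zero
  rintro ⟨a, b⟩ hab
  simp only [Finset.HasAntidiagonal.mem_antidiagonal] at hab
  rcases le_or_gt a m with h | h
  · rw [hQ b (by omega)]
    rw [zero_pow_card_pow, mul_zero]
  · rw [hP a h, zero_mul]

theorem coeff_natDegree_mul {P Q : TwistedPolynomial Fq K} :
    (P * Q).coeff (P.natDegree + Q.natDegree) =
      P.coeff P.natDegree * Q.coeff Q.natDegree ^ (Nat.card Fq ^ P.natDegree) :=
  coeff_mul_add (fun _ => coeff_eq_zero_of_natDegree_lt) (fun _ => coeff_eq_zero_of_natDegree_lt)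

instance : NoZeroDivisors (TwistedPolynomial Fq K) where
  eq_zero_or_eq_zero_of_mul_eq_zero {P Q} h := by
    by_contra! h'
    have h1 := coeff_natDegree_mul (P := P) (Q := Q)
    rw [h, coeff_zero] at h1
    exact mul_ne_zero (coeff_natDegree_ne_zero h'.1)
      (pow_ne_zero _ (coeff_natDegree_ne_zero h'.2)) h1.symm

instance : Nontrivial (TwistedPolynomial Fq K) :=
  ⟨0, 1, fun h => by
    have := congrArg (fun P : TwistedPolynomial Fq K => P.coeff 0) h
    simp [one_eq_monomial, coeff_monomial] at this⟩

theorem natDegree_mul {P Q : TwistedPolynomial Fq K} (hP : P ≠ 0) (hQ : Q ≠ 0) :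
    (P * Q).natDegree = P.natDegree + Q.natDegree := by
  apply natDegree_eq
  · rw [coeff_natDegree_mul]
    exact mul_ne_zero (coeff_natDegree_ne_zero hP) (pow_ne_zero _ (coeff_natDegree_ne_zero hQ))
  · intro m hm
    exact coeff_mul_of_lt (fun _ => coeff_eq_zero_of_natDegree_lt)
      (fun _ => coeff_eq_zero_of_natDegree_lt) hm

theorem natDegree_monomial (n : ℕ) {c : K} (hc : c ≠ 0) :
    (monomial n c : TwistedPolynomial Fq K).natDegree = n := by
  apply natDegree_eq
  · simpa [coeff_monomial]
  · intro m hm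
    rw [coeff_monomial, if_neg hm.ne]

theorem natDegree_one : (1 : TwistedPolynomial Fq K).natDegree = 0 := by
  rw [one_eq_monomial]
  exact natDegree_monomial 0 one_ne_zero

theorem natDegree_pow {P : TwistedPolynomial Fq K} (hP : P ≠ 0) (n : ℕ) :
    (P ^ n).natDegree = n * P.natDegree := by
  induction n with
  | zero => simp [natDegree_one]
  | succ n ih => rw [pow_succ, natDegree_mul (pow_ne_zero _ hP) hP, ih, add_mul, one_mul]

/-! ### Values -/

variable {L : Type*} [Field L] [Algebra K L]

theorem eval_eq_sum_range (P : TwistedPolynomial Fq K) {N : ℕ} (hN : P.natDegree < N) (y : L) :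
    P.eval y = ∑ i ∈ Finset.range N, algebraMap K L (P.coeff i) * y ^ (Nat.card Fq ^ i) := by
  apply Finset.sum_subset
  · intro i hi
    exact Finset.mem_range.2 ((le_natDegree (mem_support.1 hi)).trans_lt hN)
  · intro i _ hi
    rw [not_not.1 (fun h => hi (mem_support.2 h)), map_zero, zero_mul]

@[simp] theorem eval_zero_left (y : L) : (0 : TwistedPolynomial Fq K).eval y = 0 := by
  rw [eval_eq_sum_range _ (Nat.lt_succ_self _)]
  simp

theorem eval_add_left (P Q : TwistedPolynomial Fq K) (y : L) :
    (P + Q).eval y = P.eval y + Q.eval y := by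
  set N := (P + Q).natDegree + P.natDegree + Q.natDegree + 1
  rw [eval_eq_sum_range (P + Q) (N := N) (by omega), eval_eq_sum_range P (N := N) (by omega),
    eval_eq_sum_range Q (N := N) (by omega), ← Finset.sum_add_distrib]
  simp [add_mul]

theorem eval_monomial (n : ℕ) (c : K) (y : L) :
    (monomial n c : TwistedPolynomial Fq K).eval y =
      algebraMap K L c * y ^ (Nat.card Fq ^ n) := by
  rw [eval_eq_sum_range _ (N := (monomial n c : TwistedPolynomial Fq K).natDegree + n + 1)
    (by omega), Finset.sum_eq_single n]
  · simp [coeff_monomial]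
  · intro i _ hi
    simp [coeff_monomial, hi.symm]
  · intro h
    exact absurd (Finset.mem_range.2 (by omega)) h

section Additive

variable [Algebra Fq L]

theorem eval_add (P : TwistedPolynomial Fq K) (y z : L) :
    P.eval (y + z) = P.eval y + P.eval z := by
  rw [eval_eq_sum_range P (Nat.lt_succ_self _), eval_eq_sum_range P (Nat.lt_succ_self _),
    eval_eq_sum_range P (Nat.lt_succ_self _), ← Finset.sum_add_distrib]
  refine Finset.sum_congr rfl fun i _ => ?_
  rw [add_pow_card_pow, mul_add]

theorem eval_zero (P : TwistedPolynomial Fq K) : P.eval (0 : L) = 0 := by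
  have := eval_add P (0 : L) 0
  simpa using this

theorem eval_neg (P : TwistedPolynomial Fq K) (y : L) : P.eval (-y) = -P.eval y := by
  have := eval_add P y (-y)
  rw [add_neg_cancel, eval_zero] at this
  exact (neg_eq_of_add_eq_zero_right this.symm).symm

theorem eval_sub (P : TwistedPolynomial Fq K) (y z : L) :
    P.eval (y - z) = P.eval y - P.eval z := by
  rw [sub_eq_add_neg, eval_add, eval_neg, sub_eq_add_neg]

theorem eval_mul (P Q : TwistedPolynomial Fq K) (y : L) :
    (P * Q).eval y = P.eval (Q.eval y) := by
  induction P using induction_monomial with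
  | zero => simp
  | monomial_add i c P ih =>
    rw [add_mul, eval_add_left, eval_add_left, ih]
    congr 1
    clear ih P
    induction Q using induction_monomial with
    | zero => rw [mul_zero, eval_zero_left, eval_zero]
    | monomial_add j d Q ih =>
      rw [mul_add, eval_add_left, ih, eval_add_left, eval_add]
      congr 1
      rw [monomial_mul_monomial, eval_monomial, eval_monomial, eval_monomial, map_mul, map_pow,
        mul_pow, ← pow_mul, mul_assoc, pow_add, mul_comm (Nat.card Fq ^ j)]

theorem eval_one (y : L) : (1 : TwistedPolynomial Fq K).eval y = y := by
  rw [one_eq_monomial, eval_monomial]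
  simp

theorem eval_pow (P : TwistedPolynomial Fq K) (n : ℕ) (y : L) :
    (P ^ n).eval y = (P.eval)^[n] y := by
  induction n generalizing y with
  | zero => rw [pow_zero, eval_one]; rfl
  | succ n ih => rw [pow_succ, eval_mul, ih, Function.iterate_succ_apply]

end Additive

end TwistedPolynomial

end LocalLehmer

end

/-! ### Growth on circles: the Gauss function and ties between terms. -/

noncomputable section

namespace LocalLehmer

set_option linter.unusedSectionVars false

namespace TwistedPolynomial

variable {Fq K : Type*} [Field Fq] [Finite Fq] [Field K] [Algebra Fq K]

theorem one_lt_card (Fq : Type*) [Field Fq] [Finite Fq] : 1 < Nat.card Fq :=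
  Finite.one_lt_card

theorem one_le_card_pow (Fq : Type*) [Field Fq] [Finite Fq] (n : ℕ) : 1 ≤ Nat.card Fq ^ n :=
  Nat.one_le_pow _ _ Nat.card_pos

theorem card_pow_lt (Fq : Type*) [Field Fq] [Finite Fq] {m n : ℕ} (h : m < n) :
    Nat.card Fq ^ m < Nat.card Fq ^ n :=
  Nat.pow_lt_pow_right (one_lt_card Fq) h

/-- The absolute value of the term of index `i` of `P` on the circle of radius `R`. -/
def term (N : AbsoluteValue K ℝ) (P : TwistedPolynomial Fq K) (R : ℝ) (i : ℕ) : ℝ :=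
  N (P.coeff i) * R ^ (Nat.card Fq ^ i)

/-- The maximum of the absolute values of the terms of `P` on the circle of radius `R`. -/
def gauss (N : AbsoluteValue K ℝ) (P : TwistedPolynomial Fq K) (R : ℝ) : ℝ :=
  (Finset.range (P.natDegree + 1)).sup' Finset.nonempty_range_add_one (term N P R)

variable {N : AbsoluteValue K ℝ} {P Q : TwistedPolynomial Fq K} {R : ℝ}

theorem term_nonneg (hR : 0 ≤ R) (i : ℕ) : 0 ≤ term N P R i :=
  mul_nonneg (N.nonneg _) (pow_nonneg hR _)

theorem term_pos (hR : 0 < R) {i : ℕ} (hi : P.coeff i ≠ 0) : 0 < term N P R i :=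
  mul_pos (N.pos hi) (pow_pos hR _)

theorem term_eq_zero {i : ℕ} (hi : P.coeff i = 0) : term N P R i = 0 := by
  rw [term, hi, map_zero, zero_mul]

theorem exists_gauss_eq (N : AbsoluteValue K ℝ) (P : TwistedPolynomial Fq K) (R : ℝ) :
    ∃ i ≤ P.natDegree, gauss N P R = term N P R i := by
  obtain ⟨i, hi, h⟩ := Finset.exists_mem_eq_sup' (s := Finset.range (P.natDegree + 1))
    Finset.nonempty_range_add_one (term N P R)
  exact ⟨i, Nat.lt_succ_iff.1 (Finset.mem_range.1 hi), h⟩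

theorem gauss_nonneg (hR : 0 ≤ R) : 0 ≤ gauss N P R := by
  obtain ⟨i, -, hi⟩ := exists_gauss_eq N P R
  rw [hi]
  exact term_nonneg hR i

theorem term_le_gauss (hR : 0 ≤ R) (i : ℕ) : term N P R i ≤ gauss N P R := by
  rcases lt_or_ge P.natDegree i with h | h
  · rw [term_eq_zero (coeff_eq_zero_of_natDegree_lt h)]
    exact gauss_nonneg hR
  · exact Finset.le_sup' (term N P R) (Finset.mem_range.2 (Nat.lt_succ_of_le h))

theorem gauss_pos (hP : P ≠ 0) (hR : 0 < R) : 0 < gauss N P R :=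
  (term_pos hR (coeff_natDegree_ne_zero hP)).trans_le (term_le_gauss hR.le _)

theorem gauss_le {B : ℝ} (h : ∀ i, term N P R i ≤ B) : gauss N P R ≤ B := by
  obtain ⟨i, -, hi⟩ := exists_gauss_eq N P R
  rw [hi]
  exact h i

theorem gauss_lt {B : ℝ} (h : ∀ i, term N P R i < B) : gauss N P R < B := by
  obtain ⟨i, -, hi⟩ := exists_gauss_eq N P R
  rw [hi]
  exact h i

theorem coeff_ne_zero_of_gauss_eq (hP : P ≠ 0) (hR : 0 < R) {i : ℕ}
    (h : gauss N P R = term N P R i) : P.coeff i ≠ 0 := fun h0 => by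
  rw [term_eq_zero h0] at h
  exact (gauss_pos hP hR).ne' h

theorem gauss_mono {R' : ℝ} (hR : 0 ≤ R) (h : R ≤ R') : gauss N P R ≤ gauss N P R' := by
  apply gauss_le
  intro i
  refine le_trans ?_ (term_le_gauss (hR.trans h) i)
  exact mul_le_mul_of_nonneg_left (pow_le_pow_left₀ hR h _) (N.nonneg _)

theorem gauss_strictMono {R' : ℝ} (hP : P ≠ 0) (hR : 0 < R) (h : R < R') :
    gauss N P R < gauss N P R' := by
  obtain ⟨i, -, hi⟩ := exists_gauss_eq N P R
  rw [hi]
  refine lt_of_lt_of_le ?_ (term_le_gauss (hR.trans h).le i)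
  exact mul_lt_mul_of_pos_left (pow_lt_pow_left₀ h hR.le (card_pow_ne_zero Fq i))
    (N.pos (coeff_ne_zero_of_gauss_eq hP hR hi))

/-- Two terms of `P` have the same absolute value on the circle of radius `R`. -/
def Tie (N : AbsoluteValue K ℝ) (P : TwistedPolynomial Fq K) (R : ℝ) : Prop :=
  ∃ i j, i < j ∧ P.coeff i ≠ 0 ∧ P.coeff j ≠ 0 ∧ term N P R i = term N P R j

theorem term_lt_of_not_tie (hP : P ≠ 0) (hR : 0 < R) (h : ¬ Tie N P R) {i : ℕ}
    (hi : gauss N P R = term N P R i) {j : ℕ} (hj : j ≠ i) : term N P R j < term N P R i := by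
  rw [← hi]
  refine lt_of_le_of_ne (term_le_gauss hR.le j) fun h' => h ?_
  have h1 := coeff_ne_zero_of_gauss_eq hP hR hi
  have h2 := coeff_ne_zero_of_gauss_eq hP hR h'.symm
  rcases lt_or_gt_of_ne hj with h3 | h3
  · exact ⟨j, i, h3, h2, h1, h'.trans hi⟩
  · exact ⟨i, j, h3, h1, h2, (h'.trans hi).symm⟩

/-- Terms of different indices are monomials in `R` of different degrees, so each of the finitely
many pairs is equal at one positive radius at most. -/
theorem finite_tie (N : AbsoluteValue K ℝ) (P : TwistedPolynomial Fq K) :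
    {R : ℝ | 0 < R ∧ Tie N P R}.Finite := by
  have : {R : ℝ | 0 < R ∧ Tie N P R} ⊆
      ⋃ i ∈ Finset.range (P.natDegree + 1), ⋃ j ∈ Finset.range (P.natDegree + 1),
        {R : ℝ | 0 < R ∧ i < j ∧ P.coeff i ≠ 0 ∧ P.coeff j ≠ 0 ∧
          term N P R i = term N P R j} := by
    rintro R ⟨hR, i, j, hij, hi, hj, h⟩
    simp only [Set.mem_iUnion]
    exact ⟨i, Finset.mem_range.2 (Nat.lt_succ_of_le (le_natDegree hi)), j,
      Finset.mem_range.2 (Nat.lt_succ_of_le (le_natDegree hj)), hR, hij, hi, hj, h⟩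
  refine Set.Finite.subset (Set.Finite.biUnion (Finset.finite_toSet _) fun i _ =>
    Set.Finite.biUnion (Finset.finite_toSet _) fun j _ => Set.Subsingleton.finite ?_) this
  rintro R ⟨hR, hij, hi, hj, h⟩ R' ⟨hR', -, -, -, h'⟩
  have key : ∀ S : ℝ, 0 < S → term N P S i = term N P S j →
      S ^ (Nat.card Fq ^ j - Nat.card Fq ^ i) = N (P.coeff i) / N (P.coeff j) := by
    intro S hS hT
    rw [eq_div_iff (N.pos hj).ne', mul_comm]
    apply mul_right_cancel₀ (pow_pos hS (Nat.card Fq ^ i)).ne'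
    rw [mul_assoc, ← pow_add, Nat.sub_add_cancel (card_pow_lt Fq hij).le]
    exact hT.symm
  have hk := (key R hR h).trans (key R' hR' h').symm
  exact (pow_left_inj₀ hR.le hR'.le (Nat.sub_ne_zero_of_lt (card_pow_lt Fq hij))).1 hk

theorem eventually_term_lt (N : AbsoluteValue K ℝ) (hP : P ≠ 0) :
    ∀ᶠ R in atTop, ∀ j, j ≠ P.natDegree → term N P R j < term N P R P.natDegree := by
  have h1 : ∀ᶠ R : ℝ in atTop, ∀ j ∈ Finset.range P.natDegree,
      N (P.coeff j) / N (P.coeff P.natDegree) < R :=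
    (Filter.eventually_all_finset _).2 fun j _ => eventually_gt_atTop _
  filter_upwards [h1, eventually_ge_atTop 1] with R hR hR1 j hj
  have hpos := N.pos (coeff_natDegree_ne_zero hP)
  have hR0 : 0 < R := by linarith
  rcases lt_or_gt_of_ne hj with h | h
  · have h2 := hR j (Finset.mem_range.2 h)
    rw [div_lt_iff₀ hpos] at h2
    have h3 := card_pow_lt Fq h
    have h4 : Nat.card Fq ^ P.natDegree =
        (Nat.card Fq ^ P.natDegree - Nat.card Fq ^ j) + Nat.card Fq ^ j := by omega
    have h5 : R ≤ R ^ (Nat.card Fq ^ P.natDegree - Nat.card Fq ^ j) :=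
      le_self_pow₀ hR1 (by omega)
    rw [term, term, h4, pow_add, ← mul_assoc]
    refine mul_lt_mul_of_pos_right ?_ (pow_pos hR0 _)
    rw [mul_comm]
    exact h2.trans_le (mul_le_mul_of_nonneg_right h5 hpos.le)
  · rw [term_eq_zero (coeff_eq_zero_of_natDegree_lt h)]
    exact term_pos hR0 (coeff_natDegree_ne_zero hP)

/-! ### Absolute values of the values of a twisted polynomial -/

section Eval

variable {L : Type*} [Field L] [Algebra K L] {NL : AbsoluteValue L ℝ}

theorem abs_term (hN : ∀ c, NL (algebraMap K L c) = N c) (P : TwistedPolynomial Fq K) (y : L)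
    (i : ℕ) : NL (algebraMap K L (P.coeff i) * y ^ (Nat.card Fq ^ i)) = term N P (NL y) i := by
  rw [map_mul, map_pow, hN, term]

theorem abs_eval_le (hNL : IsNonarchimedean NL) (hN : ∀ c, NL (algebraMap K L c) = N c)
    (P : TwistedPolynomial Fq K) (y : L) : NL (P.eval y) ≤ gauss N P (NL y) := by
  rw [eval_eq_sum_range P (Nat.lt_succ_self _)]
  obtain ⟨i, -, hi⟩ := hNL.finset_image_add_of_nonempty
    (fun i => algebraMap K L (P.coeff i) * y ^ (Nat.card Fq ^ i))
    (t := Finset.range (P.natDegree + 1)) Finset.nonempty_range_add_one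
  refine hi.trans ?_
  rw [abs_term hN]
  exact term_le_gauss (NL.nonneg _) i

theorem abs_eval_eq (hNL : IsNonarchimedean NL) (hN : ∀ c, NL (algebraMap K L c) = N c)
    {P : TwistedPolynomial Fq K} {y : L} {i : ℕ}
    (h : ∀ j, j ≠ i → term N P (NL y) j < term N P (NL y) i) :
    NL (P.eval y) = term N P (NL y) i := by
  rw [eval_eq_sum_range P (N := P.natDegree + i + 1) (by omega),
    hNL.apply_sum_eq_of_lt (fun a => (map_neg_eq_map NL a).symm) (k := i)
      (Finset.mem_range.2 (by omega)), abs_term hN]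
  intro j _ hj
  rw [abs_term hN, abs_term hN]
  exact h j hj

/-- Without a tie a single term dominates strictly, hence no cancellation is possible. -/
theorem abs_eval_of_not_tie (hNL : IsNonarchimedean NL)
    (hN : ∀ c, NL (algebraMap K L c) = N c) (hP : P ≠ 0) {y : L} (hy : 0 < NL y)
    (h : ¬ Tie N P (NL y)) : NL (P.eval y) = gauss N P (NL y) := by
  obtain ⟨i, -, hi⟩ := exists_gauss_eq N P (NL y)
  rw [hi]
  exact abs_eval_eq hNL hN fun j hj => term_lt_of_not_tie hP hy h hi hj

end Eval

/-! ### Products -/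

theorem exists_last_gauss_eq (hP : P ≠ 0) (hR : 0 < R) :
    ∃ i, gauss N P R = term N P R i ∧ ∀ j, i < j → term N P R j < gauss N P R := by
  classical
  set S := (Finset.range (P.natDegree + 1)).filter (fun i => gauss N P R = term N P R i)
  have hS : S.Nonempty := by
    obtain ⟨i, h1, h2⟩ := exists_gauss_eq N P R
    exact ⟨i, Finset.mem_filter.2 ⟨Finset.mem_range.2 (Nat.lt_succ_of_le h1), h2⟩⟩
  refine ⟨S.max' hS, (Finset.mem_filter.1 (S.max'_mem hS)).2, fun j hj => ?_⟩
  refine lt_of_le_of_ne (term_le_gauss hR.le j) fun h => ?_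
  have : j ∈ S := Finset.mem_filter.2 ⟨Finset.mem_range.2 (Nat.lt_succ_of_le
    (le_natDegree (coeff_ne_zero_of_gauss_eq hP hR h.symm))), h.symm⟩
  exact absurd (S.le_max' j this) (not_le.2 hj)

/-- Gauss's lemma for composition. For `≥`, let `i` and `j` be the last indices at which the maxima
for `P` (at the radius `gauss N Q R`) and for `Q` (at `R`) are attained. In the coefficient of
`τ^(i+j)` the pair `(i, j)` dominates strictly, since any other pair exceeds `i` or exceeds `j`. -/
theorem gauss_mul (hNa : IsNonarchimedean N) (hP : P ≠ 0) (hQ : Q ≠ 0) (hR : 0 < R) :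
    gauss N (P * Q) R = gauss N P (gauss N Q R) := by
  have hQR := gauss_pos (N := N) hQ hR
  have hterm : ∀ i j, N (P.coeff i * Q.coeff j ^ (Nat.card Fq ^ i)) * R ^ (Nat.card Fq ^ (i + j)) =
      N (P.coeff i) * term N Q R j ^ (Nat.card Fq ^ i) := by
    intro i j
    rw [term, map_mul, map_pow, mul_pow, ← pow_mul, pow_add, mul_comm (Nat.card Fq ^ i), mul_assoc]
  have hle : ∀ i j, N (P.coeff i) * term N Q R j ^ (Nat.card Fq ^ i) ≤ gauss N P (gauss N Q R) :=
    fun i j => le_trans (mul_le_mul_of_nonneg_left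
      (pow_le_pow_left₀ (term_nonneg hR.le j) (term_le_gauss hR.le j) _) (N.nonneg _))
      (term_le_gauss hQR.le i)
  apply le_antisymm
  · apply gauss_le
    intro n
    rw [term, coeff_mul]
    obtain ⟨x, hx, h⟩ := hNa.finset_image_add_of_nonempty
      (fun x : ℕ × ℕ => P.coeff x.1 * Q.coeff x.2 ^ (Nat.card Fq ^ x.1))
      (t := Finset.HasAntidiagonal.antidiagonal n)
      ⟨(0, n), Finset.HasAntidiagonal.mem_antidiagonal.2 (by simp)⟩
    refine (mul_le_mul_of_nonneg_right h (pow_nonneg hR.le _)).trans ?_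
    rw [← Finset.HasAntidiagonal.mem_antidiagonal.1 hx, hterm]
    exact hle _ _
  · obtain ⟨i, hi, hi'⟩ := exists_last_gauss_eq (N := N) hP hQR
    obtain ⟨j, hj, hj'⟩ := exists_last_gauss_eq (N := N) hQ hR
    have hP0 := coeff_ne_zero_of_gauss_eq hP hQR hi
    refine le_of_eq_of_le ?_ (term_le_gauss hR.le (i + j))
    rw [term, coeff_mul, hNa.apply_sum_eq_of_lt (fun a => (map_neg_eq_map N a).symm) (k := (i, j))
      (Finset.HasAntidiagonal.mem_antidiagonal.2 rfl), hterm, hi, ← hj, term]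
    rintro ⟨a, b⟩ hab hne
    have hab' : a + b = i + j := Finset.HasAntidiagonal.mem_antidiagonal.1 hab
    refine lt_of_mul_lt_mul_right ?_ (pow_nonneg hR.le (Nat.card Fq ^ (i + j)))
    rw [hterm i j]
    dsimp only
    rw [← hab', hterm a b, ← hj]
    change _ < term N P (gauss N Q R) i
    rw [← hi]
    rcases lt_trichotomy a i with h | h | h
    · have hb := hj' b (by omega)
      rcases eq_or_ne (P.coeff a) 0 with h0 | h0
      · rw [h0, map_zero, zero_mul]
        exact gauss_pos hP hQR
      · refine lt_of_lt_of_le ?_ (term_le_gauss hQR.le a)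
        exact mul_lt_mul_of_pos_left (pow_lt_pow_left₀ hb (term_nonneg hR.le b)
          (card_pow_ne_zero Fq a)) (N.pos h0)
    · exact absurd (by rw [h, show b = j by omega]) hne
    · refine lt_of_le_of_lt ?_ (hi' a h)
      exact mul_le_mul_of_nonneg_left
        (pow_le_pow_left₀ (term_nonneg hR.le b) (term_le_gauss hR.le b) _) (N.nonneg _)

theorem gauss_one (hR : 0 < R) : gauss N (1 : TwistedPolynomial Fq K) R = R := by
  have h : ∀ i, term N (1 : TwistedPolynomial Fq K) R i = if i = 0 then R else 0 := by
    intro i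
    rw [term, one_eq_monomial, coeff_monomial]
    rcases eq_or_ne i 0 with rfl | hi
    · simp
    · simp [hi, hi.symm]
  apply le_antisymm
  · apply gauss_le
    intro i
    rw [h]
    split_ifs
    · exact le_rfl
    · exact hR.le
  · have := term_le_gauss (N := N) (P := (1 : TwistedPolynomial Fq K)) hR.le 0
    rwa [h, if_pos rfl] at this

theorem gauss_pow (hNa : IsNonarchimedean N) (hP : P ≠ 0) (n : ℕ) (hR : 0 < R) :
    gauss N (P ^ n) R = (gauss N P)^[n] R := by
  induction n generalizing R with
  | zero => exact gauss_one hR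
  | succ n ih =>
    rw [pow_succ, gauss_mul hNa (pow_ne_zero _ hP) hP hR, ih (gauss_pos hP hR),
      Function.iterate_succ_apply]

end TwistedPolynomial

end LocalLehmer

end

noncomputable section

namespace LocalLehmer

set_option linter.unusedSectionVars false

/-! ### Tate's limiting procedure -/

/-- The limit of `ℓ (f ^ n y) / Q ^ n`. -/
def tateLimit {X : Type*} (ℓ : X → ℝ) (f : X → X) (Q : ℝ) (y : X) : ℝ :=
  limUnder atTop fun n : ℕ => ℓ (f^[n] y) / Q ^ n

section TateLimit

variable {X : Type*} {ℓ : X → ℝ} {f g : X → X} {Q Q' c c' : ℝ}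

theorem dist_tate_le (hQ : 2 ≤ Q) (h : ∀ y, |ℓ (f y) - Q * ℓ y| ≤ c) (y : X) (n : ℕ) :
    dist (ℓ (f^[n] y) / Q ^ n) (ℓ (f^[n + 1] y) / Q ^ (n + 1)) ≤ c / Q * (1 / Q) ^ n := by
  have hQ0 : 0 < Q := by linarith
  rw [Function.iterate_succ_apply', dist_comm, Real.dist_eq]
  have : ℓ (f (f^[n] y)) / Q ^ (n + 1) - ℓ (f^[n] y) / Q ^ n =
      (ℓ (f (f^[n] y)) - Q * ℓ (f^[n] y)) / Q ^ (n + 1) := by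
    field_simp
    ring
  rw [this, abs_div, abs_of_pos (pow_pos hQ0 _)]
  refine (div_le_div_of_nonneg_right (h _) (pow_pos hQ0 _).le).trans (le_of_eq ?_)
  rw [one_div, inv_pow]
  field_simp
  ring

theorem tendsto_tateLimit (hQ : 2 ≤ Q) (h : ∀ y, |ℓ (f y) - Q * ℓ y| ≤ c) (y : X) :
    Tendsto (fun n : ℕ => ℓ (f^[n] y) / Q ^ n) atTop (𝓝 (tateLimit ℓ f Q y)) := by
  have h1 : 1 / Q < 1 := by
    rw [div_lt_one (by linarith)]
    linarith
  exact (cauchySeq_of_le_geometric _ _ h1 (dist_tate_le hQ h y)).tendsto_limUnder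

/-- The telescoping series sums to at most `c / (Q - 1)`, and `Q ≥ 2`. -/
theorem abs_tateLimit_sub_le (hQ : 2 ≤ Q) (h : ∀ y, |ℓ (f y) - Q * ℓ y| ≤ c) (y : X) :
    |tateLimit ℓ f Q y - ℓ y| ≤ c := by
  have hc : 0 ≤ c := (abs_nonneg _).trans (h y)
  have h1 : 1 / Q < 1 := by
    rw [div_lt_one (by linarith)]
    linarith
  have h2 := dist_le_of_le_geometric_of_tendsto₀ _ _ h1 (dist_tate_le hQ h y)
    (tendsto_tateLimit hQ h y)
  simp only [Function.iterate_zero, id, pow_zero, div_one] at h2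
  rw [dist_comm, Real.dist_eq] at h2
  refine h2.trans ?_
  have : c / Q / (1 - 1 / Q) = c / (Q - 1) := by
    have : Q - 1 ≠ 0 := by linarith
    have : Q ≠ 0 := by linarith
    field_simp
  rw [this]
  exact div_le_self hc (by linarith)

theorem tateLimit_nonneg (hQ : 2 ≤ Q) (h : ∀ y, |ℓ (f y) - Q * ℓ y| ≤ c) (hl : ∀ y, 0 ≤ ℓ y)
    (y : X) : 0 ≤ tateLimit ℓ f Q y :=
  ge_of_tendsto' (tendsto_tateLimit hQ h y) fun n =>
    div_nonneg (hl _) (pow_nonneg (by linarith) n)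

theorem tendsto_const_div_pow (hQ : 2 ≤ Q) (B : ℝ) :
    Tendsto (fun n : ℕ => B / Q ^ n) atTop (𝓝 0) :=
  tendsto_const_nhds.div_atTop (tendsto_pow_atTop_atTop_of_one_lt (by linarith))

theorem tateLimit_eq_zero (hQ : 2 ≤ Q) (h : ∀ y, |ℓ (f y) - Q * ℓ y| ≤ c) (hl : ∀ y, 0 ≤ ℓ y)
    {y : X} {B : ℝ} (hB : ∀ n, ℓ (f^[n] y) ≤ B) : tateLimit ℓ f Q y = 0 := by
  refine le_antisymm ?_ (tateLimit_nonneg hQ h hl y)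
  refine le_of_tendsto_of_tendsto' (tendsto_tateLimit hQ h y) (tendsto_const_div_pow hQ B) ?_
  exact fun n => div_le_div_of_nonneg_right (hB n) (pow_nonneg (by linarith) n)

/-- By commutation `ℓ (f^n (g y)) = ℓ (g (f^n y))`, which is `Q' ℓ (f^n y)` up to `c'`; the error
disappears after division by `Q^n`. -/
theorem tateLimit_apply (hQ : 2 ≤ Q) (h : ∀ y, |ℓ (f y) - Q * ℓ y| ≤ c)
    (h' : ∀ y, |ℓ (g y) - Q' * ℓ y| ≤ c') (hfg : Function.Commute f g) (y : X) :
    tateLimit ℓ f Q (g y) = Q' * tateLimit ℓ f Q y := by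
  refine tendsto_nhds_unique (tendsto_tateLimit hQ h (g y)) ?_
  have h1 := (tendsto_tateLimit hQ h y).const_mul Q'
  have h2 : Tendsto (fun n : ℕ => ℓ (f^[n] (g y)) / Q ^ n - Q' * (ℓ (f^[n] y) / Q ^ n))
      atTop (𝓝 0) := by
    refine squeeze_zero_norm (fun n => ?_) (tendsto_const_div_pow hQ c')
    have hp : 0 < Q ^ n := pow_pos (by linarith) n
    rw [(hfg.iterate_left n).eq, Real.norm_eq_abs, ← mul_div_assoc, ← sub_div, abs_div,
      abs_of_pos hp]
    exact div_le_div_of_nonneg_right (h' _) hp.le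
  simpa using h2.add h1

theorem tateLimit_iterate (hQ : 2 ≤ Q) (h : ∀ y, |ℓ (f y) - Q * ℓ y| ≤ c)
    (h' : ∀ y, |ℓ (g y) - Q' * ℓ y| ≤ c') (hfg : Function.Commute f g) (n : ℕ) (y : X) :
    tateLimit ℓ f Q (g^[n] y) = Q' ^ n * tateLimit ℓ f Q y := by
  induction n with
  | zero => simp
  | succ n ih =>
    rw [Function.iterate_succ_apply', tateLimit_apply hQ h h' hfg, ih]
    ring

/-- The limit along `f` stays within `c` of `ℓ` and is multiplied by `Q'` under `g`. Comparing both
at `g^n y` and dividing by `Q'^n` identifies it with the limit along `g`. This is why the local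
height does not depend on the chosen element of `A`. -/
theorem tateLimit_eq_of_commute (hQ : 2 ≤ Q) (h : ∀ y, |ℓ (f y) - Q * ℓ y| ≤ c) (hQ' : 2 ≤ Q')
    (h' : ∀ y, |ℓ (g y) - Q' * ℓ y| ≤ c') (hfg : Function.Commute f g) (y : X) :
    tateLimit ℓ g Q' y = tateLimit ℓ f Q y := by
  refine tendsto_nhds_unique (tendsto_tateLimit hQ' h' y) ?_
  have h2 : Tendsto (fun n : ℕ => ℓ (g^[n] y) / Q' ^ n - tateLimit ℓ f Q y) atTop (𝓝 0) := by
    refine squeeze_zero_norm (fun n => ?_) (tendsto_const_div_pow hQ' c)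
    have hp : 0 < Q' ^ n := pow_pos (by linarith) n
    have h3 := abs_tateLimit_sub_le hQ h (g^[n] y)
    rw [tateLimit_iterate hQ h h' hfg] at h3
    rw [Real.norm_eq_abs, ← mul_div_cancel_left₀ (tateLimit ℓ f Q y) hp.ne', ← sub_div, abs_div,
      abs_of_pos hp, abs_sub_comm]
    exact div_le_div_of_nonneg_right h3 hp.le
  simpa using h2.add_const (tateLimit ℓ f Q y)

theorem tateLimit_le_max [Add X] (hQ : 2 ≤ Q) (h : ∀ y, |ℓ (f y) - Q * ℓ y| ≤ c)
    (hadd : ∀ y z, f (y + z) = f y + f z) (hl : ∀ y z, ℓ (y + z) ≤ max (ℓ y) (ℓ z)) (y z : X) :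
    tateLimit ℓ f Q (y + z) ≤ max (tateLimit ℓ f Q y) (tateLimit ℓ f Q z) := by
  refine le_of_tendsto_of_tendsto' (tendsto_tateLimit hQ h (y + z))
    ((tendsto_tateLimit hQ h y).max (tendsto_tateLimit hQ h z)) fun n => ?_
  have hit : ∀ n : ℕ, f^[n] (y + z) = f^[n] y + f^[n] z := by
    intro n
    induction n with
    | zero => rfl
    | succ n ih => rw [Function.iterate_succ_apply', ih, hadd, Function.iterate_succ_apply',
        Function.iterate_succ_apply']
  have hp : 0 ≤ Q ^ n := pow_nonneg (by linarith) n
  rw [max_div_div_right hp, hit]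
  exact div_le_div_of_nonneg_right (hl _ _) hp

end TateLimit

/-! ### The canonical height of a twisted polynomial -/

open Real

namespace TwistedPolynomial

variable {Fq K : Type*} [Field Fq] [Finite Fq] [Field K] [Algebra Fq K]
  {N : AbsoluteValue K ℝ} {P Q : TwistedPolynomial Fq K}

/-- Beyond a radius `B` the leading term dominates; inside it both quantities are bounded. What
matters is that `c` depends on `P` and `N` alone, not on the extension `L` or its absolute value. -/
theorem exists_bound_posLog_eval.{u} (N : AbsoluteValue K ℝ) (hP : P ≠ 0) :
    ∃ c : ℝ, 0 ≤ c ∧ ∀ (L : Type u) [Field L] [Algebra K L] (NL : AbsoluteValue L ℝ),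
      IsNonarchimedean NL → (∀ a, NL (algebraMap K L a) = N a) → ∀ y : L,
        |log⁺ (NL (P.eval y)) - (Nat.card Fq : ℝ) ^ P.natDegree * log⁺ (NL y)| ≤ c := by
  obtain ⟨B, hB1, hB⟩ := ((eventually_ge_atTop (1 : ℝ)).and
    (eventually_forall_ge_atTop.2 (eventually_term_lt N hP))).exists
  set D : ℝ := (Nat.card Fq : ℝ) ^ P.natDegree with hD
  have hD0 : 0 ≤ D := pow_nonneg (Nat.cast_nonneg _) _
  set l := N (P.coeff P.natDegree)
  have hl : 0 < l := N.pos (coeff_natDegree_ne_zero hP)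
  have hg0 := posLog_nonneg (x := gauss N P B)
  have hDB : 0 ≤ D * log⁺ B := mul_nonneg hD0 posLog_nonneg
  refine ⟨|log l| + log⁺ (gauss N P B) + D * log⁺ B, by positivity, ?_⟩
  intro L _ _ NL hNL hN y
  have hy0 := NL.nonneg y
  rcases le_or_gt B (NL y) with h | h
  · rw [abs_eval_eq hNL hN (hB _ h)]
    have hy1 : 1 ≤ NL y := hB1.trans h
    have hlog : 0 ≤ D * log (NL y) := mul_nonneg hD0 (log_nonneg hy1)
    rw [term, posLog_eq_log (x := NL y) (by rwa [abs_of_nonneg hy0]), posLog_apply,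
      log_mul hl.ne' (pow_pos (by linarith) _).ne', log_pow, Nat.cast_pow, ← hD]
    have : |max 0 (log l + D * log (NL y)) - D * log (NL y)| ≤ |log l| := by
      rcases max_cases 0 (log l + D * log (NL y)) with ⟨h1, h2⟩ | ⟨h1, h2⟩ <;> rw [h1]
      · rw [zero_sub, abs_neg, abs_of_nonneg hlog]
        linarith [neg_abs_le (log l)]
      · simp
    linarith
  · have h1 : log⁺ (NL (P.eval y)) ≤ log⁺ (gauss N P B) :=
      posLog_le_posLog (NL.nonneg _)
        ((abs_eval_le hNL hN P y).trans (gauss_mono hy0 h.le))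
    have h2 : D * log⁺ (NL y) ≤ D * log⁺ B :=
      mul_le_mul_of_nonneg_left (posLog_le_posLog hy0 h.le) hD0
    have h3 : 0 ≤ D * log⁺ (NL y) := mul_nonneg hD0 posLog_nonneg
    have h4 := posLog_nonneg (x := NL (P.eval y))
    have h5 := abs_nonneg (log l)
    rw [abs_le]
    constructor <;> linarith

variable {L : Type*} [Field L] [Algebra K L]

/-- The limit of `log⁺ |P ^ n (y)| / q ^ (n deg P)`. -/
def height (NL : AbsoluteValue L ℝ) (P : TwistedPolynomial Fq K) (y : L) : ℝ :=
  tateLimit (fun z => log⁺ (NL z)) P.eval ((Nat.card Fq : ℝ) ^ P.natDegree) y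

theorem two_le_card_pow (Fq : Type*) [Field Fq] [Finite Fq] {d : ℕ} (hd : d ≠ 0) :
    (2 : ℝ) ≤ (Nat.card Fq : ℝ) ^ d := by
  have h1 : (2 : ℝ) ≤ Nat.card Fq := by exact_mod_cast one_lt_card Fq
  exact h1.trans (le_self_pow₀ (by linarith) hd)

theorem commute_eval [Algebra Fq L] (h : Commute P Q) :
    Function.Commute (P.eval (L := L)) Q.eval := by
  intro y
  rw [← eval_mul, ← eval_mul, h.eq]

section Height

variable {NL : AbsoluteValue L ℝ} {c : ℝ}

theorem posLog_add_le_max (hNL : IsNonarchimedean NL) (y z : L) :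
    log⁺ (NL (y + z)) ≤ max (log⁺ (NL y)) (log⁺ (NL z)) := by
  rcases le_max_iff.1 (hNL y z) with h | h
  · exact le_max_of_le_left (posLog_le_posLog (NL.nonneg _) h)
  · exact le_max_of_le_right (posLog_le_posLog (NL.nonneg _) h)

variable (hP : P ≠ 0) (hd : P.natDegree ≠ 0) (hNL : IsNonarchimedean NL)
  (hN : ∀ a, NL (algebraMap K L a) = N a)

include hP hd hNL hN

theorem height_nonneg (y : L) : 0 ≤ height NL P y := by
  obtain ⟨c, -, hc⟩ := exists_bound_posLog_eval N hP
  exact tateLimit_nonneg (two_le_card_pow Fq hd) (hc L NL hNL hN) (fun _ => posLog_nonneg) y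

theorem height_eq_zero_of_bounded {y : L} {B : ℝ} (hB : ∀ n, NL (P.eval^[n] y) ≤ B) :
    height NL P y = 0 := by
  obtain ⟨c, -, hc⟩ := exists_bound_posLog_eval N hP
  exact tateLimit_eq_zero (two_le_card_pow Fq hd) (hc L NL hNL hN) (fun _ => posLog_nonneg)
    (fun n => posLog_le_posLog (NL.nonneg _) (hB n))

theorem height_iterate [Algebra Fq L] (n : ℕ) (y : L) :
    height NL P (P.eval^[n] y) = ((Nat.card Fq : ℝ) ^ P.natDegree) ^ n * height NL P y := by
  obtain ⟨c, -, hc⟩ := exists_bound_posLog_eval N hP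
  exact tateLimit_iterate (two_le_card_pow Fq hd) (hc L NL hNL hN) (hc L NL hNL hN)
    (Function.Commute.refl _) n y

theorem height_eq_of_commute [Algebra Fq L] (hQ : Q ≠ 0) (hd' : Q.natDegree ≠ 0)
    (h : Commute P Q) (y : L) : height NL Q y = height NL P y := by
  obtain ⟨c, -, hc⟩ := exists_bound_posLog_eval N hP
  obtain ⟨c', -, hc'⟩ := exists_bound_posLog_eval N hQ
  exact tateLimit_eq_of_commute (two_le_card_pow Fq hd) (hc L NL hNL hN)
    (two_le_card_pow Fq hd') (hc' L NL hNL hN) (commute_eval h) y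

theorem height_add_le_max [Algebra Fq L] (y z : L) :
    height NL P (y + z) ≤ max (height NL P y) (height NL P z) := by
  obtain ⟨c, -, hc⟩ := exists_bound_posLog_eval N hP
  exact tateLimit_le_max (two_le_card_pow Fq hd) (hc L NL hNL hN) (eval_add P)
    (posLog_add_le_max hNL) y z

theorem height_neg [Algebra Fq L] (y : L) : height NL P (-y) = height NL P y := by
  have hit : ∀ n : ℕ, P.eval^[n] (-y) = -P.eval^[n] y := by
    intro n
    induction n with
    | zero => rfl
    | succ n ih => rw [Function.iterate_succ_apply', ih, eval_neg, Function.iterate_succ_apply']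
  simp only [height, tateLimit, hit, map_neg_eq_map]

theorem height_sub_le_max [Algebra Fq L] (y z : L) :
    height NL P (y - z) ≤ max (height NL P y) (height NL P z) := by
  rw [sub_eq_add_neg, ← height_neg hP hd hNL hN z]
  exact height_add_le_max hP hd hNL hN y (-z)

theorem abs_height_sub_le (hc : ∀ y : L,
      |log⁺ (NL (P.eval y)) - (Nat.card Fq : ℝ) ^ P.natDegree * log⁺ (NL y)| ≤ c) (y : L) :
    |height NL P y - log⁺ (NL y)| ≤ c :=
  abs_tateLimit_sub_le (two_le_card_pow Fq hd) hc y

theorem tendsto_height (y : L) :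
    Tendsto (fun n : ℕ => log⁺ (NL (P.eval^[n] y)) / ((Nat.card Fq : ℝ) ^ P.natDegree) ^ n) atTop
      (𝓝 (height NL P y)) := by
  obtain ⟨c, -, hc⟩ := exists_bound_posLog_eval N hP
  exact tendsto_tateLimit (two_le_card_pow Fq hd) (hc L NL hNL hN) y

end Height

end TwistedPolynomial

end LocalLehmer

end

noncomputable section

namespace LocalLehmer

set_option linter.unusedSectionVars false

/-! ### Extension of a nonarchimedean absolute value to the algebraic closure -/

/-- The valuation ring of a nonarchimedean absolute value. -/
def unitBall {L : Type*} [Field L] (N : AbsoluteValue L ℝ) (hN : IsNonarchimedean N) :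
    ValuationSubring L where
  carrier := {y | N y ≤ 1}
  mul_mem' {a b} ha hb := by
    change N (a * b) ≤ 1
    rw [map_mul]
    exact mul_le_one₀ ha (N.nonneg b) hb
  one_mem' := (map_one N).le
  add_mem' {a b} ha hb := (hN a b).trans (max_le ha hb)
  zero_mem' := by simp
  neg_mem' {a} ha := by simpa using ha
  mem_or_inv_mem' a := by
    change N a ≤ 1 ∨ N a⁻¹ ≤ 1
    rw [map_inv₀]
    rcases le_total (N a) 1 with h | h
    · exact Or.inl h
    · exact Or.inr (inv_le_one_of_one_le₀ h)

/-- The image of the unit ball in `Ω` is dominated by a valuation ring. Only comparisons of absolute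
values are needed later, so its value group is left arbitrary. -/
theorem exists_valuation_extension {L : Type*} [Field L] (N : AbsoluteValue L ℝ)
    (hN : IsNonarchimedean N) (Ω : Type*) [Field Ω] [Algebra L Ω] :
    ∃ V : ValuationSubring Ω, ∀ a b : L,
      V.valuation (algebraMap L Ω a) ≤ V.valuation (algebraMap L Ω b) ↔ N a ≤ N b := by
  obtain ⟨V, hV, hloc⟩ := IsLocalRing.exists_factor_valuationRing
    ((algebraMap L Ω).comp (unitBall N hN).subtype)
  have h1 : ∀ y : L, N y ≤ 1 → V.valuation (algebraMap L Ω y) ≤ 1 := fun y hy =>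
    (V.valuation_le_one_iff _).2 (hV ⟨y, hy⟩)
  have h2 : ∀ y : L, N y < 1 → V.valuation (algebraMap L Ω y) < 1 := by
    intro y hy
    have hm : ¬ IsUnit (⟨y, hy.le⟩ : unitBall N hN) := by
      intro hu
      obtain ⟨⟨z, hz⟩, hyz⟩ := hu.exists_right_inv
      have h3 : y * z = 1 := congrArg Subtype.val hyz
      have h4 := congrArg N h3
      rw [map_mul, map_one] at h4
      have : N y * N z < 1 := by
        have hz' : N z ≤ 1 := hz
        nlinarith [N.nonneg y, N.nonneg z]
      linarith
    refine lt_of_le_of_ne (h1 y hy.le) fun h => hm ?_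
    apply hloc.map_nonunit
    exact (V.valuation_eq_one_iff ⟨_, hV ⟨y, hy.le⟩⟩).2 h
  have h3 : ∀ y : L, V.valuation (algebraMap L Ω y) ≤ 1 ↔ N y ≤ 1 := by
    refine fun y => ⟨fun h => ?_, h1 y⟩
    by_contra! h'
    have h0 : y ≠ 0 := by
      rintro rfl
      rw [map_zero] at h'
      linarith
    have h4 := h2 y⁻¹ (by rw [map_inv₀]; exact inv_lt_one_of_one_lt₀ h')
    rw [map_inv₀, map_inv₀] at h4
    have h5 : V.valuation (algebraMap L Ω y) ≠ 0 := by simpa using h0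
    exact absurd h (not_le.2 ((inv_lt_one₀ (zero_lt_iff.2 h5)).1 h4))
  refine ⟨V, fun a b => ?_⟩
  rcases eq_or_ne b 0 with rfl | hb
  · simp only [map_zero, le_zero_iff, (N.nonneg a).ge_iff_eq']
    simp
  · have hb' : V.valuation (algebraMap L Ω b) ≠ 0 := by simpa using hb
    have h4 := h3 (a / b)
    rw [map_div₀, map_div₀, map_div₀, div_le_one₀ (zero_lt_iff.2 hb'),
      div_le_one₀ (N.pos hb)] at h4
    exact h4

/-! ### The roots of a twisted polynomial -/

namespace TwistedPolynomial

open Polynomial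

variable {Fq K : Type*} [Field Fq] [Finite Fq] [Field K] [Algebra Fq K]

theorem add_pow_card_pow' (Fq : Type*) {S : Type*} [Field Fq] [Finite Fq] [CommRing S]
    [Algebra Fq S] [Nontrivial S] (n : ℕ) (x y : S) :
    (x + y) ^ (Nat.card Fq ^ n) = x ^ (Nat.card Fq ^ n) + y ^ (Nat.card Fq ^ n) := by
  obtain ⟨p, hp⟩ := CharP.exists Fq
  let _ := Fintype.ofFinite Fq
  obtain ⟨m, hpr, hm⟩ := FiniteField.card Fq p
  have : Fact p.Prime := ⟨hpr⟩
  have : CharP S p := charP_of_injective_algebraMap (algebraMap Fq S).injective p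
  rw [Nat.card_eq_fintype_card, hm, ← pow_mul]
  exact add_pow_char_pow x y p (m * n)

variable {Ω : Type*} [Field Ω] [Algebra K Ω]

/-- The additive polynomial `∑ cₙ X ^ (q ^ n)` attached to `∑ cₙ τ ^ n`. -/
def toPolynomial (Ω : Type*) [Field Ω] [Algebra K Ω] (P : TwistedPolynomial Fq K) : Polynomial Ω :=
  ∑ i ∈ Finset.range (P.natDegree + 1), C (algebraMap K Ω (P.coeff i)) * X ^ (Nat.card Fq ^ i)

theorem eval_toPolynomial (P : TwistedPolynomial Fq K) (y : Ω) :
    (P.toPolynomial Ω).eval y = P.eval y := by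
  rw [toPolynomial, eval_eq_sum_range P (Nat.lt_succ_self _), Polynomial.eval_finsetSum]
  simp

theorem natDegree_toPolynomial_le (P : TwistedPolynomial Fq K) :
    (P.toPolynomial Ω).natDegree ≤ Nat.card Fq ^ P.natDegree := by
  apply Polynomial.natDegree_sum_le_of_forall_le
  intro i hi
  refine (Polynomial.natDegree_C_mul_X_pow_le _ _).trans ?_
  exact Nat.pow_le_pow_right Nat.card_pos (Nat.lt_succ_iff.1 (Finset.mem_range.1 hi))

theorem coeff_toPolynomial (P : TwistedPolynomial Fq K) (j : ℕ) :
    (P.toPolynomial Ω).coeff (Nat.card Fq ^ j) = algebraMap K Ω (P.coeff j) := by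
  rw [toPolynomial, Polynomial.finsetSum_coeff]
  simp only [coeff_C_mul, coeff_X_pow, mul_ite, mul_one, mul_zero]
  rw [Finset.sum_eq_single j]
  · simp
  · intro i _ hi
    rw [if_neg]
    exact fun h => hi (Nat.pow_right_injective (one_lt_card Fq) h).symm
  · intro h
    rw [coeff_eq_zero_of_natDegree_lt (by simpa using h)]
    simp

theorem toPolynomial_ne_zero {P : TwistedPolynomial Fq K} (hP : P ≠ 0) :
    P.toPolynomial Ω ≠ 0 := by
  intro h
  have := coeff_toPolynomial (Ω := Ω) P P.natDegree
  rw [h, Polynomial.coeff_zero] at this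
  exact coeff_natDegree_ne_zero hP ((map_eq_zero _).1 this.symm)

/-- By additivity `P(y + wX) = P(y) + P(wX)`, so `y` affects only the constant coefficient. -/
theorem coeff_comp_toPolynomial [Algebra Fq Ω] (P : TwistedPolynomial Fq K) (y w : Ω) (j : ℕ) :
    ((P.toPolynomial Ω).comp (C y + C w * X)).coeff (Nat.card Fq ^ j) =
      algebraMap K Ω (P.coeff j) * w ^ (Nat.card Fq ^ j) := by
  have h : (P.toPolynomial Ω).comp (C y + C w * X) =
      C (P.eval y) + (P.toPolynomial Ω).comp (C w * X) := by
    rw [← eval_toPolynomial, toPolynomial, Polynomial.eval_finsetSum, Polynomial.sum_comp,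
      Polynomial.sum_comp, map_sum, ← Finset.sum_add_distrib]
    refine Finset.sum_congr rfl fun i _ => ?_
    simp only [mul_comp, C_comp, pow_comp, X_comp, add_pow_card_pow' Fq, Polynomial.eval_mul, eval_C,
      Polynomial.eval_pow, eval_X, map_mul, map_pow, mul_add]
  rw [h, Polynomial.coeff_add, coeff_C, if_neg (card_pow_ne_zero Fq j), zero_add,
    comp_C_mul_X_coeff, coeff_toPolynomial]

variable {Γ : Type*} [LinearOrderedCommGroupWithZero Γ] {v : Valuation Ω Γ}

/-- Factoring over the roots gives `P(y + wX) = P(y) ∏ (1 + (w / (y - z)) X)`. If `w` is no larger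
than any `y - z`, the product has integral coefficients, so every coefficient of the left side is at
most `P(y)` in size. By additivity, the coefficient of `X^(q^j)` is `a_j w^(q^j)`. -/
theorem valuation_coeff_mul_pow_le [Algebra Fq Ω] [IsAlgClosed Ω] {P : TwistedPolynomial Fq K}
    {y w : Ω} (hw : w ≠ 0) (h : ∀ z, P.eval z = 0 → v w ≤ v (y - z)) (j : ℕ) :
    v (algebraMap K Ω (P.coeff j) * w ^ (Nat.card Fq ^ j)) ≤ v (P.eval y) := by
  set p := P.toPolynomial Ω with hp
  have hsplit : p = C p.leadingCoeff * (p.roots.map fun z => X - C z).prod :=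
    (IsAlgClosed.splits p).eq_prod_roots
  have hroot : ∀ z ∈ p.roots, v w ≤ v (y - z) := fun z hz => h z (by
    rw [← eval_toPolynomial]
    exact Polynomial.isRoot_of_mem_roots hz)
  have hne : ∀ z ∈ p.roots, y - z ≠ 0 := fun z hz h0 => by
    have := hroot z hz
    rw [h0, map_zero, le_zero_iff, map_eq_zero] at this
    exact hw this
  have hy : P.eval y = p.leadingCoeff * (p.roots.map fun z => y - z).prod := by
    rw [← eval_toPolynomial, ← hp]
    conv_lhs => rw [hsplit]
    rw [Polynomial.eval_mul, eval_C, eval_multiset_prod, Multiset.map_map]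
    simp
  have hcomp : p.comp (C y + C w * X) =
      C (P.eval y) * (p.roots.map fun z => 1 + C (w / (y - z)) * X).prod := by
    rw [hy, map_mul, map_multiset_prod, Multiset.map_map, mul_assoc, ← Multiset.prod_map_mul]
    conv_lhs => rw [hsplit]
    rw [mul_comp, C_comp, multiset_prod_comp, Multiset.map_map]
    congr 2
    refine Multiset.map_congr rfl fun z hz => ?_
    simp only [Function.comp_apply, sub_comp, X_comp, C_comp]
    rw [mul_add, mul_one, ← mul_assoc, ← C_mul, mul_div_cancel₀ _ (hne z hz), C_sub]
    ring
  have hint : (p.roots.map fun z => 1 + C (w / (y - z)) * X).prod ∈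
      (mapRingHom v.integer.subtype).range := by
    apply Subring.multiset_prod_mem
    intro f hf
    obtain ⟨z, hz, rfl⟩ := Multiset.mem_map.1 hf
    have : v (w / (y - z)) ≤ 1 := by
      rw [map_div₀]
      exact (div_le_one₀ (zero_lt_iff.2 ((Valuation.ne_zero_iff v).2 (hne z hz)))).2 (hroot z hz)
    refine ⟨1 + C ⟨w / (y - z), this⟩ * X, ?_⟩
    simp
  obtain ⟨g, hg⟩ := hint
  rw [← coeff_comp_toPolynomial P y w j, ← hp, hcomp, coeff_C_mul, ← hg, map_mul]
  refine mul_le_of_le_one_right' ?_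
  rw [coe_mapRingHom, coeff_map]
  exact (g.coeff _).2

/-- Induction needs `P y` to be far from each root `z'` of the next iterate. Write `z' = P z`; then
`P y - z' = P (y - z)`, and a root `s` of `P` yields the root `z + s` of the longer iterate, so the
one-step bound applies to `y - z`. -/
theorem valuation_iterate_le [Algebra Fq Ω] [IsAlgClosed Ω] {P : TwistedPolynomial Fq K}
    {j : ℕ} (hj : P.coeff j ≠ 0) (n : ℕ) {y w : Ω} (hw : w ≠ 0)
    (h : ∀ z, P.eval^[n] z = 0 → v w ≤ v (y - z)) :
    v ((fun u => algebraMap K Ω (P.coeff j) * u ^ (Nat.card Fq ^ j))^[n] w) ≤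
      v (P.eval^[n] y) := by
  induction n generalizing y w with
  | zero => simpa using h 0 rfl
  | succ n ih =>
    rw [Function.iterate_succ_apply, Function.iterate_succ_apply]
    apply ih
    · exact mul_ne_zero (by simpa using hj) (pow_ne_zero _ hw)
    · intro z' hz'
      have hpos : 0 < (P.toPolynomial Ω - C z').degree := by
        have h1 : 0 < (P.toPolynomial Ω).natDegree := by
          refine lt_of_lt_of_le Nat.zero_lt_one ((one_le_card_pow Fq j).trans ?_)
          apply Polynomial.le_natDegree_of_ne_zero
          rw [coeff_toPolynomial]
          simpa using hj
        rw [← Polynomial.natDegree_pos_iff_degree_pos, Polynomial.natDegree_sub_C]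
        exact h1
      obtain ⟨z, hz⟩ := IsAlgClosed.exists_root (P.toPolynomial Ω - C z') hpos.ne'
      have hz2 : P.eval z = z' := by
        rw [IsRoot, Polynomial.eval_sub, eval_C, eval_toPolynomial, sub_eq_zero] at hz
        exact hz
      rw [← hz2, ← eval_sub]
      apply valuation_coeff_mul_pow_le hw
      intro s hs
      rw [sub_sub]
      apply h
      rw [Function.iterate_succ_apply, eval_add, hs, add_zero, hz2, hz']

theorem algebraMap_eval {L : Type*} [Field L] [Algebra K L] [Algebra L Ω] [IsScalarTower K L Ω]
    (P : TwistedPolynomial Fq K) (y : L) :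
    algebraMap L Ω (P.eval y) = P.eval (algebraMap L Ω y) := by
  rw [eval_eq_sum_range P (Nat.lt_succ_self _), eval_eq_sum_range P (Nat.lt_succ_self _), map_sum]
  refine Finset.sum_congr rfl fun i _ => ?_
  rw [map_mul, map_pow, ← IsScalarTower.algebraMap_apply]

/-- Among sufficiently many elements that are far apart from each other, one is mapped by
`P ^ n` to a large element. -/
theorem exists_le_abs_iterate {L : Type*} [Field L] [Algebra K L] [Algebra Fq L]
    {NL : AbsoluteValue L ℝ} (hNL : IsNonarchimedean NL) {P : TwistedPolynomial Fq K} (hP : P ≠ 0)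
    {j : ℕ} (hj : P.coeff j ≠ 0) (n : ℕ) (x : ℕ → L) {w : L} (hw : w ≠ 0)
    (h : ∀ i k, i < k → k ≤ Nat.card Fq ^ (n * P.natDegree) → NL w ≤ NL (x k - x i)) :
    ∃ i ≤ Nat.card Fq ^ (n * P.natDegree),
      NL ((fun u => algebraMap K L (P.coeff j) * u ^ (Nat.card Fq ^ j))^[n] w) ≤
        NL (P.eval^[n] (x i)) := by
  obtain ⟨V, hV⟩ := exists_valuation_extension NL hNL (AlgebraicClosure L)
  set e := algebraMap L (AlgebraicClosure L)
  set B := Nat.card Fq ^ (n * P.natDegree)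
  have hit : ∀ (n : ℕ) (y : L), e (P.eval^[n] y) = P.eval^[n] (e y) := fun n y =>
    Function.Semiconj.iterate_right (f := e) (ga := P.eval) (gb := P.eval)
      (fun y => algebraMap_eval P y) n y
  have hit' : e ((fun u => algebraMap K L (P.coeff j) * u ^ (Nat.card Fq ^ j))^[n] w) =
      (fun u => algebraMap K (AlgebraicClosure L) (P.coeff j) * u ^ (Nat.card Fq ^ j))^[n] (e w) :=
    Function.Semiconj.iterate_right (f := e) (fun y => by
      rw [map_mul, map_pow, ← IsScalarTower.algebraMap_apply]) n w
  by_contra! hcon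
  -- If the conclusion fails, each of the `B + 1` points is closer than `w` to some root of `P^n`.
  -- There are at most `B` roots, so two points share one, and their difference is smaller than `w`.
  have hz : ∀ i : Fin (B + 1), ∃ z, P.eval^[n] z = 0 ∧
      V.valuation (e (x i) - z) < V.valuation (e w) := by
    intro i
    by_contra! hz
    have := valuation_iterate_le hj n (v := V.valuation) (y := e (x i)) (w := e w)
      (by simpa using hw) hz
    rw [← hit, ← hit', hV] at this
    exact absurd this (not_le.2 (hcon i (Nat.lt_succ_iff.1 i.2)))
  choose z hz0 hzv using hz
  classical
  set p := (P ^ n).toPolynomial (AlgebraicClosure L)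
  have hp0 : p ≠ 0 := toPolynomial_ne_zero (pow_ne_zero _ hP)
  have hmem : ∀ i, z i ∈ p.roots.toFinset := by
    intro i
    rw [Multiset.mem_toFinset, Polynomial.mem_roots hp0, IsRoot, eval_toPolynomial, eval_pow]
    exact hz0 i
  have hcard : p.roots.toFinset.card < (Finset.univ : Finset (Fin (B + 1))).card := by
    rw [Finset.card_univ, Fintype.card_fin]
    refine Nat.lt_succ_of_le ((Multiset.toFinset_card_le _).trans ((Polynomial.card_roots' p).trans
      ((natDegree_toPolynomial_le _).trans ?_)))
    rw [natDegree_pow hP]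
  obtain ⟨i, -, k, -, hik, heq⟩ := Finset.exists_ne_map_eq_of_card_lt_of_maps_to hcard
    (fun i _ => hmem i)
  have hfinal : ∀ i k : Fin (B + 1), i < k → z i = z k → False := by
    intro i k hik heq
    have h1 := h i k hik (Nat.lt_succ_iff.1 k.2)
    rw [← hV, map_sub] at h1
    refine absurd h1 (not_le.2 ?_)
    have : e (x k) - e (x i) = (e (x k) - z k) - (e (x i) - z i) := by
      rw [heq]
      ring
    rw [this]
    exact (Valuation.map_sub _ _ _).trans_lt (max_lt (hzv k) (hzv i))
  rcases lt_or_gt_of_ne hik with h1 | h1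
  · exact hfinal i k h1 heq
  · exact hfinal k i h1 heq.symm

end TwistedPolynomial

end LocalLehmer

end

/-! ### The fixed radius and its behaviour under commutation. -/

noncomputable section

namespace LocalLehmer

set_option linter.unusedSectionVars false

theorem pow_eq_of_eventually_mul_pow_eq {u : ℕ → ℝ} (hu : Tendsto u atTop atTop) {c c' : ℝ}
    (hc : 0 < c) (hc' : 0 < c') {a b : ℕ}
    (h : ∀ᶠ n in atTop, c * u n ^ a = c' * u n ^ b) : a = b := by
  have key : ∀ {c c' : ℝ} {a b : ℕ}, 0 < c → 0 < c' →
      (∀ᶠ n in atTop, c * u n ^ a = c' * u n ^ b) → ¬ a < b := by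
    intro c c' a b hc hc' h hab
    have h1 : Tendsto (fun n => u n ^ (b - a)) atTop atTop :=
      (tendsto_pow_atTop (Nat.sub_ne_zero_of_lt hab)).comp hu
    obtain ⟨n, hn1, hn2, hn3⟩ :=
      (h.and ((hu.eventually_gt_atTop 0).and (h1.eventually_gt_atTop (c / c')))).exists
    rw [div_lt_iff₀ hc'] at hn3
    have h4 : u n ^ b = u n ^ (b - a) * u n ^ a := by
      rw [← pow_add, Nat.sub_add_cancel hab.le]
    rw [h4, ← mul_assoc] at hn1
    have := mul_right_cancel₀ (pow_pos hn2 a).ne' hn1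
    linarith
  exact le_antisymm (not_lt.1 (key hc' hc (h.mono fun _ h => h.symm))) (not_lt.1 (key hc hc' h))

namespace TwistedPolynomial

variable {Fq K : Type*} [Field Fq] [Finite Fq] [Field K] [Algebra Fq K]
  {N : AbsoluteValue K ℝ} {P Q : TwistedPolynomial Fq K} {R s : ℝ} {i : ℕ}

/-- The largest disc, of radius `R`, which `P` maps to itself, and the largest index `i` of a
term of `P` which is maximal on it. -/
structure FixedRadius (N : AbsoluteValue K ℝ) (P : TwistedPolynomial Fq K) (R : ℝ) (i : ℕ) :
    Prop where
  pos : 0 < R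
  term_le : ∀ j, term N P R j ≤ R
  term_eq : term N P R i = R
  term_lt : ∀ j, i < j → term N P R j < R

theorem term_mul (N : AbsoluteValue K ℝ) (P : TwistedPolynomial Fq K) (R s : ℝ) (j : ℕ) :
    term N P (R * s) j = term N P R j * s ^ (Nat.card Fq ^ j) := by
  rw [term, term, mul_pow, mul_assoc]

/-- The term of index `i` equals the radius exactly at `|aᵢ|^(-1/(q^i - 1))`. The smallest of these
radii works: there one term equals `R` and no other exceeds it. The hypothesis on the constant
coefficient keeps `q^i - 1` nonzero. -/
theorem exists_gauss_eq_self (N : AbsoluteValue K ℝ) (hP : P ≠ 0) (h0 : P.coeff 0 = 0) :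
    ∃ R, 0 < R ∧ gauss N P R = R := by
  classical
  have hS : (SkewPolynomial.support P).Nonempty := by
    obtain ⟨n, hn⟩ := exists_coeff_ne_zero hP
    exact ⟨n, mem_support.2 hn⟩
  obtain ⟨i, hi, hmin⟩ := Finset.exists_min_image (SkewPolynomial.support P)
    (fun i => (N (P.coeff i)) ^ (-(((Nat.card Fq ^ i - 1 : ℕ) : ℝ)⁻¹))) hS
  have hne : ∀ j ∈ SkewPolynomial.support P, Nat.card Fq ^ j - 1 ≠ 0 := by
    intro j hj
    have hj0 : j ≠ 0 := by
      rintro rfl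
      exact mem_support.1 hj h0
    have := card_pow_lt Fq (Nat.pos_of_ne_zero hj0)
    rw [pow_zero] at this
    omega
  have hpos : ∀ j ∈ SkewPolynomial.support P, 0 < N (P.coeff j) := fun j hj =>
    N.pos (mem_support.1 hj)
  have hpow : ∀ j ∈ SkewPolynomial.support P,
      ((N (P.coeff j)) ^ (-(((Nat.card Fq ^ j - 1 : ℕ) : ℝ)⁻¹))) ^ (Nat.card Fq ^ j - 1) =
        (N (P.coeff j))⁻¹ := by
    intro j hj
    rw [Real.rpow_neg (hpos j hj).le, inv_pow,
      Real.rpow_inv_natCast_pow (hpos j hj).le (hne j hj)]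
  set R := (N (P.coeff i)) ^ (-(((Nat.card Fq ^ i - 1 : ℕ) : ℝ)⁻¹)) with hR
  have hR0 : 0 < R := Real.rpow_pos_of_pos (hpos i hi) _
  have hsucc : ∀ j, R ^ (Nat.card Fq ^ j) = R ^ (Nat.card Fq ^ j - 1) * R := by
    intro j
    rw [← pow_succ, Nat.sub_add_cancel (one_le_card_pow Fq j)]
  refine ⟨R, hR0, le_antisymm (gauss_le fun j => ?_) ?_⟩
  · by_cases hj : j ∈ SkewPolynomial.support P
    · have h1 := pow_le_pow_left₀ hR0.le (hmin j hj) (Nat.card Fq ^ j - 1)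
      rw [hpow j hj] at h1
      rw [term, hsucc, ← mul_assoc]
      refine mul_le_of_le_one_left hR0.le ?_
      calc N (P.coeff j) * R ^ (Nat.card Fq ^ j - 1)
          ≤ N (P.coeff j) * (N (P.coeff j))⁻¹ :=
            mul_le_mul_of_nonneg_left h1 (hpos j hj).le
        _ = 1 := mul_inv_cancel₀ (hpos j hj).ne'
    · rw [term_eq_zero (not_not.1 fun h => hj (mem_support.2 h))]
      exact hR0.le
  · refine le_of_eq_of_le ?_ (term_le_gauss hR0.le i)
    rw [term, hsucc, hR, hpow i hi, ← mul_assoc, mul_inv_cancel₀ (hpos i hi).ne', one_mul]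

theorem exists_fixedRadius_of_gauss_eq (hP : P ≠ 0) (hR : 0 < R) (h : gauss N P R = R) :
    ∃ i, FixedRadius N P R i := by
  obtain ⟨i, h1, h2⟩ := exists_last_gauss_eq (N := N) hP hR
  exact ⟨i, hR, fun j => (term_le_gauss hR.le j).trans h.le, h1.symm.trans h,
    fun j hj => (h2 j hj).trans_eq h⟩

namespace FixedRadius

variable (H : FixedRadius N P R i)

include H

theorem gauss_eq : gauss N P R = R :=
  le_antisymm (gauss_le H.term_le) (H.term_eq.symm.le.trans (term_le_gauss H.pos.le i))

theorem coeff_ne_zero : P.coeff i ≠ 0 := fun h => by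
  have := H.term_eq
  rw [term_eq_zero h] at this
  exact H.pos.ne this

theorem le_gauss (hs : 0 ≤ s) : R * s ^ (Nat.card Fq ^ i) ≤ gauss N P (R * s) := by
  refine le_of_eq_of_le ?_ (term_le_gauss (mul_nonneg H.pos.le hs) i)
  rw [term_mul, H.term_eq]

theorem le_gauss_iterate (n : ℕ) (hs : 0 ≤ s) :
    R * s ^ ((Nat.card Fq ^ i) ^ n) ≤ (gauss N P)^[n] (R * s) := by
  induction n with
  | zero => simp
  | succ n ih =>
    rw [Function.iterate_succ_apply', pow_succ, pow_mul]
    refine (H.le_gauss (pow_nonneg hs _)).trans ?_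
    exact gauss_mono (mul_nonneg H.pos.le (pow_nonneg hs _)) ih

theorem gauss_le_of_le (hs : 0 ≤ s) (hs1 : s ≤ R) : gauss N P s ≤ R :=
  (gauss_mono hs hs1).trans H.gauss_eq.le

theorem ne_zero (h0 : P.coeff 0 = 0) : i ≠ 0 := by
  rintro rfl
  exact H.coeff_ne_zero h0

theorem one_lt_card_pow (h0 : P.coeff 0 = 0) : 1 < Nat.card Fq ^ i := by
  simpa using card_pow_lt Fq (Nat.pos_of_ne_zero (H.ne_zero h0))

/-- All exponents occurring exceed 1, so below `R` every term falls strictly under the radius, while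
above `R` the term of index `i` strictly exceeds it. -/
theorem eq_of_gauss_eq (h0 : P.coeff 0 = 0) {S : ℝ} (hS : 0 < S) (h : gauss N P S = S) :
    S = R := by
  have hS' : S = R * (S / R) := by
    rw [mul_div_cancel₀ _ H.pos.ne']
  have hs0 : 0 < S / R := div_pos hS H.pos
  rcases lt_trichotomy S R with h1 | h1 | h1
  · exfalso
    have hlt : S / R < 1 := (div_lt_one H.pos).2 h1
    refine absurd h (gauss_lt fun j => ?_).ne
    rcases eq_or_ne (P.coeff j) 0 with hj | hj
    · rw [term_eq_zero hj]
      exact hS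
    · have hj0 : j ≠ 0 := by
        rintro rfl
        exact hj h0
      have h2 : 1 < Nat.card Fq ^ j := by
        simpa using card_pow_lt Fq (Nat.pos_of_ne_zero hj0)
      calc term N P S j = term N P R j * (S / R) ^ (Nat.card Fq ^ j) := by
            conv_lhs => rw [hS', term_mul]
        _ ≤ R * (S / R) ^ (Nat.card Fq ^ j) :=
            mul_le_mul_of_nonneg_right (H.term_le j) (pow_nonneg hs0.le _)
        _ < R * (S / R) ^ 1 :=
            mul_lt_mul_of_pos_left (pow_lt_pow_right_of_lt_one₀ hs0 hlt h2) H.pos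
        _ = S := by rw [pow_one, ← hS']
  · exact h1
  · exfalso
    have hlt : 1 < S / R := (one_lt_div H.pos).2 h1
    have h2 := H.le_gauss hs0.le
    rw [← hS', h] at h2
    have h3 : R * (S / R) ^ 1 < R * (S / R) ^ (Nat.card Fq ^ i) :=
      mul_lt_mul_of_pos_left (pow_lt_pow_right₀ hlt (H.one_lt_card_pow h0)) H.pos
    rw [pow_one, ← hS'] at h3
    linarith

/-- To the right of `R`, terms of smaller index grow more slowly, and those of larger index were
strictly smaller at `R`, hence stay so nearby by continuity. -/
theorem eventually_term_lt :
    ∀ᶠ s in 𝓝[>] (1 : ℝ), ∀ j, j ≠ i → term N P (R * s) j < term N P (R * s) i := by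
  have h1 : ∀ᶠ s in 𝓝[>] (1 : ℝ), ∀ j ∈ Finset.range (P.natDegree + 1), i < j →
      term N P R j * s ^ (Nat.card Fq ^ j) < R * s ^ (Nat.card Fq ^ i) := by
    refine (Filter.eventually_all_finset _).2 fun j _ => ?_
    rcases lt_or_ge i j with hij | hij
    · have hc : ContinuousAt
          (fun s : ℝ => R * s ^ (Nat.card Fq ^ i) - term N P R j * s ^ (Nat.card Fq ^ j)) 1 := by
        fun_prop
      have h2 : ∀ᶠ s in 𝓝 (1 : ℝ),
          0 < R * s ^ (Nat.card Fq ^ i) - term N P R j * s ^ (Nat.card Fq ^ j) := by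
        apply hc.eventually_const_lt
        simpa using H.term_lt j hij
      filter_upwards [nhdsWithin_le_nhds h2] with s hs _
      linarith
    · exact Eventually.of_forall fun s h => absurd h (not_lt.2 hij)
  filter_upwards [h1, self_mem_nhdsWithin] with s hs hs1 j hj
  have hs1' : (1 : ℝ) < s := hs1
  rw [term_mul, term_mul, H.term_eq]
  rcases lt_or_gt_of_ne hj with h | h
  · calc term N P R j * s ^ (Nat.card Fq ^ j) ≤ R * s ^ (Nat.card Fq ^ j) :=
          mul_le_mul_of_nonneg_right (H.term_le j) (by positivity)
      _ < _ := mul_lt_mul_of_pos_left (pow_lt_pow_right₀ hs1' (card_pow_lt Fq h)) H.pos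
  · rcases le_or_gt j P.natDegree with h2 | h2
    · exact hs j (Finset.mem_range.2 (Nat.lt_succ_of_le h2)) h
    · rw [term_eq_zero (coeff_eq_zero_of_natDegree_lt h2), zero_mul]
      have := H.pos
      positivity

theorem exists_break : ∃ B : ℝ, 1 < B ∧ ∀ s, 1 < s → s < B →
    ∀ j, j ≠ i → term N P (R * s) j < term N P (R * s) i := by
  obtain ⟨B, hB, h⟩ := mem_nhdsGT_iff_exists_Ioo_subset.1 H.eventually_term_lt
  exact ⟨B, hB, fun s h1 h2 => h ⟨h1, h2⟩⟩

theorem gauss_eq_of_term_lt (hs : 0 ≤ s)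
    (h : ∀ j, j ≠ i → term N P (R * s) j < term N P (R * s) i) :
    gauss N P (R * s) = R * s ^ (Nat.card Fq ^ i) := by
  refine le_antisymm (gauss_le fun j => ?_) (H.le_gauss hs)
  rw [← H.term_eq, ← term_mul, H.term_eq]
  rcases eq_or_ne j i with rfl | hj
  · exact le_rfl
  · exact (h j hj).le

theorem eventually_gauss_iterate_eq (n : ℕ) :
    ∀ᶠ s in 𝓝[>] (1 : ℝ), (gauss N P)^[n] (R * s) = R * s ^ ((Nat.card Fq ^ i) ^ n) := by
  induction n with
  | zero => simp
  | succ n ih =>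
    have ht : Tendsto (fun s : ℝ => s ^ (Nat.card Fq ^ i)) (𝓝[>] 1) (𝓝[>] 1) := by
      apply tendsto_nhdsWithin_iff.2
      constructor
      · have hc : ContinuousAt (fun s : ℝ => s ^ (Nat.card Fq ^ i)) 1 := by fun_prop
        have := hc.tendsto
        rw [one_pow] at this
        exact this.mono_left nhdsWithin_le_nhds
      · filter_upwards [self_mem_nhdsWithin] with s hs
        exact one_lt_pow₀ (Set.mem_Ioi.1 hs) (card_pow_ne_zero Fq i)
    filter_upwards [ht.eventually ih, H.eventually_term_lt, self_mem_nhdsWithin] with s h1 h2 h3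
    have h3' : (1 : ℝ) < s := h3
    rw [Function.iterate_succ_apply, H.gauss_eq_of_term_lt (by linarith) h2, h1, ← pow_mul,
      pow_succ, mul_comm ((Nat.card Fq ^ i) ^ n)]

/-- Commuting twisted polynomials have the same fixed radius, and the ratio between the degree and
the index of the fixed radius is the same for both. -/
theorem exists_of_commute (hNa : IsNonarchimedean N) (hP : P ≠ 0) (hQ : Q ≠ 0)
    (hP0 : P.coeff 0 = 0) (h : Commute P Q) :
    ∃ j, FixedRadius N Q R j ∧ P.natDegree * j = Q.natDegree * i := by
  have hQR : gauss N Q R = R := by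
    apply H.eq_of_gauss_eq hP0 (gauss_pos hQ H.pos)
    rw [← gauss_mul hNa hP hQ H.pos, h.eq, gauss_mul hNa hQ hP H.pos, H.gauss_eq]
  obtain ⟨j, H'⟩ := exists_fixedRadius_of_gauss_eq hQ H.pos hQR
  refine ⟨j, H', ?_⟩
  obtain ⟨s, hs1, hs2, hs3⟩ := ((H.eventually_gauss_iterate_eq j).and
    ((H'.eventually_gauss_iterate_eq i).and self_mem_nhdsWithin)).exists
  have hs3' : (1 : ℝ) < s := hs3
  have hRs : 0 < R * s := mul_pos H.pos (by linarith)
  have hPj : P ^ j ≠ 0 := pow_ne_zero _ hP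
  have hQi : Q ^ i ≠ 0 := pow_ne_zero _ hQ
  -- Just outside the fixed radius, both powers send `R s` to `R s^(q^(ij))`.
  have heq : gauss N (P ^ j) (R * s) = gauss N (Q ^ i) (R * s) := by
    rw [gauss_pow hNa hP j hRs, gauss_pow hNa hQ i hRs, hs1, hs2, ← pow_mul, ← pow_mul,
      mul_comm i j]
  -- Equality at the one radius `R s` propagates along its orbit under the Gauss function of `P`,
  -- since `P^j` and `Q^i` commute with `P^n`. The orbit tends to infinity, where the leading terms
  -- govern; so `P^j` and `Q^i` have the same degree.
  set u : ℕ → ℝ := fun n => gauss N (P ^ n) (R * s) with hu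
  have hun : ∀ n, gauss N (P ^ j) (u n) = gauss N (Q ^ i) (u n) := by
    intro n
    have hPn : P ^ n ≠ 0 := pow_ne_zero _ hP
    rw [hu, ← gauss_mul hNa hPj hPn hRs, ← gauss_mul hNa hQi hPn hRs,
      (Commute.refl P).pow_pow j n, (h.symm.pow_pow i n).eq, gauss_mul hNa hPn hPj hRs,
      gauss_mul hNa hPn hQi hRs, heq]
  have hlim : Tendsto u atTop atTop := by
    have h1 : Tendsto (fun n : ℕ => R * s ^ ((Nat.card Fq ^ i) ^ n)) atTop atTop := by
      apply Tendsto.const_mul_atTop H.pos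
      exact (tendsto_pow_atTop_atTop_of_one_lt hs3').comp
        (tendsto_pow_atTop_atTop_of_one_lt (H.one_lt_card_pow hP0))
    refine tendsto_atTop_mono (fun n => ?_) h1
    rw [hu]
    simp only [gauss_pow hNa hP n hRs]
    exact H.le_gauss_iterate n (by linarith)
  have hlead : ∀ {S : TwistedPolynomial Fq K}, S ≠ 0 → ∀ᶠ n in atTop,
      gauss N S (u n) = N (S.coeff S.natDegree) * u n ^ (Nat.card Fq ^ S.natDegree) := by
    intro S hS
    filter_upwards [hlim.eventually (TwistedPolynomial.eventually_term_lt N hS),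
      hlim.eventually_ge_atTop 0] with n hn hn0
    refine le_antisymm (gauss_le fun k => ?_) (term_le_gauss hn0 S.natDegree)
    rcases eq_or_ne k S.natDegree with rfl | hk
    · exact le_rfl
    · exact (hn k hk).le
  have hfin := pow_eq_of_eventually_mul_pow_eq hlim
    (N.pos (coeff_natDegree_ne_zero hPj)) (N.pos (coeff_natDegree_ne_zero hQi))
    (((hlead hPj).and (hlead hQi)).mono fun n hn => by rw [← hn.1, ← hn.2, hun])
  have := Nat.pow_right_injective (one_lt_card Fq) hfin
  rw [natDegree_pow hP, natDegree_pow hQ] at this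
  rw [mul_comm, this, mul_comm]

end FixedRadius

end TwistedPolynomial

end LocalLehmer

end

/-! ### Avoiding ties: denominators prime to `p`, and orbits outside the fixed disc. -/

noncomputable section

namespace LocalLehmer

set_option linter.unusedSectionVars false

open Real

theorem exists_forall_le_of_finite {S : Set ℝ} (hS : S.Finite) {φ : ℝ → ℝ → Prop}
    (h : ∀ ρ ∈ S, ∃ B, 1 < B ∧ φ ρ B) (hφ : ∀ ρ B B', B ≤ B' → φ ρ B' → φ ρ B) :
    ∃ B, 1 < B ∧ ∀ ρ ∈ S, φ ρ B := by
  have : ∀ᶠ B in 𝓝[>] (1 : ℝ), ∀ ρ ∈ S, φ ρ B := by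
    refine (Filter.eventually_all_finite hS).2 fun ρ hρ => ?_
    obtain ⟨B, hB, h1⟩ := h ρ hρ
    filter_upwards [Ioo_mem_nhdsGT hB] with B' hB'
    exact hφ ρ B' B hB'.2.le h1
  obtain ⟨B, h1, h2⟩ := (this.and self_mem_nhdsWithin).exists
  exact ⟨B, h2, h1⟩

/-- A power of a prime `p` times a rational number with denominator prime to `p` can only be
equal to a given number if the power is bounded. -/
theorem exists_bound_of_prime_denominator {p q : ℕ} (hp : p.Prime) {s : ℕ} (hq : q = p ^ s)
    {d : ℕ} (hd : 0 < d) {lR : ℝ} {a : ℤ} (hR : d * lR = a) {β : ℝ} (hβ : 0 < β) :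
    ∃ B, 1 < B ∧ ∀ (m e : ℕ) (κ : ℤ), ¬ p ∣ e → β = (q : ℝ) ^ m * (κ / e - lR) →
      log B ≤ κ / e - lR := by
  by_cases hex : ∃ (m e : ℕ) (κ : ℤ), ¬ p ∣ e ∧ β = (q : ℝ) ^ m * (κ / e - lR)
  swap
  · push Not at hex
    exact ⟨2, one_lt_two, fun m e κ he h => absurd h (hex m e κ he)⟩
  have hdR : (0 : ℝ) < d := by exact_mod_cast hd
  have key : ∀ (m e : ℕ) (κ : ℤ), ¬ p ∣ e → β = (q : ℝ) ^ m * (κ / e - lR) →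
      β * (e * d) = (((q : ℤ) ^ m * (κ * d - a * e) : ℤ) : ℝ) ∧ (0 : ℝ) < e := by
    intro m e κ he h
    have he0 : (0 : ℝ) < e := by
      rw [Nat.cast_pos, Nat.pos_iff_ne_zero]
      rintro rfl
      exact he (dvd_zero p)
    refine ⟨?_, he0⟩
    push_cast
    rw [h, ← hR]
    field_simp
  obtain ⟨m₀, e₀, κ₀, he₀, h₀⟩ := hex
  obtain ⟨k₀, hpos₀⟩ := key m₀ e₀ κ₀ he₀ h₀
  -- One reference solution gives the fixed positive integer `A = β e₀ d`. For any other solution `A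
  -- e` is a multiple of `q^m`, hence so is `A`, because `e` is prime to `p`. Thus `q^m ≤ A` and
  -- `κ/e - lR = β / q^m ≥ β / A`.
  set A : ℤ := (q : ℤ) ^ m₀ * (κ₀ * d - a * e₀) with hA
  have hA0 : 0 < A := by
    have : (0 : ℝ) < (A : ℝ) := by
      rw [← k₀]
      positivity
    exact_mod_cast this
  refine ⟨exp (β / A), one_lt_exp_iff.2 (div_pos hβ (by exact_mod_cast hA0)), ?_⟩
  intro m e κ he h
  obtain ⟨k, hpos⟩ := key m e κ he h
  have hdvd : (q : ℤ) ^ m ∣ A * e := by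
    refine ⟨(κ * d - a * e) * e₀, ?_⟩
    have : ((A * e : ℤ) : ℝ) = (((q : ℤ) ^ m * ((κ * d - a * e) * e₀) : ℤ) : ℝ) := by
      rw [Int.cast_mul, ← k₀, ← mul_assoc ((q : ℤ) ^ m), Int.cast_mul, ← k]
      push_cast
      ring
    exact_mod_cast this
  have hcop : IsCoprime ((q : ℤ) ^ m) (e : ℤ) := by
    have h1 : Nat.Coprime (q ^ m) e := by
      rw [hq, ← pow_mul]
      exact Nat.Coprime.pow_left _ ((Nat.Prime.coprime_iff_not_dvd hp).2 he)
    exact_mod_cast Nat.isCoprime_iff_coprime.2 h1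
  have hle : (q : ℤ) ^ m ≤ A := Int.le_of_dvd hA0 (hcop.dvd_of_dvd_mul_right hdvd)
  have hleR : (q : ℝ) ^ m ≤ A := by exact_mod_cast hle
  have hAR : (0 : ℝ) < A := by exact_mod_cast hA0
  have hqm : (0 : ℝ) < (q : ℝ) ^ m := by
    have : 0 < q := hq ▸ pow_pos hp.pos s
    positivity
  have hν : 0 < κ / e - lR := by
    by_contra! hneg
    have : (q : ℝ) ^ m * (κ / e - lR) ≤ 0 := mul_nonpos_of_nonneg_of_nonpos hqm.le hneg
    linarith
  rw [log_exp, div_le_iff₀ hAR, h, mul_comm]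
  exact mul_le_mul_of_nonneg_left hleR hν.le

namespace TwistedPolynomial

variable {Fq K : Type*} [Field Fq] [Finite Fq] [Field K] [Algebra Fq K]
  {N : AbsoluteValue K ℝ} {P : TwistedPolynomial Fq K} {R : ℝ} {i : ℕ}

/-- The Gauss function is strictly increasing on positive radii, so each of its iterates pulls the
finite set of ties back to a finite set. -/
theorem finite_tie_iterate (N : AbsoluteValue K ℝ) (hP : P ≠ 0) (n : ℕ) :
    {ρ : ℝ | 0 < ρ ∧ ∃ k < n, Tie N P ((gauss N P)^[k] ρ)}.Finite := by
  have hpos : ∀ (k : ℕ) {ρ : ℝ}, 0 < ρ → 0 < (gauss N P)^[k] ρ := by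
    intro k
    induction k with
    | zero => exact fun h => h
    | succ k ih =>
      intro ρ h
      rw [Function.iterate_succ_apply']
      exact gauss_pos hP (ih h)
  have hinj : ∀ k : ℕ, Set.InjOn (gauss N P)^[k] (Set.Ioi 0) := by
    intro k
    have : StrictMonoOn (gauss N P)^[k] (Set.Ioi 0) := by
      induction k with
      | zero => exact fun _ _ _ _ h => h
      | succ k ih =>
        intro a ha b hb hab
        rw [Function.iterate_succ_apply', Function.iterate_succ_apply']
        exact gauss_strictMono hP (hpos k ha) (ih ha hb hab)
    exact this.injOn
  have : {ρ : ℝ | 0 < ρ ∧ ∃ k < n, Tie N P ((gauss N P)^[k] ρ)} ⊆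
      ⋃ k ∈ Finset.range n, Set.Ioi 0 ∩ (gauss N P)^[k] ⁻¹' {R | 0 < R ∧ Tie N P R} := by
    rintro ρ ⟨hρ, k, hk, h⟩
    simp only [Set.mem_iUnion]
    exact ⟨k, Finset.mem_range.2 hk, hρ, hpos k hρ, h⟩
  refine Set.Finite.subset (Set.Finite.biUnion (Finset.finite_toSet _) fun k _ => ?_) this
  exact Set.Finite.of_finite_image ((finite_tie N P).subset (by
    rintro _ ⟨a, ha, rfl⟩
    exact ha.2)) ((hinj k).mono Set.inter_subset_left)

section Dynamics

variable {L : Type*} [Field L] [Algebra K L] {NL : AbsoluteValue L ℝ}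

theorem abs_iterate_of_not_tie (hNL : IsNonarchimedean NL)
    (hN : ∀ c, NL (algebraMap K L c) = N c) (hP : P ≠ 0) {y : L} (hy : 0 < NL y) {n : ℕ}
    (h : ∀ k < n, ¬ Tie N P ((gauss N P)^[k] (NL y))) :
    NL (P.eval^[n] y) = (gauss N P)^[n] (NL y) := by
  have : ∀ k ≤ n, NL (P.eval^[k] y) = (gauss N P)^[k] (NL y) ∧ 0 < NL (P.eval^[k] y) := by
    intro k
    induction k with
    | zero => exact fun _ => ⟨rfl, hy⟩
    | succ k ih =>
      intro hk
      obtain ⟨h1, h2⟩ := ih (by omega)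
      have h3 := abs_eval_of_not_tie hNL hN hP h2 (by rw [h1]; exact h k (by omega))
      rw [Function.iterate_succ_apply', Function.iterate_succ_apply', h3, h1]
      refine ⟨rfl, ?_⟩
      rw [← h1]
      exact gauss_pos hP h2
  exact (this n le_rfl).1

variable (H : FixedRadius N P R i)

include H

theorem FixedRadius.abs_iterate_le (hNL : IsNonarchimedean NL)
    (hN : ∀ c, NL (algebraMap K L c) = N c) {y : L} (hy : NL y ≤ R) (n : ℕ) :
    NL (P.eval^[n] y) ≤ R := by
  induction n with
  | zero => exact hy
  | succ n ih =>
    rw [Function.iterate_succ_apply']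
    exact (abs_eval_le hNL hN P _).trans (H.gauss_le_of_le (NL.nonneg _) ih)

/-- Until the radius passes the break `R B`, the term of index `i` alone governs each step, so `log
(|y| / R)` is multiplied by `q^i` each time. -/
theorem FixedRadius.abs_iterate_eq (hNL : IsNonarchimedean NL)
    (hN : ∀ c, NL (algebraMap K L c) = N c) {B : ℝ}
    (hB : ∀ s, 1 < s → s < B → ∀ j, j ≠ i → term N P (R * s) j < term N P (R * s) i)
    {y : L} {s : ℝ} (hs : 1 < s) (hy : NL y = R * s) {m : ℕ}
    (hm : ∀ k < m, s ^ ((Nat.card Fq ^ i) ^ k) < B) :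
    NL (P.eval^[m] y) = R * s ^ ((Nat.card Fq ^ i) ^ m) := by
  induction m with
  | zero => simpa using hy
  | succ m ih =>
    have h1 := ih fun k hk => hm k (by omega)
    have h2 : 1 < s ^ ((Nat.card Fq ^ i) ^ m) :=
      one_lt_pow₀ hs (pow_ne_zero _ (card_pow_ne_zero Fq i))
    have h3 := hB _ h2 (hm m (by omega))
    rw [Function.iterate_succ_apply', abs_eval_eq hNL hN (i := i), h1, term_mul, H.term_eq,
      ← pow_mul, pow_succ (Nat.card Fq ^ i)]
    rw [h1]
    exact h3

theorem FixedRadius.abs_leading_iterate (hN : ∀ c, NL (algebraMap K L c) = N c) {w : L} {s : ℝ}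
    (hw : NL w = R * s) (n : ℕ) :
    NL ((fun u => algebraMap K L (P.coeff i) * u ^ (Nat.card Fq ^ i))^[n] w) =
      R * s ^ ((Nat.card Fq ^ i) ^ n) := by
  induction n with
  | zero => simpa using hw
  | succ n ih =>
    rw [Function.iterate_succ_apply', abs_term hN, ih, term_mul, H.term_eq, ← pow_mul,
      pow_succ (Nat.card Fq ^ i)]

end Dynamics

/-- The equality of the term of index `i` with `R` reads `(q^i - 1) log R = -log |aᵢ|`, an integer.
-/
theorem FixedRadius.exists_rational_log (H : FixedRadius N P R i) (h0 : P.coeff 0 = 0)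
    (hdisc : ∀ c : K, c ≠ 0 → ∃ k : ℤ, log (N c) = k) :
    ∃ (d : ℕ) (a : ℤ), 0 < d ∧ d * log R = a := by
  obtain ⟨k, hk⟩ := hdisc _ H.coeff_ne_zero
  have h1 := congrArg log H.term_eq
  rw [term, log_mul (N.pos H.coeff_ne_zero).ne' (pow_pos H.pos _).ne', log_pow, hk] at h1
  have h2 := H.one_lt_card_pow h0
  refine ⟨Nat.card Fq ^ i - 1, -k, by omega, ?_⟩
  rw [Nat.cast_sub h2.le]
  push_cast at h1 ⊢
  linarith

end TwistedPolynomial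

end LocalLehmer

end

/-! ### The lower bound at one place. -/

noncomputable section

namespace LocalLehmer

set_option linter.unusedSectionVars false

open Real

namespace TwistedPolynomial

variable {Fq K : Type*} [Field Fq] [Finite Fq] [Field K] [Algebra Fq K]
  {N : AbsoluteValue K ℝ} {P : TwistedPolynomial Fq K} {R : ℝ} {i : ℕ}

theorem one_le_height_of_le (hP : P ≠ 0) (hd : P.natDegree ≠ 0) {L : Type*} [Field L]
    [Algebra K L] {NL : AbsoluteValue L ℝ} (hNL : IsNonarchimedean NL)
    (hN : ∀ a, NL (algebraMap K L a) = N a) {c : ℝ}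
    (hc : ∀ y : L, |log⁺ (NL (P.eval y)) - (Nat.card Fq : ℝ) ^ P.natDegree * log⁺ (NL y)| ≤ c)
    {y : L} (hy : exp (c + 1) ≤ NL y) : 1 ≤ height NL P y := by
  have h1 := abs_height_sub_le hP hd hNL hN hc y
  have h2 : c + 1 ≤ log⁺ (NL y) := by
    rw [posLog_apply]
    exact le_max_of_le_right ((le_log_iff_exp_le ((exp_pos _).trans_le hy)).2 hy)
  linarith [(abs_le.1 h1).1]

theorem FixedRadius.height_eq_zero (H : FixedRadius N P R i) (hP : P ≠ 0) (hd : P.natDegree ≠ 0)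
    {L : Type*} [Field L] [Algebra K L] {NL : AbsoluteValue L ℝ} (hNL : IsNonarchimedean NL)
    (hN : ∀ a, NL (algebraMap K L a) = N a) {y : L} (hy : NL y ≤ R) : height NL P y = 0 :=
  height_eq_zero_of_bounded hP hd hNL hN (H.abs_iterate_le hNL hN hy)

theorem exists_last_pow_lt {s B : ℝ} (hs : 1 < s) (hsB : s < B) {q : ℕ} (hq : 1 < q) :
    ∃ m : ℕ, (∀ k ≤ m, s ^ (q ^ k) < B) ∧ B ≤ (s ^ (q ^ m)) ^ q := by
  classical
  have hex : ∃ m : ℕ, B ≤ s ^ (q ^ m) :=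
    (((tendsto_pow_atTop_atTop_of_one_lt hs).comp
      (tendsto_pow_atTop_atTop_of_one_lt hq)).eventually_ge_atTop B).exists
  obtain ⟨m, hm⟩ : ∃ m, Nat.find hex = m + 1 := by
    apply Nat.exists_eq_succ_of_ne_zero
    intro h0
    have := Nat.find_spec hex
    rw [h0, pow_zero, pow_one] at this
    linarith
  refine ⟨m, fun k hk => not_le.1 (Nat.find_min hex (by omega)), ?_⟩
  have := Nat.find_spec hex
  rwa [hm, pow_succ, pow_mul] at this

/-- If `p` does not divide the denominator `e` of the values of an absolute value, an element
just outside the fixed disc has a height bounded below by a power of `1 / e`. -/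
theorem FixedRadius.exists_dichotomy.{u} (H : FixedRadius N P R i) (hP : P ≠ 0)
    (h0 : P.coeff 0 = 0)
    (hdisc : ∀ c : K, c ≠ 0 → ∃ k : ℤ, log (N c) = k) {p : ℕ} (hp : p.Prime) {f : ℕ}
    (hq : Nat.card Fq = p ^ f) :
    ∃ B C : ℝ, 1 < B ∧ 0 < C ∧ ∀ (L : Type u) [Field L] [Algebra K L] [Algebra Fq L]
      (NL : AbsoluteValue L ℝ), IsNonarchimedean NL → (∀ a, NL (algebraMap K L a) = N a) →
      ∀ e : ℕ, ¬ p ∣ e → (∀ y : L, y ≠ 0 → ∃ k : ℤ, log (NL y) = k / e) →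
      ∀ y : L, R < NL y → R * B ≤ NL y ∨
        C / (e : ℝ) ^ ((P.natDegree : ℝ) / i) ≤ height NL P y := by
  have hi0 := H.ne_zero h0
  have hiD : i ≤ P.natDegree := le_natDegree H.coeff_ne_zero
  have hd : P.natDegree ≠ 0 := by omega
  obtain ⟨c, hc0, hc⟩ := exists_bound_posLog_eval N hP
  obtain ⟨B₁, hB₁, hbreak⟩ := H.exists_break
  obtain ⟨d, a, hd0, hda⟩ := H.exists_rational_log h0 hdisc
  have hQ1 := H.one_lt_card_pow h0
  set Q₁ := Nat.card Fq ^ i with hQ₁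
  have hR := H.pos
  -- Starting from the break radius `R B₁`, `n` steps suffice to reach size `exp (c + 1)`, where the
  -- height is at least 1.
  obtain ⟨n, hn⟩ : ∃ n : ℕ, exp (c + 1) ≤ R * B₁ ^ (Q₁ ^ n) :=
    ((Tendsto.const_mul_atTop hR ((tendsto_pow_atTop_atTop_of_one_lt hB₁).comp
      (tendsto_pow_atTop_atTop_of_one_lt hQ1))).eventually_ge_atTop (exp (c + 1))).exists
  -- The radii to avoid are those meeting a tie within the next `n + 1` steps. There are finitely
  -- many, so the divisibility bound can be made common to all. The guard `1 < B` only makes the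
  -- condition on `B` inherited by smaller `B`, where `log` must be monotone.
  obtain ⟨B₂, hB₂, hB₂'⟩ := exists_forall_le_of_finite
    (S := {ρ : ℝ | 0 < ρ ∧ ∃ k < n + 1, Tie N P ((gauss N P)^[k] ρ)} ∩ Set.Ioi R)
    ((finite_tie_iterate N hP (n + 1)).subset Set.inter_subset_left)
    (φ := fun ρ B => 1 < B → ∀ (m e : ℕ) (κ : ℤ), ¬ p ∣ e →
      log (ρ / R) = (Q₁ : ℝ) ^ m * (κ / e - log R) → log B ≤ κ / e - log R)
    (fun ρ hρ => by
      obtain ⟨B, h1, h2⟩ := exists_bound_of_prime_denominator hp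
        (hQ₁.trans (by rw [hq, ← pow_mul])) hd0 hda (log_pos ((one_lt_div hR).2 hρ.2))
      exact ⟨B, h1, fun _ => h2⟩)
    (fun ρ B B' hBB' h hB m e κ he heq => (log_le_log (by linarith) hBB').trans
      (h (hB.trans_le hBB') m e κ he heq))
  have hlogB₁ : 0 < log B₁ := log_pos hB₁
  have hdR : (0 : ℝ) < d := by exact_mod_cast hd0
  have hqD : (0 : ℝ) < (Nat.card Fq : ℝ) ^ P.natDegree := by
    linarith [two_le_card_pow Fq hd]
  set α : ℝ := (P.natDegree : ℝ) / i with hα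
  set C : ℝ := (((Nat.card Fq : ℝ) ^ P.natDegree) ^ (n + 1) * (d * log B₁) ^ α)⁻¹ with hC
  have hC0 : 0 < C := by
    have : 0 < (d * log B₁) ^ α := rpow_pos_of_pos (by positivity) _
    positivity
  refine ⟨min B₁ B₂, C, lt_min hB₁ hB₂, hC0, ?_⟩
  intro L _ _ _ NL hNL hN e he hdiscL y hy
  by_contra! hcon
  obtain ⟨hcon1, hcon2⟩ := hcon
  have he0 : (0 : ℝ) < e := by
    rw [Nat.cast_pos, Nat.pos_iff_ne_zero]
    rintro rfl
    exact he (dvd_zero p)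
  have hy0 : 0 < NL y := hR.trans hy
  set s := NL y / R with hs
  have hys : NL y = R * s := by rw [hs, mul_div_cancel₀ _ hR.ne']
  have hs1 : 1 < s := (one_lt_div hR).2 hy
  rw [hys] at hcon1
  have hsB := lt_of_mul_lt_mul_left hcon1 hR.le
  have hsB₁ : s < B₁ := hsB.trans_le (min_le_left _ _)
  have hsB₂ : s < B₂ := hsB.trans_le (min_le_right _ _)
  obtain ⟨κ, hκ⟩ := hdiscL y (NL.pos_iff.1 hy0)
  have hlogs : log s = κ / e - log R := by rw [hs, log_div hy0.ne' hR.ne', hκ]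
  -- `P^m y` is the last point of the orbit before the break, so its radius is known exactly.
  obtain ⟨m, hm1, hm2⟩ := exists_last_pow_lt hs1 hsB₁ hQ1
  have hx := H.abs_iterate_eq hNL hN hbreak hs1 hys (m := m) fun k hk => hm1 k hk.le
  set x := P.eval^[m] y with hxdef
  have hspow : 1 < s ^ (Q₁ ^ m) := one_lt_pow₀ hs1 (by positivity)
  have hx0 : 0 < NL x := by rw [hx]; positivity
  -- A tie would make `log (|x| / R)` one of the finitely many values above, written as `Q₁^m (κ/e -
  -- log R)`; this forces `s ≥ B₂`, contrary to assumption.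
  have hnotie : ∀ k < n + 1, ¬ Tie N P ((gauss N P)^[k] (NL x)) := by
    intro k hk htie
    have h1 := hB₂' (NL x) ⟨⟨hx0, k, hk, htie⟩, by
      rw [Set.mem_Ioi, hx]
      exact lt_mul_of_one_lt_right hR hspow⟩ hB₂ m e κ he (by
        rw [hx, mul_div_cancel_left₀ _ hR.ne', log_pow, ← hlogs, Nat.cast_pow])
    rw [← hlogs] at h1
    exact absurd h1 (not_le.2 (log_lt_log (by linarith) hsB₂))
  -- The first of the `n + 1` steps brings the lower bound up to the break, the other `n` take it to
  -- `exp (c + 1)`.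
  have hbig : exp (c + 1) ≤ NL (P.eval^[n + 1] x) := by
    rw [abs_iterate_of_not_tie hNL hN hP hx0 hnotie, hx]
    refine hn.trans (le_trans ?_ (H.le_gauss_iterate (n + 1) (by positivity)))
    refine mul_le_mul_of_nonneg_left ?_ hR.le
    rw [pow_succ' (Nat.card Fq ^ i), pow_mul]
    exact pow_le_pow_left₀ (by linarith) hm2 _
  have hh := one_le_height_of_le hP hd hNL hN (hc L NL hNL hN) hbig
  rw [height_iterate hP hd hNL hN, hxdef, height_iterate hP hd hNL hN, ← mul_assoc] at hh
  -- `Q₁^m log s < log B₁`, whereas `log s` is a positive fraction with denominator `e d`, so at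
  -- least `1/(e d)`. Hence `Q₁^m ≤ d e log B₁`; the power `α = D/i` turns `Q₁^m = q^(im)` into
  -- `q^(Dm)`.
  have hqm : ((Nat.card Fq : ℝ) ^ P.natDegree) ^ m ≤ (d * log B₁) ^ α * (e : ℝ) ^ α := by
    have h1 : (Q₁ : ℝ) ^ m * log s < log B₁ := by
      have := log_lt_log (by linarith) (hm1 m le_rfl)
      rw [log_pow] at this
      exact_mod_cast this
    have h2 : 1 / (e * d) ≤ log s := by
      have h3 : log s = ((κ * d - a * e : ℤ) : ℝ) / (e * d) := by
        rw [hlogs]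
        push_cast
        rw [← hda]
        field_simp
      have h4 : (0 : ℝ) < ((κ * d - a * e : ℤ) : ℝ) := by
        have := log_pos hs1
        rw [h3] at this
        exact (div_pos_iff_of_pos_right (by positivity)).1 this
      rw [h3]
      refine div_le_div_of_nonneg_right ?_ (by positivity)
      exact_mod_cast Int.add_one_le_iff.2 (Int.cast_pos.1 h4)
    have h5 : (Q₁ : ℝ) ^ m ≤ d * log B₁ * e := by
      have h6 : (Q₁ : ℝ) ^ m * (1 / (e * d)) ≤ log B₁ :=
        (mul_le_mul_of_nonneg_left h2 (by positivity)).trans h1.le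
      rw [mul_one_div, div_le_iff₀ (by positivity)] at h6
      linarith
    rw [← mul_rpow (by positivity) he0.le]
    calc ((Nat.card Fq : ℝ) ^ P.natDegree) ^ m = ((Q₁ : ℝ) ^ m) ^ α := by
          rw [hα, hQ₁, Nat.cast_pow, ← pow_mul, ← pow_mul, ← rpow_natCast, ← rpow_natCast,
            ← rpow_mul (Nat.cast_nonneg _)]
          congr 1
          push_cast
          have : (i : ℝ) ≠ 0 := by exact_mod_cast hi0
          field_simp
      _ ≤ _ := rpow_le_rpow (by positivity) h5 (by positivity)
  have hhy := height_nonneg hP hd hNL hN y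
  refine absurd hcon2 (not_lt.2 ?_)
  rw [hC, ← one_div, div_div, div_le_iff₀ (by
    have : 0 < (d * log B₁) ^ α := rpow_pos_of_pos (by positivity) _
    have : 0 < (e : ℝ) ^ α := rpow_pos_of_pos he0 _
    positivity)]
  refine hh.trans ?_
  rw [mul_comm (height NL P y), mul_assoc (_ ^ (n + 1)), ← mul_assoc (_ ^ (n + 1))]
  refine mul_le_mul_of_nonneg_right ?_ hhy
  rw [mul_assoc]
  exact mul_le_mul_of_nonneg_left hqm (by positivity)

/-- The local lower bound for the height. -/
theorem FixedRadius.exists_height_lower_bound.{u} (H : FixedRadius N P R i) (hP : P ≠ 0)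
    (h0 : P.coeff 0 = 0)
    (hdisc : ∀ c : K, c ≠ 0 → ∃ k : ℤ, log (N c) = k) {p : ℕ} (hp : p.Prime) {f : ℕ}
    (hq : Nat.card Fq = p ^ f) :
    ∃ C : ℝ, 0 < C ∧ ∀ (L : Type u) [Field L] [Algebra K L] [Algebra Fq L]
      (NL : AbsoluteValue L ℝ), IsNonarchimedean NL → (∀ a, NL (algebraMap K L a) = N a) →
      ∀ e : ℕ, ¬ p ∣ e → (∀ y : L, y ≠ 0 → ∃ k : ℤ, log (NL y) = k / e) →
      ∀ x : L, 0 < height NL P x →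
        C / (e : ℝ) ^ ((P.natDegree : ℝ) / i) ≤ height NL P x := by
  classical
  have hi0 := H.ne_zero h0
  have hiD : i ≤ P.natDegree := le_natDegree H.coeff_ne_zero
  have hd : P.natDegree ≠ 0 := by omega
  have hR := H.pos
  have hQ1 := H.one_lt_card_pow h0
  obtain ⟨c, hc0, hc⟩ := exists_bound_posLog_eval N hP
  obtain ⟨B, C, hB, hC, hBC⟩ := H.exists_dichotomy hP h0 hdisc hp hq
  obtain ⟨n, hn⟩ : ∃ n : ℕ, exp (c + 1) ≤ R * B ^ ((Nat.card Fq ^ i) ^ n) :=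
    ((Tendsto.const_mul_atTop hR ((tendsto_pow_atTop_atTop_of_one_lt hB).comp
      (tendsto_pow_atTop_atTop_of_one_lt hQ1))).eventually_ge_atTop (exp (c + 1))).exists
  -- `M` bounds the number of roots of `P^n`; the points used are `x, P x, …, P^M x`.
  obtain ⟨M, hM⟩ : ∃ M, M = Nat.card Fq ^ (n * P.natDegree) := ⟨_, rfl⟩
  obtain ⟨Q, hQ⟩ : ∃ Q, Q = (Nat.card Fq : ℝ) ^ P.natDegree := ⟨_, rfl⟩
  have hQ2 : 2 ≤ Q := hQ ▸ two_le_card_pow Fq hd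
  have hQ0 : 0 < Q := by linarith
  refine ⟨min (C / Q ^ M) (1 / Q ^ (n + M)), by positivity, ?_⟩
  intro L _ _ _ NL hNL hN e he hdiscL x hx
  have he1 : (1 : ℝ) ≤ e := by
    rw [Nat.one_le_cast, Nat.one_le_iff_ne_zero]
    rintro rfl
    exact he (dvd_zero p)
  set α : ℝ := (P.natDegree : ℝ) / i with hα
  have hα0 : 0 ≤ α := by positivity
  have heα : 1 ≤ (e : ℝ) ^ α := one_le_rpow he1 hα0
  have hit : ∀ k, height NL P (P.eval^[k] x) = Q ^ k * height NL P x :=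
    fun k => by
    rw [height_iterate hP hd hNL hN, hQ]
  have hmono : ∀ {k l : ℕ}, k ≤ l → Q ^ k * height NL P x ≤ Q ^ l * height NL P x :=
    fun h => mul_le_mul_of_nonneg_right (pow_le_pow_right₀ (by linarith) h) hx.le
  -- A difference inside the fixed disc has height zero, so by the ultrametric inequality the height
  -- of `P^l x` would be at most that of `P^k x`, although it is larger by a factor `Q^(l-k) > 1`.
  have hdiff : ∀ k l, k < l → l ≤ M →
      R < NL (P.eval^[l] x - P.eval^[k] x) ∧
      height NL P (P.eval^[l] x - P.eval^[k] x) ≤ Q ^ M * height NL P x := by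
    intro k l hkl hl
    constructor
    · by_contra! hle
      have h1 := H.height_eq_zero hP hd hNL hN hle
      have h2 := height_add_le_max hP hd hNL hN (P.eval^[l] x - P.eval^[k] x) (P.eval^[k] x)
      rw [sub_add_cancel, h1, hit, hit, max_eq_right (by positivity)] at h2
      have h3 := lt_of_mul_lt_mul_right (lt_of_le_of_ne h2 fun h => by
        have := mul_right_cancel₀ hx.ne' h
        exact absurd (pow_right_injective₀ hQ0 (by linarith) this) hkl.ne') hx.le
      exact absurd h3 (not_lt.2 (pow_le_pow_right₀ (by linarith) hkl.le))
    · refine (height_sub_le_max hP hd hNL hN _ _).trans ?_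
      rw [hit, hit]
      exact max_le (hmono hl) (hmono (by omega))
  -- Either two points are close enough for the second alternative of the dichotomy to hold for
  -- their difference, or all points are at mutual distance at least `R B`.
  by_cases hsmall : ∃ k l, k < l ∧ l ≤ M ∧ NL (P.eval^[l] x - P.eval^[k] x) < R * B
  · obtain ⟨k, l, hkl, hl, hlt⟩ := hsmall
    obtain ⟨h1, h2⟩ := hdiff k l hkl hl
    rcases hBC L NL hNL hN e he hdiscL _ h1 with h3 | h3
    · exact absurd hlt (not_lt.2 h3)
    · have h4 := h3.trans h2
      calc min (C / Q ^ M) (1 / Q ^ (n + M)) / (e : ℝ) ^ α ≤ C / Q ^ M / (e : ℝ) ^ α :=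
            div_le_div_of_nonneg_right (min_le_left _ _) (by linarith)
        _ = C / (e : ℝ) ^ α / Q ^ M := by rw [div_right_comm]
        _ ≤ height NL P x := by
            rw [div_le_iff₀ (by positivity), mul_comm]
            exact h4
  · push Not at hsmall
    -- The smallest difference `w` serves as the common separation in the pigeonhole argument on
    -- roots.
    obtain ⟨⟨k, l⟩, hkl, hmin⟩ := Finset.exists_min_image
      ((Finset.range (M + 1) ×ˢ Finset.range (M + 1)).filter fun x : ℕ × ℕ => x.1 < x.2)
      (fun z => NL (P.eval^[z.2] x - P.eval^[z.1] x))
      ⟨(0, 1), by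
        have := one_le_card_pow Fq (n * P.natDegree)
        rw [← hM] at this
        simp only [Finset.mem_filter, Finset.mem_product, Finset.mem_range]
        omega⟩
    simp only [Finset.mem_filter, Finset.mem_product, Finset.mem_range] at hkl hmin
    set w := P.eval^[l] x - P.eval^[k] x with hw
    have hwB : R * B ≤ NL w := hsmall k l hkl.2 (by omega)
    have hw0 : w ≠ 0 := NL.pos_iff.1 (lt_of_lt_of_le (by positivity) hwB)
    obtain ⟨i₀, hi₀, hle⟩ := exists_le_abs_iterate hNL hP H.coeff_ne_zero n
      (fun k => P.eval^[k] x) hw0 (fun a b hab hb => by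
        rw [← hM] at hb
        exact hmin (a, b) ⟨⟨by omega, by omega⟩, hab⟩)
    rw [← hM] at hi₀
    rw [H.abs_leading_iterate hN (s := NL w / R) (by rw [mul_div_cancel₀ _ hR.ne'])] at hle
    have hbig : exp (c + 1) ≤ NL (P.eval^[n] (P.eval^[i₀] x)) := by
      refine hn.trans (le_trans ?_ hle)
      refine mul_le_mul_of_nonneg_left (pow_le_pow_left₀ (by linarith) ?_ _) hR.le
      rw [le_div_iff₀ hR, mul_comm]
      exact hwB
    have hh := one_le_height_of_le hP hd hNL hN (hc L NL hNL hN) hbig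
    rw [← Function.iterate_add_apply, hit] at hh
    have hh2 := hh.trans (hmono (show n + i₀ ≤ n + M by omega))
    calc min (C / Q ^ M) (1 / Q ^ (n + M)) / (e : ℝ) ^ α ≤ min (C / Q ^ M) (1 / Q ^ (n + M)) :=
          div_le_self (by positivity) heα
      _ ≤ 1 / Q ^ (n + M) := min_le_right _ _
      _ ≤ height NL P x := by
          rw [div_le_iff₀ (by positivity), mul_comm]
          exact hh2

end TwistedPolynomial

end LocalLehmer

end

/-! ### From places to absolute values. -/

noncomputable section

namespace LocalLehmer

set_option linter.unusedSectionVars false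

open Real

section AbsoluteValue

variable {L : Type*} [Field L]

theorem intValuation_log_add_le (v : Valuation L (WithZero (Multiplicative ℤ))) {x y : L}
    (hxy : x + y ≠ 0) (hx : x ≠ 0) (hy : y ≠ 0) :
    WithZero.log (v (x + y)) ≤ max (WithZero.log (v x)) (WithZero.log (v y)) := by
  have hne : ∀ {z : L}, z ≠ 0 → v z ≠ 0 := fun h => (Valuation.ne_zero_iff v).2 h
  rcases le_max_iff.1 (v.map_add x y) with h | h
  · exact le_max_of_le_left ((WithZero.log_le_log (hne hxy) (hne hx)).2 h)
  · exact le_max_of_le_right ((WithZero.log_le_log (hne hxy) (hne hy)).2 h)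

open Classical in
theorem isNonarchimedean_aux (v : Valuation L (WithZero (Multiplicative ℤ))) (e : ℕ) (x y : L) :
    (if x + y = 0 then 0 else exp (((WithZero.log (v (x + y)) : ℤ) : ℝ) / e)) ≤
      max (if x = 0 then 0 else exp (((WithZero.log (v x) : ℤ) : ℝ) / e))
        (if y = 0 then 0 else exp (((WithZero.log (v y) : ℤ) : ℝ) / e)) := by
  by_cases hx : x = 0
  · simp [hx]
  by_cases hy : y = 0
  · simp [hy]
  by_cases hxy : x + y = 0
  · simp only [hxy, if_true, if_neg hx]
    exact le_max_of_le_left (exp_pos _).le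
  simp only [hx, hy, hxy, if_false]
  rcases le_max_iff.1 (intValuation_log_add_le v hxy hx hy) with h | h
  · exact le_max_of_le_left (by gcongr)
  · exact le_max_of_le_right (by gcongr)

open Classical in
/-- The absolute value `y ↦ exp (log (v y) / e)` attached to a discrete valuation. -/
def intAbs (v : Valuation L (WithZero (Multiplicative ℤ))) (e : ℕ) : AbsoluteValue L ℝ where
  toFun y := if y = 0 then 0 else exp (((WithZero.log (v y) : ℤ) : ℝ) / e)
  map_mul' x y := by
    by_cases hx : x = 0
    · simp [hx]
    by_cases hy : y = 0
    · simp [hy]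
    have h1 : v x ≠ 0 := (Valuation.ne_zero_iff v).2 hx
    have h2 : v y ≠ 0 := (Valuation.ne_zero_iff v).2 hy
    simp only [hx, hy, mul_eq_zero, or_self, if_false, map_mul, WithZero.log_mul h1 h2,
      Int.cast_add, add_div, exp_add]
  nonneg' x := by
    split_ifs
    exacts [le_rfl, (exp_pos _).le]
  eq_zero' x := by
    split_ifs with h
    · simp [h]
    · simp [h, (exp_pos _).ne']
  add_le' x y := by
    have h : ∀ z : L, (0 : ℝ) ≤ if z = 0 then 0 else exp (((WithZero.log (v z) : ℤ) : ℝ) / e) := by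
      intro z
      split_ifs
      exacts [le_rfl, (exp_pos _).le]
    refine le_trans ?_ (max_le_add_of_nonneg (h x) (h y))
    exact isNonarchimedean_aux v e x y

variable (v : Valuation L (WithZero (Multiplicative ℤ))) (e : ℕ)

theorem intAbs_apply {y : L} (hy : y ≠ 0) : intAbs v e y = exp (((WithZero.log (v y) : ℤ) : ℝ) / e) := by
  classical
  change (if y = 0 then 0 else _) = _
  rw [if_neg hy]

theorem log_intAbs (y : L) : log (intAbs v e y) = ((WithZero.log (v y) : ℤ) : ℝ) / e := by
  by_cases hy : y = 0
  · simp [hy]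
  · rw [intAbs_apply v e hy, log_exp]

theorem isNonarchimedean_intAbs : IsNonarchimedean (intAbs v e) := by
  intro x y
  classical
  exact isNonarchimedean_aux v e x y

theorem exists_log_intAbs_eq (y : L) : ∃ k : ℤ, log (intAbs v e y) = k / e :=
  ⟨_, log_intAbs v e y⟩

/-- Dividing the logarithm by the ramification index is what makes the absolute value of `L` extend
the one of `K`, at the price of values with denominator `e`. -/
theorem intAbs_algebraMap {K : Type*} [Field K] [Algebra K L]
    {u : Valuation K (WithZero (Multiplicative ℤ))} (he : e ≠ 0)
    (h : ∀ c : K, v (algebraMap K L c) = u c ^ e) (c : K) :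
    intAbs v e (algebraMap K L c) = intAbs u 1 c := by
  by_cases hc : c = 0
  · simp [hc]
  rw [intAbs_apply u 1 hc, intAbs_apply v e (by simpa using hc), h, WithZero.log_pow]
  have : (e : ℝ) ≠ 0 := by exact_mod_cast he
  congr 1
  push_cast [nsmul_eq_mul]
  field_simp

theorem intAbs_one_eq_one_iff (y : L) : intAbs v 1 y = 1 ↔ v y = 1 := by
  by_cases hy : y = 0
  · simp [hy]
  have h1 : v y ≠ 0 := (Valuation.ne_zero_iff v).2 hy
  rw [intAbs_apply v 1 hy, exp_eq_one_iff]
  constructor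
  · intro h
    have h2 : WithZero.log (v y) = 0 := by
      have : ((WithZero.log (v y) : ℤ) : ℝ) = 0 := by simpa using h
      exact_mod_cast this
    rw [← WithZero.exp_log h1, h2, WithZero.exp_zero]
  · intro h
    simp [h]

end AbsoluteValue

namespace ProjectiveVariety.Place

variable {k K : Type*} [Field k] [Field K] [Algebra k K] {M : ℕ} {V : ProjectiveVariety k K M}
  {L : Type*} [Field L] [Algebra K L]
variable {Fq A : Type*} [Field Fq] [Finite Fq] [CommRing A] [Algebra Fq A] [Algebra Fq K]

/-- The infimum of the empty set is 0, so a nonzero index is attained. The condition `p ∤ e`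
excludes that default value. -/
theorem ramificationIndex_spec (w : V.Place L) (h : w.ramificationIndex ≠ 0) (c : K) :
    w.val (algebraMap K L c) = w.base c ^ w.ramificationIndex := by
  refine (Nat.sInf_mem (s := {e : ℕ | 0 < e ∧ ∀ c : K, w.val (algebraMap K L c) = w.base c ^ e})
    ?_).2 c
  by_contra hne
  rw [Set.not_nonempty_iff_eq_empty] at hne
  exact h (by rw [ramificationIndex, hne, Nat.sInf_empty])

theorem ramificationIndex_eq (w : V.Place L) {e : ℕ} (he : 0 < e)
    (h : ∀ c : K, w.val (algebraMap K L c) = w.base c ^ e) : w.ramificationIndex = e := by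
  have h0 : w.ramificationIndex ≠ 0 := (Nat.sInf_mem (s := {e : ℕ | 0 < e ∧ ∀ c : K,
    w.val (algebraMap K L c) = w.base c ^ e}) ⟨e, he, h⟩).1.ne'
  obtain ⟨c, hc⟩ := w.base_surjective (WithZero.exp 1)
  have h1 := (w.ramificationIndex_spec h0 c).symm.trans (h c)
  rw [hc] at h1
  have h2 := congrArg WithZero.log h1
  simpa [WithZero.log_pow] using h2

theorem truncVal_eq (w : V.Place L) {e : ℕ} (he : e ≠ 0) (y : L) :
    w.truncVal y = -(e * log⁺ (intAbs w.val e y)) := by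
  have he' : (0 : ℝ) < e := by positivity
  rw [truncVal, posLog_apply, log_intAbs, mul_max_of_nonneg _ _ he'.le, mul_zero,
    mul_div_cancel₀ _ he'.ne', ← min_neg_neg, neg_zero]

/-- Since `φ_{a^n} = (φ_a)^n`, the sequence defining the local height is Tate's sequence for `φ_a`,
up to the sign and the factor `e` of the normalization. -/
theorem limitVal_eq [Algebra Fq L] (w : V.Place L) (D : DrinfeldModule Fq A K) {a : A}
    (ha : (D.φ a).natDegree ≠ 0) (hφ : D.φ a ≠ 0) {e : ℕ} (he : e ≠ 0)
    (hw : ∀ c : K, w.val (algebraMap K L c) = w.base c ^ e) (y : L) :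
    w.limitVal D a y = -(e * TwistedPolynomial.height (intAbs w.val e) (D.φ a) y) := by
  rw [limitVal]
  apply Tendsto.limUnder_eq
  have h := ((TwistedPolynomial.tendsto_height (N := intAbs w.base 1) hφ ha
    (isNonarchimedean_intAbs w.val e) (intAbs_algebraMap w.val e he hw) y).const_mul (e : ℝ)).neg
  refine h.congr fun n => ?_
  rw [map_pow, TwistedPolynomial.eval_pow, TwistedPolynomial.natDegree_pow hφ, truncVal_eq w he,
    mul_comm n, pow_mul]
  ring

end ProjectiveVariety.Place

end LocalLehmer

end

/-! ### Nonconstant elements of `A` have nonconstant images. -/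

noncomputable section

namespace LocalLehmer

set_option linter.unusedSectionVars false

section Constants

variable {Fq K : Type*} [Field Fq] [Finite Fq] [Field K] [Algebra Fq K]

namespace TwistedPolynomial

theorem natDegree_add_of_lt {P Q : TwistedPolynomial Fq K} (h : Q.natDegree < P.natDegree) :
    (P + Q).natDegree = P.natDegree := by
  have hP : P ≠ 0 := by
    rintro rfl
    exact absurd h (by rw [show (0 : TwistedPolynomial Fq K).natDegree = 0 from rfl]; omega)
  apply natDegree_eq
  · rw [coeff_add, coeff_eq_zero_of_natDegree_lt h, add_zero]
    exact coeff_natDegree_ne_zero hP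
  · intro m hm
    rw [coeff_add, coeff_eq_zero_of_natDegree_lt hm, coeff_eq_zero_of_natDegree_lt (h.trans hm),
      add_zero]

theorem eq_monomial_zero {P : TwistedPolynomial Fq K} (h : P.natDegree = 0) :
    P = monomial 0 (P.coeff 0) := by
  apply ext_coeff
  intro n
  rw [coeff_monomial]
  split_ifs with hn
  · rw [← hn]
  · exact coeff_eq_zero_of_natDegree_lt (by omega)

/-- The values of a ring morphism on polynomials in one variable. -/
theorem natDegree_map_polynomial (ψ : Polynomial Fq →+* TwistedPolynomial Fq K)
    (hd : (ψ Polynomial.X).natDegree ≠ 0) {p : Polynomial Fq} (hp : p ≠ 0) :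
    ψ p ≠ 0 ∧ (ψ p).natDegree = p.natDegree * (ψ Polynomial.X).natDegree := by
  have hX : ψ Polynomial.X ≠ 0 := by
    intro h
    rw [h] at hd
    exact hd rfl
  have hC : ∀ c : Fq, c ≠ 0 → ψ (Polynomial.C c) ≠ 0 ∧ (ψ (Polynomial.C c)).natDegree = 0 := by
    intro c hc
    have h1 : ψ (Polynomial.C c) * ψ (Polynomial.C c⁻¹) = 1 := by
      rw [← map_mul, ← Polynomial.C_mul, mul_inv_cancel₀ hc, Polynomial.C_1, map_one]
    have h2 : ψ (Polynomial.C c) ≠ 0 := left_ne_zero_of_mul_eq_one h1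
    have h3 : ψ (Polynomial.C c⁻¹) ≠ 0 := right_ne_zero_of_mul_eq_one h1
    refine ⟨h2, ?_⟩
    have h4 := natDegree_mul h2 h3
    rw [h1, natDegree_one] at h4
    omega
  have hC' : ∀ c : Fq, (ψ (Polynomial.C c)).natDegree = 0 := by
    intro c
    by_cases hc : c = 0
    · rw [hc, map_zero, map_zero]; rfl
    · exact (hC c hc).2
  induction h : p.natDegree generalizing p with
  | zero =>
    rw [Polynomial.eq_C_of_natDegree_eq_zero h] at hp ⊢
    have := hC (p.coeff 0) (fun h0 => hp (by rw [h0, map_zero]))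
    exact ⟨this.1, by rw [this.2, zero_mul]⟩
  | succ n ih =>
    have h1 : p.divX.natDegree = n := by rw [Polynomial.natDegree_divX_eq_natDegree_tsub_one, h]; rfl
    have h2 : p.divX ≠ 0 := by
      intro h0
      rw [Polynomial.divX_eq_zero_iff] at h0
      rw [h0, Polynomial.natDegree_C] at h
      omega
    obtain ⟨h3, h4⟩ := ih h2 h1
    have h5 : (ψ p.divX * ψ Polynomial.X).natDegree = (n + 1) * (ψ Polynomial.X).natDegree := by
      rw [natDegree_mul h3 hX, h4, add_mul, one_mul]
    have h6 : ψ p = ψ p.divX * ψ Polynomial.X + ψ (Polynomial.C (p.coeff 0)) := by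
      rw [← map_mul, ← map_add, Polynomial.divX_mul_X_add]
    have h7 : (ψ p).natDegree = (n + 1) * (ψ Polynomial.X).natDegree := by
      rw [h6, natDegree_add_of_lt, h5]
      rw [hC', h5]
      positivity
    refine ⟨fun h0 => ?_, h7⟩
    rw [h0, show (0 : TwistedPolynomial Fq K).natDegree = 0 from rfl] at h7
    exact absurd h7.symm (by positivity)

/-- Comparison of the leading coefficients of the two products. -/
theorem pow_eq_self_of_commute {P : TwistedPolynomial Fq K} (hP : P ≠ 0) {c : K}
    (h : Commute (monomial 0 c) P) : c ^ Nat.card Fq ^ P.natDegree = c := by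
  have h1 := congrArg (fun Q => coeff Q P.natDegree) h.eq
  have h2 : (monomial 0 c * P).coeff (0 + P.natDegree) =
      c * P.coeff P.natDegree ^ (Nat.card Fq ^ 0) := by
    rw [coeff_mul_add _ (fun _ => coeff_eq_zero_of_natDegree_lt), coeff_monomial, if_pos rfl]
    intro i hi
    rw [coeff_monomial, if_neg hi.ne]
  have h3 : (P * monomial 0 c).coeff (P.natDegree + 0) =
      P.coeff P.natDegree * c ^ (Nat.card Fq ^ P.natDegree) := by
    rw [coeff_mul_add (fun _ => coeff_eq_zero_of_natDegree_lt), coeff_monomial, if_pos rfl]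
    intro i hi
    rw [coeff_monomial, if_neg hi.ne]
  simp only [zero_add, add_zero, pow_zero, pow_one] at h1 h2 h3
  rw [h2, h3, mul_comm] at h1
  exact (mul_left_cancel₀ (coeff_natDegree_ne_zero hP) h1).symm

end TwistedPolynomial

open TwistedPolynomial

variable {A : Type*} [CommRing A] [IsDomain A] [Algebra Fq A]

theorem DrinfeldModule.natDegree_aeval (D : DrinfeldModule Fq A K) {t : A}
    (ht : (D.φ t).natDegree ≠ 0) {p : Polynomial Fq} (hp : p ≠ 0) :
    D.φ (Polynomial.aeval t p) ≠ 0 ∧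
      (D.φ (Polynomial.aeval t p)).natDegree = p.natDegree * (D.φ t).natDegree := by
  have := natDegree_map_polynomial (D.φ.comp (Polynomial.aeval t).toRingHom) (by simpa using ht) hp
  simpa using this

theorem DrinfeldModule.transcendental (D : DrinfeldModule Fq A K) {t : A}
    (ht : (D.φ t).natDegree ≠ 0) : Transcendental Fq t := by
  rintro ⟨p, hp, h⟩
  apply (D.natDegree_aeval ht hp).1
  rw [h, map_zero]

/-- In a Drinfeld module in the sense of `DrinfeldModule`, a nonconstant element has a nonconstant
image as soon as some element has. -/
theorem DrinfeldModule.natDegree_ne_zero (D : DrinfeldModule Fq A K)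
    (hA : Algebra.trdeg Fq A ≤ 1) {t a : A} (ht : (D.φ t).natDegree ≠ 0)
    (ha : Transcendental Fq a) : (D.φ a).natDegree ≠ 0 := by
  intro h0
  have hφt : D.φ t ≠ 0 := fun h => ht (by rw [h]; rfl)
  set m := Nat.card Fq ^ (D.φ t).natDegree with hm
  have hm1 : 1 < m := by
    have := one_lt_card Fq
    exact Nat.one_lt_pow ht this
  -- If `φ_a` is a constant `c`, commutation with `φ_t` gives `c^m = c`, so `φ` kills `a^m - a`,
  -- which is nonzero by transcendence of `a`.
  have hbφ : D.φ (a ^ m - a) = 0 := by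
    have hc : Commute (D.φ a) (D.φ t) := (Commute.all a t).map D.φ
    rw [eq_monomial_zero h0] at hc
    have h1 := pow_eq_self_of_commute hφt hc
    rw [map_sub, map_pow, sub_eq_zero, eq_monomial_zero h0]
    have h2 : ∀ n : ℕ, (monomial 0 ((D.φ a).coeff 0) : TwistedPolynomial Fq K) ^ n =
        monomial 0 ((D.φ a).coeff 0 ^ n) := by
      intro n
      induction n with
      | zero => rw [pow_zero, pow_zero, one_eq_monomial]
      | succ n ih => rw [pow_succ, ih, monomial_mul_monomial, pow_zero, pow_one, pow_succ]
    rw [h2, h1]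
  have hb0 : a ^ m - a ≠ 0 := by
    intro h
    refine ha ⟨Polynomial.X ^ m - Polynomial.X, ?_, by simpa using h⟩
    exact FiniteField.X_pow_card_sub_X_ne_zero Fq hm1
  have htb : IsTranscendenceBasis Fq (fun _ : Unit => t) := by
    apply AlgebraicIndependent.isTranscendenceBasis_of_lift_trdeg_le_of_finite
    · exact algebraicIndependent_unique_type_iff.2 (D.transcendental ht)
    · simpa using hA
  have halg := htb.isAlgebraic
  -- As `A` is algebraic over `Fq[t]`, the killed element divides a nonzero polynomial in `t`. But
  -- `φ` is injective on `Fq[t]`, by degrees.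
  obtain ⟨⟨s, hs⟩, hs0, hdvd⟩ := (halg.isAlgebraic (a ^ m - a)).exists_nonzero_dvd
    (mem_nonZeroDivisors_of_ne_zero hb0)
  have hs' : s ∈ Algebra.adjoin Fq {t} := by simpa using hs
  rw [Algebra.adjoin_singleton_eq_range_aeval] at hs'
  obtain ⟨p, rfl⟩ := hs'
  have hp : p ≠ 0 := by
    rintro rfl
    exact hs0 (by ext; simp)
  obtain ⟨b, hb⟩ := hdvd
  have h3 : Polynomial.aeval t p = (a ^ m - a) * b := hb
  apply (D.natDegree_aeval ht hp).1
  rw [h3, map_mul, hbφ, zero_mul]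

end Constants

theorem trdeg_regularAway_le {Fq F : Type*} [Field Fq] [Field F] [Algebra Fq F]
    (h : Algebra.trdeg Fq F ≤ 1) (infty : ValuationSubring F) :
    Algebra.trdeg Fq (regularAway Fq infty) ≤ 1 :=
  (trdeg_le_of_injective (regularAway Fq infty).val Subtype.val_injective).trans h

end LocalLehmer

end

/-! ### Divisors of `V`: integrality of degrees, finiteness of bad places. -/

noncomputable section

namespace LocalLehmer

set_option linter.unusedSectionVars false

/-- The valuation ring determines the units, so every value of `v` is a power of `v π`, for `π` a
uniformizer of `u`. Surjectivity of `v` forces `v π` to be a generator, and integrality of `π` fixes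
its sign. -/
theorem intValuation_eq_of_integer_eq {K : Type*} [Field K]
    {u v : Valuation K (WithZero (Multiplicative ℤ))} (hu : Function.Surjective u)
    (hv : Function.Surjective v) (h : u.integer = v.integer) : u = v := by
  have hle : ∀ c, u c ≤ 1 ↔ v c ≤ 1 := fun c => by
    rw [← Valuation.mem_integer_iff, h, Valuation.mem_integer_iff]
  have hinv : ∀ (w : Valuation K (WithZero (Multiplicative ℤ))) {c : K}, c ≠ 0 →
      (w c = 1 ↔ w c ≤ 1 ∧ w c⁻¹ ≤ 1) := by
    intro w c hc
    have h0 : 0 < w c := zero_lt_iff.2 ((Valuation.ne_zero_iff w).2 hc)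
    rw [map_inv₀, inv_le_one₀ h0, le_antisymm_iff]
  have hone : ∀ {c : K}, c ≠ 0 → (u c = 1 ↔ v c = 1) := by
    intro c hc
    rw [hinv u hc, hinv v hc, hle, hle]
  obtain ⟨π, hπ⟩ := hu (WithZero.exp (-1))
  obtain ⟨ϖ, hϖ⟩ := hv (WithZero.exp (-1))
  have hπ0 : π ≠ 0 := by
    rintro rfl
    exact WithZero.exp_ne_zero (hπ.symm.trans (map_zero u))
  have hϖ0 : ϖ ≠ 0 := by
    rintro rfl
    exact WithZero.exp_ne_zero (hϖ.symm.trans (map_zero v))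
  have key : ∀ {c : K}, c ≠ 0 → v c = v π ^ (-WithZero.log (u c)) := by
    intro c hc
    have huc : u c ≠ 0 := (Valuation.ne_zero_iff u).2 hc
    have h1 : u (c * π ^ WithZero.log (u c)) = 1 := by
      rw [map_mul, map_zpow₀, hπ, ← WithZero.exp_log huc, WithZero.log_exp, ← WithZero.exp_zsmul,
        ← WithZero.exp_add]
      simp
    rw [hone (mul_ne_zero hc (zpow_ne_zero _ hπ0)), map_mul, map_zpow₀] at h1
    rw [zpow_neg]
    exact eq_inv_of_mul_eq_one_left h1
  have hvπ : v π = WithZero.exp (-1) := by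
    have h1 := key hϖ0
    have hvπ0 : v π ≠ 0 := (Valuation.ne_zero_iff v).2 hπ0
    rw [hϖ] at h1
    have h2 := congrArg WithZero.log h1
    rw [WithZero.log_exp, WithZero.log_zpow, smul_eq_mul] at h2
    have h3 : v π ≤ 1 := (hle π).1 (by rw [hπ, ← WithZero.exp_zero, WithZero.exp_le_exp]; simp)
    rw [← WithZero.exp_zero, ← WithZero.exp_log hvπ0, WithZero.exp_le_exp] at h3
    rcases Int.isUnit_iff.1 (IsUnit.of_mul_eq_one_right (-(-WithZero.log (u ϖ)))
      (by linarith : (-(-WithZero.log (u ϖ))) * WithZero.log (v π) = 1)) with h4 | h4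
    · omega
    · rw [← WithZero.exp_log hvπ0, h4]
  ext c
  by_cases hc : c = 0
  · simp [hc]
  have huc : u c ≠ 0 := (Valuation.ne_zero_iff u).2 hc
  rw [key hc, hvπ, ← WithZero.exp_zsmul, ← WithZero.exp_log huc]
  simp

/-- The finite difference of order `deg P` is the constant `(deg P)!` times the leading coefficient,
and also an integral combination of the integers `f n`. -/
theorem exists_int_leadingCoeff_mul_factorial (P : Polynomial ℚ) {f : ℕ → ℕ}
    (h : ∀ᶠ n : ℕ in atTop, P.eval (n : ℚ) = f n) :
    ∃ z : ℤ, P.leadingCoeff * (P.natDegree.factorial : ℚ) = z := by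
  obtain ⟨n, hn⟩ := eventually_atTop.1 h
  have h1 := congrFun P.fwdDiff_iter_degree_eq_factorial (n : ℚ)
  rw [fwdDiff_iter_eq_sum_shift] at h1
  refine ⟨∑ j ∈ Finset.range (P.natDegree + 1),
    ((-1 : ℤ) ^ (P.natDegree - j) * P.natDegree.choose j) * f (n + j), ?_⟩
  have h2 : (P.leadingCoeff • (P.natDegree.factorial : ℚ → ℚ)) (n : ℚ) =
    P.leadingCoeff * (P.natDegree.factorial : ℚ) := rfl
  rw [← h2, ← h1]
  push_cast
  apply Finset.sum_congr rfl
  intro j _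
  have h3 := hn (n + j) (by omega)
  push_cast at h3
  rw [nsmul_one, h3, zsmul_eq_mul]
  push_cast
  ring

namespace ProjectiveVariety

variable {k K : Type*} [Field k] [Field K] [Algebra k K] {M : ℕ} {V : ProjectiveVariety k K M}

open MvPolynomial

theorem Point.exists_int_degree_eq (Q : V.Point) : ∃ z : ℤ, Q.degree = z := by
  rw [Point.degree]
  split_ifs with h
  · exact exists_int_leadingCoeff_mul_factorial _ h.choose_spec
  · exact ⟨0, by simp⟩

/-- Two polynomials that eventually agree with the Hilbert function are equal, so the choice in the
definition of the degree is harmless. -/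
theorem Point.degree_eq_of_eventually {Q : V.Point} {P : Polynomial ℚ}
    (h : ∀ᶠ n : ℕ in atTop, P.eval (n : ℚ) = Q.hilbertFunction n) :
    Q.degree = P.leadingCoeff * (P.natDegree.factorial : ℚ) := by
  have hex : ∃ P : Polynomial ℚ, ∀ᶠ n : ℕ in atTop, P.eval (n : ℚ) = Q.hilbertFunction n := ⟨P, h⟩
  rw [Point.degree, dif_pos hex]
  have : hex.choose = P := by
    apply Polynomial.eq_of_infinite_eval_eq
    obtain ⟨n, hn⟩ := eventually_atTop.1 (hex.choose_spec.and h)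
    refine Set.Infinite.mono (s := Set.range fun j : ℕ => ((n + j : ℕ) : ℚ)) ?_
      (Set.infinite_range_of_injective fun a b hab => ?_)
    · rintro _ ⟨j, rfl⟩
      exact (hn (n + j) (by omega)).1.trans (hn (n + j) (by omega)).2.symm
    · have : ((n + a : ℕ) : ℚ) = ((n + b : ℕ) : ℚ) := hab
      have := Nat.cast_injective this
      omega
  rw [this]

/-- Every element of the function field is a quotient of two forms of the same degree. -/
theorem exists_eq_div (V : ProjectiveVariety k K M) (c : K) :
    ∃ (n : ℕ) (G H : MvPolynomial (Fin (M + 1)) k), G.IsHomogeneous n ∧ H.IsHomogeneous n ∧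
      aeval V.coord H ≠ 0 ∧ c = aeval V.coord G / aeval V.coord H := by
  have hc : c ∈ IntermediateField.adjoin k {z : K | ∃ i j, z = V.coord i / V.coord j} := by
    rw [V.adjoin_eq_top]
    exact IntermediateField.mem_top
  induction hc using IntermediateField.adjoin_induction with
  | mem x hx =>
    obtain ⟨i, j, rfl⟩ := hx
    by_cases hj : V.coord j = 0
    · exact ⟨0, 0, 1, isHomogeneous_zero _ _ _, isHomogeneous_one _ _, by simp, by simp [hj]⟩
    · exact ⟨1, X i, X j, isHomogeneous_X _ _, isHomogeneous_X _ _, by simpa, by simp⟩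
  | algebraMap x =>
    exact ⟨0, C x, 1, isHomogeneous_C _ _, isHomogeneous_one _ _, by simp, by simp⟩
  | add x y _ _ hx hy =>
    obtain ⟨m, G, H, hG, hH, h0, rfl⟩ := hx
    obtain ⟨n, G', H', hG', hH', h0', rfl⟩ := hy
    refine ⟨m + n, G * H' + H * G', H * H', (hG.mul hH').add (hH.mul hG'), hH.mul hH', ?_, ?_⟩
    · rw [map_mul]
      exact mul_ne_zero h0 h0'
    · rw [map_add, map_mul, map_mul, map_mul, div_add_div _ _ h0 h0']
  | inv x _ hx =>
    obtain ⟨m, G, H, hG, hH, h0, rfl⟩ := hx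
    by_cases hG0 : aeval V.coord G = 0
    · exact ⟨0, 0, 1, isHomogeneous_zero _ _ _, isHomogeneous_one _ _, by simp, by simp [hG0]⟩
    · exact ⟨m, H, G, hH, hG, hG0, by rw [inv_div]⟩
  | mul x y _ _ hx hy =>
    obtain ⟨m, G, H, hG, hH, h0, rfl⟩ := hx
    obtain ⟨n, G', H', hG', hH', h0', rfl⟩ := hy
    refine ⟨m + n, G * G', H * H', hG.mul hG', hH.mul hH', ?_, ?_⟩
    · rw [map_mul]
      exact mul_ne_zero h0 h0'
    · rw [map_mul, map_mul, div_mul_div_comm]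

namespace Point

variable (Q : V.Point)

theorem aeval_ne_zero {n : ℕ} {H : MvPolynomial (Fin (M + 1)) k} (hH : H.IsHomogeneous n)
    (h : H ∉ Q.ideal) : aeval V.coord H ≠ 0 := fun h0 => h (Q.mem_of_aeval_eq_zero n H hH h0)

theorem valuation_div_le_one {u : Valuation K (WithZero (Multiplicative ℤ))}
    (hu : u.integer = Q.localRing) {n : ℕ} {G H : MvPolynomial (Fin (M + 1)) k}
    (hG : G.IsHomogeneous n) (hH : H.IsHomogeneous n) (h : H ∉ Q.ideal) :
    u (aeval V.coord G / aeval V.coord H) ≤ 1 := by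
  rw [← Valuation.mem_integer_iff, hu]
  exact ⟨n, G, H, hG, hH, h, rfl⟩

/-- If `G/H` were a unit, its inverse would be some `A/B` with `B` outside the ideal. Then `HB - AG`
vanishes on `V`, so it lies in the ideal, and so does `HB`, contradicting primality. -/
theorem valuation_div_lt_one {u : Valuation K (WithZero (Multiplicative ℤ))}
    (hu : u.integer = Q.localRing) {n : ℕ} {G H : MvPolynomial (Fin (M + 1)) k}
    (hG : G.IsHomogeneous n) (hH : H.IsHomogeneous n) (h : H ∉ Q.ideal) (hGQ : G ∈ Q.ideal) :
    u (aeval V.coord G / aeval V.coord H) < 1 := by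
  refine lt_of_le_of_ne (Q.valuation_div_le_one hu hG hH h) fun h1 => ?_
  have hz : aeval V.coord G / aeval V.coord H ≠ 0 := by
    intro h0
    rw [h0, map_zero] at h1
    exact zero_ne_one h1
  have hinv : (aeval V.coord G / aeval V.coord H)⁻¹ ∈ Q.localRing := by
    rw [← hu, Valuation.mem_integer_iff, map_inv₀, h1, inv_one]
  obtain ⟨m, A, B, hA, hB, hBQ, hAB⟩ := hinv
  have hB0 := Q.aeval_ne_zero hB hBQ
  have hG0 : aeval V.coord G ≠ 0 := fun h0 => hz (by rw [h0, zero_div])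
  rw [inv_div, div_eq_div_iff hG0 hB0] at hAB
  have hmem : H * B - A * G ∈ Q.ideal := by
    refine Q.mem_of_aeval_eq_zero (n + m) _ ((hH.mul hB).sub ?_) ?_
    · rw [add_comm n m]
      exact hA.mul hG
    · rw [map_sub, map_mul, map_mul, hAB, sub_self]
  have : H * B ∈ Q.ideal := by
    simpa using Q.ideal.add_mem hmem (Q.ideal.mul_mem_left A hGQ)
  exact (Q.isPrime.mem_or_mem this).elim h hBQ

/-- If a form `D` belongs to the ideal of `Q` but does not vanish on `V`, then this ideal is minimal
over the ideal of `V` and `D`. -/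
theorem ideal_mem_minimalPrimes {u : Valuation K (WithZero (Multiplicative ℤ))}
    (hu : u.integer = Q.localRing) {d : ℕ} {D : MvPolynomial (Fin (M + 1)) k}
    (hD : D.IsHomogeneous d) (hD0 : aeval V.coord D ≠ 0) (hDQ : D ∈ Q.ideal) :
    Q.ideal ∈ (Ideal.span ({G | ∃ n, G.IsHomogeneous n ∧ aeval V.coord G = 0} ∪
      {D})).minimalPrimes := by
  set J := Ideal.span ({G | ∃ n, G.IsHomogeneous n ∧ aeval V.coord G = 0} ∪ {D}) with hJ
  have hJQ : J ≤ Q.ideal := by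
    rw [hJ, Ideal.span_le]
    rintro G (⟨n, hG, h0⟩ | rfl)
    · exact Q.mem_of_aeval_eq_zero n G hG h0
    · exact hDQ
  have := Q.isPrime
  obtain ⟨P, hP, hPQ⟩ := Ideal.exists_minimalPrimes_le hJQ
  have hPp : P.IsPrime := hP.1.1
  have hJP : J ≤ P := hP.1.2
  obtain ⟨i, hi⟩ := Q.exists_X_notMem
  have hX : ∀ n : ℕ, (X i ^ n : MvPolynomial (Fin (M + 1)) k) ∉ Q.ideal := fun n h =>
    hi (Q.isPrime.mem_of_pow_mem n h)
  have hXh : ∀ n : ℕ, (X i ^ n : MvPolynomial (Fin (M + 1)) k).IsHomogeneous n := fun n =>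
    isHomogeneous_X_pow (R := k) i n
  -- Let `z = U/Xᵢ^m` and `z₀ = D/Xᵢ^d`. Since `u z < 1` and values are integral powers, some `z^n`
  -- is a multiple of `z₀` in the local ring. Clearing denominators puts `U^n Xᵢ^d B` in the ideal
  -- `J`, hence in `P`, while `Xᵢ` and `B` lie outside `P`.
  have hhom : ∀ (m : ℕ) (U : MvPolynomial (Fin (M + 1)) k), U.IsHomogeneous m → U ∈ Q.ideal →
      U ∈ P := by
    intro m U hU hUQ
    set z := aeval V.coord U / aeval V.coord (X i ^ m : MvPolynomial (Fin (M + 1)) k) with hz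
    set z₀ := aeval V.coord D / aeval V.coord (X i ^ d : MvPolynomial (Fin (M + 1)) k) with hz₀
    have hz1 : u z < 1 := Q.valuation_div_lt_one hu hU (hXh m) (hX m) hUQ
    have hX0 : ∀ n : ℕ, aeval V.coord (X i ^ n) ≠ 0 := fun n => Q.aeval_ne_zero (hXh n) (hX n)
    have hz₀0 : u z₀ ≠ 0 := (Valuation.ne_zero_iff u).2 (div_ne_zero hD0 (hX0 d))
    obtain ⟨n, hn⟩ : ∃ n : ℕ, u z ^ n ≤ u z₀ := by
      by_cases hz0 : u z = 0
      · exact ⟨1, by simp [hz0]⟩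
      refine ⟨(WithZero.log (u z₀)).natAbs, ?_⟩
      have h1 : WithZero.log (u z) < 0 := by
        rw [← WithZero.log_one]
        exact (WithZero.log_lt_log hz0 one_ne_zero).2 hz1
      rw [← WithZero.log_le_log (pow_ne_zero _ hz0) hz₀0, WithZero.log_pow, nsmul_eq_mul]
      have h2 : -((WithZero.log (u z₀)).natAbs : ℤ) ≤ WithZero.log (u z₀) := by omega
      have h3 : (0 : ℤ) ≤ (WithZero.log (u z₀)).natAbs := by positivity
      push_cast at h2 h3 ⊢
      nlinarith
    have hmem : z ^ n / z₀ ∈ Q.localRing := by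
      rw [← hu, Valuation.mem_integer_iff, map_div₀, map_pow]
      exact (div_le_one₀ (zero_lt_iff.2 hz₀0)).2 hn
    obtain ⟨l, A, B, hA, hB, hBQ, hAB⟩ := hmem
    have hB0 := Q.aeval_ne_zero hB hBQ
    have heq : aeval V.coord (U ^ n * X i ^ d * B) = aeval V.coord (A * D * X i ^ (m * n)) := by
      rw [hz, hz₀, div_pow, div_div_div_eq, ← map_pow, ← map_pow, ← pow_mul,
        div_eq_div_iff (mul_ne_zero (hX0 _) hD0) hB0] at hAB
      simp only [map_mul] at hAB ⊢
      rw [hAB]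
      ring
    have hJ1 : U ^ n * X i ^ d * B - A * D * X i ^ (m * n) ∈ J := by
      refine Ideal.subset_span (Or.inl ⟨m * n + d + l, ?_, by rw [map_sub, heq, sub_self]⟩)
      refine (((hU.pow n).mul (hXh d)).mul hB).sub ?_
      have := (hA.mul hD).mul (hXh (m * n))
      rwa [show l + d + m * n = m * n + d + l by ring] at this
    have hJ2 : A * D * X i ^ (m * n) ∈ J :=
      Ideal.mul_mem_right _ _ (Ideal.mul_mem_left _ _ (Ideal.subset_span (Or.inr rfl)))
    have hJ3 : U ^ n * X i ^ d * B ∈ P := hJP (by simpa using J.add_mem hJ1 hJ2)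
    rcases hPp.mem_or_mem hJ3 with h | h
    · rcases hPp.mem_or_mem h with h | h
      · exact hPp.mem_of_pow_mem n h
      · exact absurd (hPQ h) (hX d)
    · exact absurd (hPQ h) hBQ
  have hQP : Q.ideal ≤ P := by
    intro G hG
    rw [← sum_homogeneousComponent G]
    exact P.sum_mem fun n _ => hhom n _ (homogeneousComponent_isHomogeneous n G)
      (Q.isHomogeneous G hG n)
  rwa [le_antisymm hQP hPQ]

end Point

/-- A nonzero element of the function field has nontrivial valuation at finitely many divisors. -/
theorem finite_valuation_ne_one (V : ProjectiveVariety k K M) {c : K}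
    (hc : c ≠ 0) :
    {u : Valuation K (WithZero (Multiplicative ℤ)) | Function.Surjective u ∧
      (∃ Q : V.Point, u.integer = Q.localRing) ∧ u c ≠ 1}.Finite := by
  classical
  obtain ⟨n, G, H, hG, hH, hH0, rfl⟩ := V.exists_eq_div c
  have hG0 : aeval V.coord G ≠ 0 := fun h => hc (by rw [h, zero_div])
  set S := {u : Valuation K (WithZero (Multiplicative ℤ)) | Function.Surjective u ∧
      (∃ Q : V.Point, u.integer = Q.localRing) ∧
        u (aeval V.coord G / aeval V.coord H) ≠ 1} with hS
  -- Each bad valuation is sent to the ideal of its divisor, which is minimal over the ideal of `V`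
  -- and `GH`. There are finitely many such primes, and the ideal determines the valuation. The
  -- default `⊥` is never used on `S`.
  let F : Valuation K (WithZero (Multiplicative ℤ)) → Ideal (MvPolynomial (Fin (M + 1)) k) :=
    fun u => if h : ∃ Q : V.Point, u.integer = Q.localRing then h.choose.ideal else ⊥
  have hF : ∀ u ∈ S, ∃ Q : V.Point, u.integer = Q.localRing ∧ F u = Q.ideal := by
    rintro u ⟨-, h, -⟩
    exact ⟨h.choose, h.choose_spec, dif_pos h⟩
  refine Set.Finite.of_finite_image (f := F) (Set.Finite.subset
    (Ideal.finite_minimalPrimes_of_isNoetherianRing _ (Ideal.span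
      ({P | ∃ n, P.IsHomogeneous n ∧ aeval V.coord P = 0} ∪ {G * H}))) ?_) ?_
  · rintro _ ⟨u, hu, rfl⟩
    obtain ⟨Q, hQ, hFQ⟩ := hF u hu
    rw [hFQ]
    refine Q.ideal_mem_minimalPrimes hQ (hG.mul hH) (by
      rw [map_mul]; exact mul_ne_zero hG0 hH0) ?_
    by_contra hGH
    have hGQ : G ∉ Q.ideal := fun h => hGH (Q.ideal.mul_mem_right _ h)
    have hHQ : H ∉ Q.ideal := fun h => hGH (Q.ideal.mul_mem_left _ h)
    apply hu.2.2
    apply le_antisymm (Q.valuation_div_le_one hQ hG hH hHQ)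
    have h1 := Q.valuation_div_le_one hQ hH hG hGQ
    rw [← inv_div, map_inv₀] at h1
    exact (inv_le_one₀ (zero_lt_iff.2
      ((Valuation.ne_zero_iff u).2 (div_ne_zero hG0 hH0)))).1 h1
  · intro u hu u' hu' h
    obtain ⟨Q, hQ, hFQ⟩ := hF u hu
    obtain ⟨Q', hQ', hFQ'⟩ := hF u' hu'
    have hQQ : Q = Q' := by
      have : Q.ideal = Q'.ideal := hFQ.symm.trans (h.trans hFQ')
      cases Q
      cases Q'
      congr
    exact intValuation_eq_of_integer_eq hu.1 hu'.1 (by rw [hQ, hQ', hQQ])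

end ProjectiveVariety

end LocalLehmer

end

/-! ### The lower bound, uniformly in the place. -/

noncomputable section

namespace LocalLehmer

set_option linter.unusedSectionVars false

open Real TwistedPolynomial

namespace ProjectiveVariety.Place

variable {k K : Type*} [Field k] [Field K] [Algebra k K] {M : ℕ} {V : ProjectiveVariety k K M}
  {L : Type*} [Field L] [Algebra K L]
variable {Fq A : Type*} [Field Fq] [Finite Fq] [CommRing A] [Algebra Fq A] [Algebra Fq K]

theorem localHeight_eq [Algebra Fq L] (w : V.Place L) (D : DrinfeldModule Fq A K) {a t : A}
    (ha : (D.φ a).natDegree ≠ 0) (ht : (D.φ t).natDegree ≠ 0) (he : w.ramificationIndex ≠ 0)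
    (y : L) :
    w.localHeight D a y = (w.divisor.degree : ℝ) * w.residueDegree / Module.finrank K L *
      (w.ramificationIndex * height (intAbs w.val w.ramificationIndex) (D.φ t) y) := by
  have hne : ∀ {b : A}, (D.φ b).natDegree ≠ 0 → D.φ b ≠ 0 := fun h h0 => h (by rw [h0]; rfl)
  have hw := w.ramificationIndex_spec he
  rw [localHeight, w.limitVal_eq D ha (hne ha) he hw, height_eq_of_commute (hne ht) ht
    (isNonarchimedean_intAbs w.val _) (intAbs_algebraMap w.val _ he hw) (hne ha) ha
    ((Commute.all t a).map D.φ)]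
  ring

/-- Degree times residue degree is an integer, positive because the local height is; hence it is at
least 1 and can be dropped. Positivity also rules out the default value 0 of the ranks. -/
theorem localHeight_ge [Algebra Fq L] (w : V.Place L) (D : DrinfeldModule Fq A K) {a t : A}
    (ha : (D.φ a).natDegree ≠ 0) (ht : (D.φ t).natDegree ≠ 0) (he : w.ramificationIndex ≠ 0)
    {y : L} (hy : 0 < w.localHeight D a y) :
    0 < height (intAbs w.val w.ramificationIndex) (D.φ t) y ∧
    (w.ramificationIndex * height (intAbs w.val w.ramificationIndex) (D.φ t) y) /
      Module.finrank K L ≤ w.localHeight D a y := by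
  have hne : ∀ {b : A}, (D.φ b).natDegree ≠ 0 → D.φ b ≠ 0 := fun h h0 => h (by rw [h0]; rfl)
  have hw := w.ramificationIndex_spec he
  have h0 := height_nonneg (hne ht) ht (isNonarchimedean_intAbs w.val w.ramificationIndex)
    (intAbs_algebraMap w.val _ he hw) y
  rw [w.localHeight_eq D ha ht he] at hy ⊢
  set h := height (intAbs w.val w.ramificationIndex) (D.φ t) y
  have he0 : (0 : ℝ) < w.ramificationIndex := by exact_mod_cast Nat.pos_of_ne_zero he
  have hpos : 0 < h := by
    refine lt_of_le_of_ne h0 fun h1 => ?_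
    rw [← h1, mul_zero, mul_zero] at hy
    exact lt_irrefl _ hy
  refine ⟨hpos, ?_⟩
  have hEh : 0 < w.ramificationIndex * h := mul_pos he0 hpos
  have h1 := pos_of_mul_pos_left hy hEh.le
  obtain ⟨z, hz⟩ := w.divisor.exists_int_degree_eq
  have hfin : (0 : ℝ) < Module.finrank K L := by
    refine lt_of_le_of_ne (by positivity) fun h2 => ?_
    rw [← h2, div_zero] at h1
    exact lt_irrefl _ h1
  rw [hz] at h1 ⊢
  have h2 : (0 : ℝ) < ((z : ℚ) : ℝ) * w.residueDegree := by
    by_contra! h3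
    exact absurd h1 (not_lt.2 (div_nonpos_of_nonpos_of_nonneg h3 hfin.le))
  have h3 : (1 : ℝ) ≤ ((z : ℚ) : ℝ) * w.residueDegree := by
    have h4 : (0 : ℤ) < z * w.residueDegree := by exact_mod_cast h2
    exact_mod_cast Int.add_one_le_iff.2 h4
  rw [div_mul_eq_mul_div]
  exact div_le_div_of_nonneg_right (le_mul_of_one_le_left hEh.le h3) hfin.le

end ProjectiveVariety.Place

namespace TwistedPolynomial

variable {Fq K : Type*} [Field Fq] [Finite Fq] [Field K] [Algebra Fq K]
  {P : TwistedPolynomial Fq K} {N : AbsoluteValue K ℝ}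

/-- If all the nonzero coefficients have absolute value `1`, then the height is `log⁺`. -/
theorem height_eq_posLog (hP : P ≠ 0) (h0 : P.coeff 0 = 0) (hc : ∀ i, P.coeff i ≠ 0 →
    N (P.coeff i) = 1) {L : Type*} [Field L] [Algebra K L] [Algebra Fq L]
    {NL : AbsoluteValue L ℝ} (hNL : IsNonarchimedean NL)
    (hN : ∀ a, NL (algebraMap K L a) = N a) (y : L) : height NL P y = log⁺ (NL y) := by
  have hd : P.natDegree ≠ 0 := fun h => coeff_natDegree_ne_zero hP (by rw [h, h0])
  have hc1 : ∀ i, N (P.coeff i) ≤ 1 := by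
    intro i
    by_cases h : P.coeff i = 0
    · simp [h]
    · exact (hc i h).le
  have hlead := hc _ (coeff_natDegree_ne_zero hP)
  have key : ∀ y : L, |log⁺ (NL (P.eval y)) - (Nat.card Fq : ℝ) ^ P.natDegree * log⁺ (NL y)| ≤ 0 := by
    intro y
    rw [abs_nonpos_iff, sub_eq_zero]
    rcases le_or_gt (NL y) 1 with hy | hy
    · have h1 : NL (P.eval y) ≤ 1 := by
        refine (abs_eval_le hNL hN P y).trans (gauss_le fun i => ?_)
        exact mul_le_one₀ (hc1 i) (by positivity) (pow_le_one₀ (by positivity) hy)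
      rw [posLog_eq_zero_iff _ |>.2, posLog_eq_zero_iff _ |>.2, mul_zero]
      · rwa [abs_of_nonneg (by positivity)]
      · rwa [abs_of_nonneg (by positivity)]
    · have h1 := abs_eval_eq (i := P.natDegree) hNL hN (P := P) (y := y) (fun j hj => by
        rw [term, term, hlead, one_mul]
        rcases lt_or_gt_of_ne hj with h | h
        · refine (mul_le_of_le_one_left (by positivity) (hc1 j)).trans_lt ?_
          exact pow_lt_pow_right₀ hy (card_pow_lt Fq h)
        · rw [coeff_eq_zero_of_natDegree_lt h, map_zero, zero_mul]
          positivity)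
      rw [term, hlead, one_mul] at h1
      have h2 : 1 ≤ |NL y| := by rw [abs_of_nonneg (by positivity)]; exact hy.le
      rw [h1, posLog_eq_log h2, posLog_eq_log, log_pow]
      · push_cast
        rfl
      · rw [abs_pow]
        exact one_le_pow₀ h2
  have := abs_height_sub_le hP hd hNL hN key y
  exact sub_eq_zero.1 (abs_nonpos_iff.1 this)

/-- The constant comes from the single `P`; any commuting `Q` only serves to rewrite the exponent.
With `j` the index of `Q` at the common fixed radius, `deg P / i = deg Q / j ≤ deg Q / r₀`, as `Q`
has no term of index below `r₀`. -/
theorem exists_height_lower_bound.{u} {K : Type u} [Field K] [Algebra Fq K]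
    {P : TwistedPolynomial Fq K} (hP : P ≠ 0) (h0 : P.coeff 0 = 0)
    (v : Valuation K (WithZero (Multiplicative ℤ))) {p : ℕ} (hp : p.Prime)
    {f : ℕ} (hq : Nat.card Fq = p ^ f) :
    ∃ C : ℝ, 0 < C ∧ ∀ Q : TwistedPolynomial Fq K, Q ≠ 0 → Commute P Q →
      ∀ r₀, r₀ ≠ 0 → (∀ i < r₀, Q.coeff i = 0) →
      ∀ (L : Type u) [Field L] [Algebra K L] [Algebra Fq L]
      (w : Valuation L (WithZero (Multiplicative ℤ))) (e : ℕ), ¬ p ∣ e →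
      (∀ c, w (algebraMap K L c) = v c ^ e) →
      ∀ x : L, 0 < height (intAbs w e) P x →
        C / (e : ℝ) ^ ((Q.natDegree : ℝ) / r₀) ≤ height (intAbs w e) P x := by
  obtain ⟨R, hR, hG⟩ := exists_gauss_eq_self (intAbs v 1) hP h0
  obtain ⟨i, H⟩ := exists_fixedRadius_of_gauss_eq hP hR hG
  obtain ⟨C, hC, hb⟩ := H.exists_height_lower_bound hP h0
    (fun c _ => by simpa using exists_log_intAbs_eq v 1 c) hp hq
  refine ⟨C, hC, fun Q hQ hcomm r₀ hr₀ hQ0 L _ _ _ w e hpe hw x hx => ?_⟩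
  have he : e ≠ 0 := by
    rintro rfl
    exact hpe (dvd_zero p)
  refine le_trans ?_ (hb L (intAbs w e) (isNonarchimedean_intAbs w e)
    (intAbs_algebraMap w e he hw) e hpe (fun y _ => exists_log_intAbs_eq w e y) x hx)
  obtain ⟨j, Hj, hij⟩ := H.exists_of_commute (isNonarchimedean_intAbs v 1) hP hQ h0 hcomm
  have hi := H.ne_zero h0
  have hj : r₀ ≤ j := by
    by_contra! h
    exact Hj.coeff_ne_zero (hQ0 j h)
  have he1 : (1 : ℝ) ≤ e := by exact_mod_cast Nat.one_le_iff_ne_zero.2 he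
  have hr₀' : (0 : ℝ) < r₀ := by exact_mod_cast Nat.pos_of_ne_zero hr₀
  have hi' : (0 : ℝ) < i := by exact_mod_cast Nat.pos_of_ne_zero hi
  have hjr : (r₀ : ℝ) ≤ j := by exact_mod_cast hj
  have hexp : (P.natDegree : ℝ) / i ≤ (Q.natDegree : ℝ) / r₀ := by
    rw [div_le_div_iff₀ hi' hr₀']
    calc (P.natDegree : ℝ) * r₀ ≤ P.natDegree * j := by gcongr
      _ = Q.natDegree * i := by exact_mod_cast hij
  gcongr

end TwistedPolynomial

/-- The lower bound for the local heights. -/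
theorem ProjectiveVariety.exists_localHeight_lower_bound.{u} {p : ℕ} [Fact p.Prime] {Fq : Type*}
    [Field Fq] [Finite Fq] [CharP Fq p] {A : Type*} [CommRing A] [IsDomain A] [Algebra Fq A]
    (hA : Algebra.trdeg Fq A ≤ 1) {K : Type u} [Field K] [Algebra Fq K] {k : Type*} [Field k]
    [Algebra k K] {M : ℕ} (V : ProjectiveVariety k K M) (D : DrinfeldModule Fq A K) :
    ∃ C : ℝ, 0 < C ∧ ∀ a : A, Transcendental Fq a → ∀ (t : A) (r₀ r : ℕ),
      IsLeast {n : ℕ | (D.φ t).coeff n ≠ 0} r₀ → IsGreatest {n : ℕ | (D.φ t).coeff n ≠ 0} r →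
      1 ≤ r₀ → ∀ (L : Type u) [Field L] [Algebra K L] [Algebra Fq L] (w : V.Place L),
      ¬ p ∣ w.ramificationIndex → ∀ x : L, 0 < w.localHeight D a x →
      C / ((w.ramificationIndex : ℝ) ^ ((r : ℝ) / (r₀ : ℝ) - 1) * (Module.finrank K L : ℝ)) ≤
        w.localHeight D a x := by
  classical
  have hp : p.Prime := Fact.out
  obtain ⟨f, hq⟩ : ∃ f : ℕ, Nat.card Fq = p ^ f := by
    let _ := Fintype.ofFinite Fq
    obtain ⟨m, -, hm⟩ := FiniteField.card Fq p
    exact ⟨m, by rw [Nat.card_eq_fintype_card, hm]⟩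
  -- If no such `t₁` exists, there is no `t` to which the bound applies.
  by_cases hex : ∃ t₁ : A, D.φ t₁ ≠ 0 ∧ (D.φ t₁).coeff 0 = 0
  swap
  · refine ⟨1, one_pos, fun a _ t r₀ r hr₀ hr h1 => absurd ⟨t, ?_, ?_⟩ hex⟩
    · intro h
      exact hr₀.1 (by rw [h, TwistedPolynomial.coeff_zero])
    · by_contra h
      have := hr₀.2 h
      omega
  obtain ⟨t₁, hP, h0⟩ := hex
  set P := D.φ t₁ with hPdef
  have hd : P.natDegree ≠ 0 := fun h => coeff_natDegree_ne_zero hP (by rw [h, h0])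
  -- The bad places are those where some nonzero coefficient of `P` is not a unit.
  have hbad : (⋃ i ∈ SkewPolynomial.support P,
      {u : Valuation K (WithZero (Multiplicative ℤ)) | Function.Surjective u ∧
        (∃ Q : V.Point, u.integer = Q.localRing) ∧ u (P.coeff i) ≠ 1}).Finite :=
    Set.Finite.biUnion (Finset.finite_toSet _)
      fun i hi => V.finite_valuation_ne_one (mem_support.1 hi)
  choose Cv hCv hbound using fun v : Valuation K (WithZero (Multiplicative ℤ)) =>
    TwistedPolynomial.exists_height_lower_bound hP h0 v hp hq
  obtain ⟨C₀, hC₀, hC₀le⟩ : ∃ C₀ : ℝ, 0 < C₀ ∧ ∀ v ∈ hbad.toFinset, C₀ ≤ Cv v := by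
    generalize hbad.toFinset = S
    induction S using Finset.induction_on with
    | empty => exact ⟨1, one_pos, by simp⟩
    | insert a s _ ih =>
      obtain ⟨C₀, h1, h2⟩ := ih
      refine ⟨min C₀ (Cv a), lt_min h1 (hCv a), fun v hv => ?_⟩
      rcases Finset.mem_insert.1 hv with rfl | hv
      · exact min_le_right _ _
      · exact (min_le_left _ _).trans (h2 v hv)
  refine ⟨min C₀ 1, lt_min hC₀ one_pos, ?_⟩
  intro a ha t r₀ r hr₀ hr h1 L _ _ _ w hpe x hx
  have he : w.ramificationIndex ≠ 0 := fun h => hpe (by rw [h]; exact dvd_zero p)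
  have hw := w.ramificationIndex_spec he
  obtain ⟨hpos, hge⟩ := w.localHeight_ge D (D.natDegree_ne_zero hA hd ha) hd he hx
  refine le_trans ?_ hge
  set e := w.ramificationIndex
  have he1 : (1 : ℝ) ≤ e := by exact_mod_cast Nat.one_le_iff_ne_zero.2 he
  have he0 : (0 : ℝ) < e := one_pos.trans_le he1
  have hrdeg : (D.φ t).natDegree = r := natDegree_eq hr.1 fun m hm => by
    by_contra h
    exact absurd (hr.2 h) (not_le.2 hm)
  have hr₀r : (r₀ : ℝ) ≤ r := by exact_mod_cast hr.2 hr₀.1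
  have hr₀' : (0 : ℝ) < r₀ := by exact_mod_cast h1
  have hfin0 : (0 : ℝ) ≤ Module.finrank K L := by positivity
  rw [← div_div]
  gcongr
  -- The factor `e` between the two normalizations accounts for the `-1` in the exponent.
  rw [rpow_sub_one he0.ne', div_div_eq_mul_div, mul_comm, mul_div_assoc]
  gcongr
  change _ ≤ height (intAbs w.val e) P x
  by_cases hmem : w.base ∈ hbad.toFinset
  · refine le_trans ?_ (hbound w.base (D.φ t) (fun h => hr₀.1 (by
      rw [h, TwistedPolynomial.coeff_zero])) ((Commute.all t₁ t).map D.φ) r₀ (by omega)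
      (fun i hi => by
        by_contra h
        exact absurd (hr₀.2 h) (not_le.2 hi)) L w.val e hpe hw x hpos)
    rw [hrdeg]
    gcongr
    exact (min_le_left _ _).trans (hC₀le _ hmem)
  -- At a good place the height is `log⁺`, a positive multiple of `1/e`; this suffices because `r/r₀
  -- ≥ 1`.
  · have hgood : ∀ i, P.coeff i ≠ 0 → intAbs w.base 1 (P.coeff i) = 1 := by
      intro i hi
      rw [intAbs_one_eq_one_iff]
      by_contra h
      apply hmem
      rw [Set.Finite.mem_toFinset, Set.mem_iUnion₂]
      exact ⟨i, mem_support.2 hi, w.base_surjective, ⟨w.divisor, w.base_integer⟩, h⟩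
    have hlog := height_eq_posLog hP h0 hgood (isNonarchimedean_intAbs w.val e)
      (intAbs_algebraMap w.val e he hw) x
    change 0 < height (intAbs w.val e) P x at hpos
    rw [hlog] at hpos ⊢
    rw [posLog_apply] at hpos ⊢
    obtain ⟨z, hz⟩ := exists_log_intAbs_eq w.val e x
    rw [hz] at hpos ⊢
    have h2 : (0 : ℝ) < z / e := by
      rcases lt_max_iff.1 hpos with h | h
      · exact absurd h (lt_irrefl _)
      · exact h
    have h3 : (1 : ℝ) ≤ z := by
      have h4 : (0 : ℝ) < z := by
        by_contra! h5
        exact absurd h2 (not_lt.2 (div_nonpos_of_nonpos_of_nonneg h5 he0.le))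
      have h6 : (0 : ℤ) < z := by exact_mod_cast h4
      exact_mod_cast Int.add_one_le_iff.2 h6
    refine le_trans ?_ (le_max_right _ _)
    have h4 : (e : ℝ) ≤ (e : ℝ) ^ ((r : ℝ) / r₀) := by
      conv_lhs => rw [← rpow_one (e : ℝ)]
      exact rpow_le_rpow_of_exponent_le he1 ((one_le_div hr₀').2 hr₀r)
    calc min C₀ 1 / (e : ℝ) ^ ((r : ℝ) / r₀) ≤ 1 / e := by
          gcongr
          exact min_le_right _ _
      _ ≤ z / e := by gcongr

end LocalLehmer

end

/-! ### The projective line: its coordinate ring and its Drinfeld modules. -/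

noncomputable section

namespace LocalLehmer

set_option linter.unusedSectionVars false

namespace ProjectiveLine

section RegularFunctions

variable (k : Type*) [Field k]

open Classical in
/-- The point at infinity of the projective line. -/
def infty : ValuationSubring (RatFunc k) := (RatFunc.inftyValuation k).valuationSubring

theorem X_notMem_infty : (RatFunc.X : RatFunc k) ∉ infty k := by
  classical
  rw [infty, Valuation.mem_valuationSubring_iff, RatFunc.inftyValuation.X, not_le,
    ← WithZero.exp_zero, WithZero.exp_lt_exp]
  exact one_pos

theorem isClosedPoint_infty : IsClosedPoint k (infty k) := by
  classical
  refine ⟨fun h => X_notMem_infty k (h ▸ ValuationSubring.mem_top _), fun c => ?_⟩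
  rw [infty, Valuation.mem_valuationSubring_iff]
  by_cases hc : c = 0
  · simp [hc]
  · rw [Valuation.IsTrivialOn.eq_one c hc]

variable {k}

/-- A valuation trivial on `k` with `X` of value greater than 1 is equivalent to the degree
valuation. -/
theorem eq_infty {P : ValuationSubring (RatFunc k)} (hP : IsClosedPoint k P)
    (hX : (RatFunc.X : RatFunc k) ∉ P) : P = infty k := by
  classical
  have : P.valuation.IsTrivialOn k := ⟨fun a ha => by
    apply le_antisymm ((P.valuation_le_one_iff _).2 (hP.2 a))
    have h1 := (P.valuation_le_one_iff _).2 (hP.2 a⁻¹)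
    rw [map_inv₀, map_inv₀] at h1
    exact (inv_le_one₀ (zero_lt_iff.2 ((Valuation.ne_zero_iff _).2 (by simpa using ha)))).1 h1⟩
  have h1 : 1 < P.valuation RatFunc.X := by
    rw [← not_le, P.valuation_le_one_iff]
    exact hX
  have h2 := RatFunc.valuation_isEquiv_inftyValuation_of_one_lt_valuation_X (K := k) h1
  rw [Valuation.isEquiv_iff_valuationSubring, ValuationSubring.valuationSubring_valuation] at h2
  exact h2

/-- A function integral at all primes of `k[X]` is a polynomial, and none of these places is the one
at infinity since they contain `X`. Conversely every other closed point contains `X` and `k`, hence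
all polynomials. -/
theorem mem_regularAway_iff {z : RatFunc k} :
    z ∈ regularAway k (infty k) ↔ ∃ f : Polynomial k, algebraMap _ _ f = z := by
  constructor
  · intro hz
    apply IsDedekindDomain.HeightOneSpectrum.mem_integers_of_valuation_le_one
    intro v
    have hpoly : ∀ f : Polynomial k, algebraMap _ (RatFunc k) f ∈
        (v.valuation (RatFunc k)).valuationSubring := fun f => v.valuation_le_one f
    refine hz (v.valuation (RatFunc k)).valuationSubring ⟨fun h => ?_, fun c => ?_⟩ fun h => ?_
    · obtain ⟨π, hπ⟩ := v.valuation_surjective (RatFunc k) (WithZero.exp 1)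
      have h1 : π ∈ (v.valuation (RatFunc k)).valuationSubring := h ▸ ValuationSubring.mem_top _
      rw [Valuation.mem_valuationSubring_iff, hπ, ← WithZero.exp_zero, WithZero.exp_le_exp] at h1
      exact absurd h1 (by norm_num)
    · rw [IsScalarTower.algebraMap_apply k (Polynomial k) (RatFunc k)]
      exact hpoly _
    · apply X_notMem_infty k
      rw [← h, ← RatFunc.algebraMap_X]
      exact hpoly _
  · rintro ⟨f, rfl⟩ P hP hne
    have hX : (RatFunc.X : RatFunc k) ∈ P := by
      by_contra h
      exact hne (eq_infty hP h)
    induction f using Polynomial.induction_on' with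
    | add f g hf hg => rw [map_add]; exact P.add_mem _ _ hf hg
    | monomial n c =>
      rw [← Polynomial.C_mul_X_pow_eq_monomial, map_mul, map_pow, RatFunc.algebraMap_X]
      refine P.mul_mem _ _ ?_ (pow_mem hX n)
      rw [RatFunc.algebraMap_C]
      exact hP.2 c

/-- The functions regular away from infinity are the polynomials. -/
def polynomialEquiv : Polynomial k ≃ₐ[k] regularAway k (infty k) :=
  AlgEquiv.ofBijective ((IsScalarTower.toAlgHom k (Polynomial k) (RatFunc k)).codRestrict _
    fun f => mem_regularAway_iff.2 ⟨f, rfl⟩)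
    ⟨fun f g h => RatFunc.algebraMap_injective k (congrArg Subtype.val h), fun z => by
      obtain ⟨f, hf⟩ := mem_regularAway_iff.1 z.2
      exact ⟨f, Subtype.ext hf⟩⟩

variable (k) in
theorem trdeg_regularAway : Algebra.trdeg k (regularAway k (infty k)) = 1 := by
  rw [← polynomialEquiv.trdeg_eq, Polynomial.trdeg_of_isDomain]

end RegularFunctions

section Drinfeld

variable {Fq K : Type*} [Field Fq] [Finite Fq] [Field K] [Algebra Fq K]

open TwistedPolynomial

theorem algebraMap_pow_card_pow (c : Fq) (n : ℕ) :
    (algebraMap Fq K c) ^ (Nat.card Fq ^ n) = algebraMap Fq K c := by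
  let _ := Fintype.ofFinite Fq
  rw [← map_pow, Nat.card_eq_fintype_card, FiniteField.pow_card_pow]

variable (Fq K) in
/-- The constants in `K{τ}`. -/
def constants : Fq →+* TwistedPolynomial Fq K where
  toFun c := monomial 0 (algebraMap Fq K c)
  map_one' := by rw [map_one, one_eq_monomial]
  map_mul' c d := by rw [monomial_mul_monomial, pow_zero, pow_one, map_mul]
  map_zero' := by rw [map_zero, monomial_zero_right]
  map_add' c d := by
    apply ext_coeff
    intro n
    simp only [coeff_add, coeff_monomial, map_add]
    split_ifs <;> simp

/-- Elements of `Fq` are fixed by the Frobenius of order `q`, hence are central; this is what allows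
evaluation of polynomials over `Fq` in `K{τ}`. -/
theorem commute_constants (c : Fq) (P : TwistedPolynomial Fq K) : Commute (constants Fq K c) P := by
  change monomial 0 (algebraMap Fq K c) * P = P * monomial 0 (algebraMap Fq K c)
  induction P using induction_monomial with
  | zero => rw [mul_zero, zero_mul]
  | monomial_add n d Q hQ =>
    rw [mul_add, add_mul, hQ, monomial_mul_monomial, monomial_mul_monomial, algebraMap_pow_card_pow, pow_zero, pow_one,
      add_zero, zero_add, mul_comm]

/-- The Drinfeld module over the polynomial ring, of characteristic `X`, with a given value at
`X`. -/
def drinfeldOfPolynomial {A : Type*} [CommRing A] [Algebra Fq A] (e : Polynomial Fq ≃ₐ[Fq] A)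
    (P : TwistedPolynomial Fq K) (hP : P.coeff 0 = 0) : DrinfeldModule Fq A K where
  i := (Polynomial.aeval (0 : K)).comp e.symm.toAlgHom
  φ := (Polynomial.eval₂RingHom' (constants Fq K) P fun c => commute_constants c P).comp
    e.symm.toRingEquiv.toRingHom
  coeff_zero a := by
    obtain ⟨f, rfl⟩ := e.surjective a
    change coeff ((Polynomial.eval₂RingHom' (constants Fq K) P fun c => commute_constants c P)
      (e.symm (e f))) 0 = Polynomial.aeval (0 : K) (e.symm (e f))
    rw [e.symm_apply_apply, ← Polynomial.divX_mul_X_add f, map_add, map_add, map_mul, map_mul,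
      coeff_add, Polynomial.aeval_X, mul_zero, coeff_mul]
    have h1 : (Polynomial.eval₂RingHom' (constants Fq K) P fun c => commute_constants c P)
        Polynomial.X = P := Polynomial.eval₂_X _ _
    have h2 : (Polynomial.eval₂RingHom' (constants Fq K) P fun c => commute_constants c P)
        (Polynomial.C (f.coeff 0)) = constants Fq K (f.coeff 0) := Polynomial.eval₂_C _ _
    rw [h1, h2, Polynomial.aeval_C]
    have h3 : (constants Fq K (f.coeff 0)).coeff 0 = algebraMap Fq K (f.coeff 0) :=
      (coeff_monomial _ _ _).trans (if_pos rfl)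
    rw [h3]
    simp [hP]

theorem drinfeldOfPolynomial_X {A : Type*} [CommRing A] [Algebra Fq A]
    (e : Polynomial Fq ≃ₐ[Fq] A) (P : TwistedPolynomial Fq K) (hP : P.coeff 0 = 0) :
    (drinfeldOfPolynomial e P hP).φ (e Polynomial.X) = P := by
  change (Polynomial.eval₂RingHom' (constants Fq K) P fun c => commute_constants c P)
    (e.symm (e Polynomial.X)) = P
  rw [e.symm_apply_apply]
  exact Polynomial.eval₂_X _ _

end Drinfeld

end ProjectiveLine

end LocalLehmer

end

/-! ### Normality of the projective line. -/

noncomputable section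

namespace LocalLehmer

set_option linter.unusedSectionVars false

/-- A subring of a field that contains a copy of `k[X]` with the same fraction field is integrally
closed. -/
theorem isIntegrallyClosed_of_polynomial_le {k K : Type*} [Field k] [Field K]
    (ι : Polynomial k →+* K) (hι : Function.Injective ι)
    (hfrac : ∀ z : K, ∃ a b, b ≠ 0 ∧ z = ι a / ι b) (R : Subring K) (hR : ∀ f, ι f ∈ R) :
    IsIntegrallyClosed R := by
  classical
  have hι0 : ∀ {f}, f ≠ 0 → ι f ≠ 0 := fun h h0 => h (hι (h0.trans ι.map_zero.symm))
  -- `S` consists of the polynomials that become invertible in `R`; the claim is that `R` is the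
  -- localization of `k[X]` at `S`.
  let S : Submonoid (Polynomial k) :=
    { carrier := {f | f ≠ 0 ∧ (ι f)⁻¹ ∈ R}
      one_mem' := ⟨one_ne_zero, by rw [map_one, inv_one]; exact R.one_mem⟩
      mul_mem' := fun {f g} hf hg => ⟨mul_ne_zero hf.1 hg.1, by
        rw [map_mul, mul_inv]; exact R.mul_mem hf.2 hg.2⟩ }
  let _ : Algebra (Polynomial k) R := (ι.codRestrict R hR).toAlgebra
  have halg : ∀ f, ((algebraMap (Polynomial k) R f : R) : K) = ι f := fun f => rfl
  have : IsLocalization S R :=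
    { map_units := fun f => by
        refine IsUnit.of_mul_eq_one ⟨_, f.2.2⟩ (Subtype.ext ?_)
        rw [Subring.coe_mul, halg]
        exact mul_inv_cancel₀ (hι0 f.2.1)
      surj := fun z => by
        obtain ⟨a, b, hb, hz⟩ := hfrac z
        set g := EuclideanDomain.gcd a b with hg
        have hg0 : g ≠ 0 := fun h => hb (EuclideanDomain.gcd_eq_zero_iff.1 h).2
        obtain ⟨a', ha'⟩ := EuclideanDomain.gcd_dvd_left a b
        obtain ⟨b', hb'⟩ := EuclideanDomain.gcd_dvd_right a b
        rw [← hg] at ha' hb'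
        have hb'0 : b' ≠ 0 := by
          rintro rfl
          exact hb (by rw [hb', mul_zero])
        have hz' : (z : K) = ι a' / ι b' := by
          rw [hz, ha', hb', map_mul, map_mul, mul_div_mul_left _ _ (hι0 hg0)]
        have hbez := EuclideanDomain.gcd_eq_gcd_ab a b
        rw [← hg] at hbez
        have hbez' : (1 : Polynomial k) = a' * EuclideanDomain.gcdA a b +
            b' * EuclideanDomain.gcdB a b := by
          apply mul_left_cancel₀ hg0
          calc g * 1 = a * EuclideanDomain.gcdA a b + b * EuclideanDomain.gcdB a b := by
                rw [mul_one]; exact hbez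
            _ = g * a' * EuclideanDomain.gcdA a b + g * b' * EuclideanDomain.gcdB a b := by
                rw [← ha', ← hb']
            _ = _ := by ring
        -- Bézout in lowest terms, divided by `b'`: the inverse of the denominator of `z` is a
        -- polynomial combination of `z` and 1, hence lies in `R`.
        have hinv : (ι b')⁻¹ = z * ι (EuclideanDomain.gcdA a b) +
            ι (EuclideanDomain.gcdB a b) := by
          have h1 := congrArg ι hbez'
          rw [map_one, map_add, map_mul, map_mul] at h1
          rw [hz', inv_eq_one_div, h1]
          have := hι0 hb'0
          field_simp
        have hmem : (ι b')⁻¹ ∈ R := by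
          rw [hinv]
          exact R.add_mem (R.mul_mem z.2 (hR _)) (hR _)
        exact ⟨(a', ⟨b', hb'0, hmem⟩), Subtype.ext
          ((congrArg (· * ι b') hz').trans (div_mul_cancel₀ _ (hι0 hb'0)))⟩
      exists_of_eq := fun {x y} h => ⟨1, by
        have h1 : ι x = ι y := congrArg Subtype.val h
        rw [hι h1]⟩ }
  exact isIntegrallyClosed_of_isLocalization R S
    (fun f hf => mem_nonZeroDivisors_of_ne_zero hf.1)

namespace ProjectiveLine

variable (k : Type*) [Field k]

/-- The projective line with its standard coordinates. -/
def line : ProjectiveVariety k (RatFunc k) 1 where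
  coord := ![RatFunc.X, 1]
  exists_coord_ne_zero := ⟨1, one_ne_zero⟩
  adjoin_eq_top := by
    rw [eq_top_iff, ← RatFunc.adjoin_X]
    apply IntermediateField.adjoin.mono
    rintro _ rfl
    exact ⟨0, 1, by simp⟩

variable {k}

open MvPolynomial

theorem aeval_X_inv_eq (f : Polynomial k) :
    Polynomial.aeval ((RatFunc.X : RatFunc k)⁻¹) f.reverse * RatFunc.X ^ f.natDegree =
      algebraMap _ _ f := by
  have : Invertible (RatFunc.X : RatFunc k) := invertibleOfNonzero RatFunc.X_ne_zero
  have h := Polynomial.eval₂_reverse_mul_pow (algebraMap k (RatFunc k)) RatFunc.X f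
  rw [invOf_eq_inv] at h
  rw [Polynomial.aeval_def, h, ← Polynomial.aeval_def, ← RatFunc.algebraMap_X,
    Polynomial.aeval_algebraMap_apply, Polynomial.aeval_X_left_apply]

theorem injective_aeval_X_inv :
    Function.Injective (Polynomial.aeval (R := k) ((RatFunc.X : RatFunc k)⁻¹)) := by
  rw [injective_iff_map_eq_zero]
  intro f hf
  by_contra h0
  have : Transcendental k (RatFunc.X : RatFunc k) := RatFunc.transcendental_X
  apply this
  rw [← IsAlgebraic.inv_iff]
  exact ⟨f, h0, hf⟩

/-- Every point lies in one of the two standard charts, so its local ring contains `k[X]` or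
`k[X⁻¹]`. -/
theorem isNormal_line : (line k).IsNormal := by
  intro Q
  have hC : ∀ c : k, algebraMap k (RatFunc k) c ∈ Q.localRing := fun c =>
    ⟨0, C c, 1, isHomogeneous_C _ _, isHomogeneous_one _ _,
      fun h => Q.isPrime.ne_top ((Ideal.eq_top_iff_one _).2 h), by simp⟩
  have hpoly : ∀ s ∈ Q.localRing, ∀ f : Polynomial k, Polynomial.aeval s f ∈ Q.localRing := by
    intro s hs f
    induction f using Polynomial.induction_on' with
    | add f g hf hg => rw [map_add]; exact Q.localRing.add_mem hf hg
    | monomial n c =>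
      rw [Polynomial.aeval_monomial]
      exact Q.localRing.mul_mem (hC c) (pow_mem hs n)
  by_cases h1 : (X 1 : MvPolynomial (Fin 2) k) ∈ Q.ideal
  · have h0 : (X 0 : MvPolynomial (Fin 2) k) ∉ Q.ideal := by
      intro h0
      obtain ⟨i, hi⟩ := Q.exists_X_notMem
      fin_cases i
      exacts [hi h0, hi h1]
    have hs : (RatFunc.X : RatFunc k)⁻¹ ∈ Q.localRing :=
      ⟨1, X 1, X 0, isHomogeneous_X _ _, isHomogeneous_X _ _, h0, by simp [line]⟩
    refine isIntegrallyClosed_of_polynomial_le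
      (Polynomial.aeval (R := k) ((RatFunc.X : RatFunc k)⁻¹)).toRingHom injective_aeval_X_inv
      (fun z => ?_) Q.localRing (hpoly _ hs)
    -- Reversal expresses a polynomial in `X` as one in `X⁻¹` times a power of `X`; the crossed
    -- powers compensate for the two degrees.
    refine ⟨z.num.reverse * Polynomial.X ^ z.denom.natDegree,
      z.denom.reverse * Polynomial.X ^ z.num.natDegree, mul_ne_zero ?_ (by simp), ?_⟩
    · rw [Ne, Polynomial.reverse_eq_zero]
      exact z.denom_ne_zero
    · change z = Polynomial.aeval _ _ / Polynomial.aeval _ _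
      conv_lhs => rw [← z.num_div_denom, ← aeval_X_inv_eq z.num, ← aeval_X_inv_eq z.denom]
      have hd : Polynomial.aeval ((RatFunc.X : RatFunc k)⁻¹) z.denom.reverse ≠ 0 := by
        intro h
        rw [← map_zero (Polynomial.aeval (R := k) ((RatFunc.X : RatFunc k)⁻¹))] at h
        exact z.denom_ne_zero (Polynomial.reverse_eq_zero.1 (injective_aeval_X_inv h))
      have hX : (RatFunc.X : RatFunc k) ≠ 0 := RatFunc.X_ne_zero
      simp only [map_mul, map_pow, Polynomial.aeval_X]
      generalize Polynomial.aeval ((RatFunc.X : RatFunc k)⁻¹) z.denom.reverse = b at hd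
      generalize Polynomial.aeval ((RatFunc.X : RatFunc k)⁻¹) z.num.reverse = a
      rw [inv_pow, inv_pow]
      field_simp
  · have hs : (RatFunc.X : RatFunc k) ∈ Q.localRing :=
      ⟨1, X 0, X 1, isHomogeneous_X _ _, isHomogeneous_X _ _, h1, by simp [line]⟩
    refine isIntegrallyClosed_of_polynomial_le (algebraMap (Polynomial k) (RatFunc k))
      (RatFunc.algebraMap_injective k)
      (fun z => ⟨z.num, z.denom, z.denom_ne_zero, z.num_div_denom.symm⟩) Q.localRing fun f => ?_
    have := hpoly _ hs f
    rwa [← RatFunc.algebraMap_X, Polynomial.aeval_algebraMap_apply,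
      Polynomial.aeval_X_left_apply] at this

end ProjectiveLine

end LocalLehmer

end

/-! ### The point `(0 : 1)`: ideal, valuation, degree. -/

noncomputable section

namespace LocalLehmer

set_option linter.unusedSectionVars false

namespace ProjectiveLine

variable {k : Type*} [Field k]

open MvPolynomial

/-- The value of a form at the point `(0 : 1)`, as a multiple of a power of the second
coordinate. -/
def restrictZero : MvPolynomial (Fin 2) k →ₐ[k] Polynomial k := aeval ![0, Polynomial.X]

/-- Dehomogenization with respect to the second coordinate. -/
def dehomogenize : MvPolynomial (Fin 2) k →ₐ[k] Polynomial k := aeval ![Polynomial.X, 1]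

theorem algebraMap_dehomogenize (G : MvPolynomial (Fin 2) k) :
    algebraMap (Polynomial k) (RatFunc k) (dehomogenize G) = aeval (line k).coord G := by
  have : (IsScalarTower.toAlgHom k (Polynomial k) (RatFunc k)).comp dehomogenize =
      aeval (line k).coord := by
    apply MvPolynomial.algHom_ext
    intro i
    fin_cases i <;> simp [dehomogenize, line]
  exact DFunLike.congr_fun this G

/-- Only the monomial `X₁^n` of a form of degree `n` survives at `X₀ = 0`, and its coefficient is
the value of the dehomogenization at 0. -/
theorem restrictZero_eq {G : MvPolynomial (Fin 2) k} {n : ℕ} (hG : G.IsHomogeneous n) :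
    restrictZero G = Polynomial.C ((dehomogenize G).eval 0) * Polynomial.X ^ n := by
  conv_lhs => rw [G.as_sum]
  conv_rhs => rw [G.as_sum]
  rw [map_sum, map_sum, Polynomial.eval_finsetSum, map_sum, Finset.sum_mul]
  refine Finset.sum_congr rfl fun d hd => ?_
  have h := hG (MvPolynomial.mem_support_iff.1 hd)
  have h : d 0 + d 1 = n := by
    rw [Finsupp.weight_apply, Finsupp.sum_fintype _ _ (by simp)] at h
    simpa using h
  rw [restrictZero, dehomogenize, aeval_monomial, aeval_monomial,
    Finsupp.prod_fintype _ _ (by simp), Finsupp.prod_fintype _ _ (by simp), Fin.prod_univ_two,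
    Fin.prod_univ_two]
  by_cases h0 : d 0 = 0
  · have h1 : d 1 = n := by omega
    simp [h0, h1]
  · simp [h0]

theorem restrictZero_eq_zero_iff {G : MvPolynomial (Fin 2) k} {n : ℕ} (hG : G.IsHomogeneous n) :
    restrictZero G = 0 ↔ (dehomogenize G).eval 0 = 0 := by
  rw [restrictZero_eq hG]
  simp

theorem coeff_restrictZero (G : MvPolynomial (Fin 2) k) (n : ℕ) :
    (restrictZero G).coeff n = (dehomogenize (homogeneousComponent n G)).eval 0 := by
  conv_lhs => rw [← sum_homogeneousComponent G, map_sum, Polynomial.finsetSum_coeff]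
  have h : ∀ i, (restrictZero (homogeneousComponent i G)).coeff n =
      if i = n then (dehomogenize (homogeneousComponent n G)).eval 0 else 0 := by
    intro i
    rw [restrictZero_eq (homogeneousComponent_isHomogeneous i G), Polynomial.coeff_C_mul_X_pow]
    by_cases hi : n = i
    · rw [if_pos hi, if_pos hi.symm, hi]
    · rw [if_neg hi, if_neg (Ne.symm hi)]
  simp only [h, Finset.sum_ite_eq', Finset.mem_range]
  split_ifs with hn
  · rfl
  · rw [homogeneousComponent_eq_zero n G (by omega), map_zero, Polynomial.eval_zero]

/-- The form of degree `n` with a given dehomogenization. -/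
def homogenize (n : ℕ) (f : Polynomial k) : MvPolynomial (Fin 2) k :=
  ∑ i ∈ Finset.range (n + 1), C (f.coeff i) * (X 0 ^ i * X 1 ^ (n - i))

theorem isHomogeneous_homogenize (n : ℕ) (f : Polynomial k) : (homogenize n f).IsHomogeneous n := by
  refine IsHomogeneous.sum _ _ _ fun i hi => ?_
  have hi' : i + (n - i) = n := by
    have := Finset.mem_range.1 hi
    omega
  have h := (isHomogeneous_C (Fin 2) (f.coeff i)).mul
    ((isHomogeneous_X_pow (R := k) (0 : Fin 2) i).mul (isHomogeneous_X_pow (1 : Fin 2) (n - i)))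
  rwa [hi', zero_add] at h

theorem dehomogenize_homogenize {n : ℕ} {f : Polynomial k} (hf : f.natDegree ≤ n) :
    dehomogenize (homogenize n f) = f := by
  conv_rhs => rw [f.as_sum_range' (n + 1) (by omega)]
  rw [homogenize, map_sum]
  refine Finset.sum_congr rfl fun i _ => ?_
  rw [← Polynomial.C_mul_X_pow_eq_monomial]
  simp [dehomogenize]

variable (k) in
/-- The point `(0 : 1)` of the projective line. -/
def zeroPoint : (line k).Point where
  ideal := RingHom.ker restrictZero
  isPrime := RingHom.ker_isPrime _
  isHomogeneous G hG n := by
    rw [RingHom.mem_ker] at hG ⊢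
    rw [restrictZero_eq_zero_iff (homogeneousComponent_isHomogeneous n G), ← coeff_restrictZero, hG,
      Polynomial.coeff_zero]
  mem_of_aeval_eq_zero n G hG h := by
    rw [RingHom.mem_ker, restrictZero_eq_zero_iff hG]
    rw [← algebraMap_dehomogenize, map_eq_zero_iff _ (RatFunc.algebraMap_injective k)] at h
    rw [h, Polynomial.eval_zero]
  exists_X_notMem := ⟨1, by simp [RingHom.mem_ker, restrictZero]⟩

theorem mem_zeroPoint_iff {G : MvPolynomial (Fin 2) k} {n : ℕ} (hG : G.IsHomogeneous n) :
    G ∈ (zeroPoint k).ideal ↔ (dehomogenize G).eval 0 = 0 :=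
  restrictZero_eq_zero_iff hG

variable (k) in
/-- The valuation attached to the point `(0 : 1)`. -/
def zeroVal : Valuation (RatFunc k) (WithZero (Multiplicative ℤ)) :=
  (Polynomial.idealX k).valuation (RatFunc k)

theorem mem_idealX_iff {f : Polynomial k} : f ∈ (Polynomial.idealX k).asIdeal ↔ f.eval 0 = 0 := by
  rw [Polynomial.idealX_span, Ideal.mem_span_singleton, Polynomial.X_dvd_iff,
    Polynomial.coeff_zero_eq_eval_zero]

theorem zeroVal_polynomial_le_one (f : Polynomial k) : zeroVal k (algebraMap _ _ f) ≤ 1 :=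
  (Polynomial.idealX k).valuation_le_one f

theorem zeroVal_polynomial_lt_one_iff {f : Polynomial k} :
    zeroVal k (algebraMap _ _ f) < 1 ↔ f.eval 0 = 0 := by
  rw [zeroVal, IsDedekindDomain.HeightOneSpectrum.valuation_lt_one_iff_mem, mem_idealX_iff]

theorem zeroVal_polynomial_eq_one {f : Polynomial k} (hf : f.eval 0 ≠ 0) :
    zeroVal k (algebraMap _ _ f) = 1 :=
  le_antisymm (zeroVal_polynomial_le_one f) (not_lt.1 (mt zeroVal_polynomial_lt_one_iff.1 hf))

theorem zeroVal_X : zeroVal k RatFunc.X = WithZero.exp (-1) := Polynomial.valuation_X_eq_neg_one k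

theorem exists_eq_div_of_zeroVal_le_one {z : RatFunc k} (hz : zeroVal k z ≤ 1) :
    ∃ f g : Polynomial k, g.eval 0 ≠ 0 ∧ z = algebraMap _ _ f / algebraMap _ _ g := by
  have h : z ∈ (Polynomial.idealX k).valuationSubringAtPrime (RatFunc k) := by
    rw [IsDedekindDomain.HeightOneSpectrum.valuationSubringAtPrime_eq_valuationSubring]
    exact hz
  obtain ⟨f, g, hg, rfl⟩ := h
  exact ⟨f, g, fun h => hg (mem_idealX_iff.2 h), (div_eq_mul_inv _ _).symm⟩

theorem integer_zeroVal : (zeroVal k).integer = (zeroPoint k).localRing := by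
  ext z
  rw [Valuation.mem_integer_iff]
  constructor
  · intro hz
    obtain ⟨f, g, hg, rfl⟩ := exists_eq_div_of_zeroVal_le_one hz
    refine ⟨max f.natDegree g.natDegree, homogenize _ f, homogenize _ g,
      isHomogeneous_homogenize _ _, isHomogeneous_homogenize _ _, ?_, ?_⟩
    · rwa [mem_zeroPoint_iff (isHomogeneous_homogenize _ _),
        dehomogenize_homogenize (le_max_right _ _)]
    · rw [← algebraMap_dehomogenize, ← algebraMap_dehomogenize,
        dehomogenize_homogenize (le_max_right _ _), dehomogenize_homogenize (le_max_left _ _)]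
  · rintro ⟨n, G, H, hG, hH, hHQ, rfl⟩
    rw [← algebraMap_dehomogenize, ← algebraMap_dehomogenize, map_div₀,
      zeroVal_polynomial_eq_one (mt (mem_zeroPoint_iff hH).2 hHQ), div_one]
    exact zeroVal_polynomial_le_one _

theorem isDivisor_zeroPoint : (zeroPoint k).IsDivisor := by
  have h : IsDiscreteValuationRing
      ((Polynomial.idealX k).valuationSubringAtPrime (RatFunc k)) :=
    IsLocalization.AtPrime.isDiscreteValuationRing_of_dedekind_domain (A := Polynomial k)
      (Polynomial.idealX k).ne_bot _
  have heq : ((Polynomial.idealX k).valuationSubringAtPrime (RatFunc k)).toSubring =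
      (zeroPoint k).localRing := by
    rw [← integer_zeroVal,
      IsDedekindDomain.HeightOneSpectrum.valuationSubringAtPrime_eq_valuationSubring]
    rfl
  have h1 := IsDiscreteValuationRing.ringKrullDim_eq_one
    ((Polynomial.idealX k).valuationSubringAtPrime (RatFunc k))
  have h2 : ringKrullDim ((Polynomial.idealX k).valuationSubringAtPrime (RatFunc k)).toSubring = 1 :=
    h1
  rw [heq] at h2
  exact h2

/-- Modulo the ideal of the point, a form of degree `n` is its value there times `X₁^n`. -/
theorem hilbertFunction_zeroPoint (n : ℕ) : (zeroPoint k).hilbertFunction n = 1 := by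
  have hX : (X 1 ^ n : MvPolynomial (Fin 2) k) ∉ (zeroPoint k).ideal := by
    rw [mem_zeroPoint_iff (isHomogeneous_X_pow (R := k) (1 : Fin 2) n)]
    simp [dehomogenize]
  have h : (homogeneousSubmodule (Fin 2) k n).map
      (Ideal.Quotient.mkₐ k (zeroPoint k).ideal).toLinearMap =
      Submodule.span k {Ideal.Quotient.mkₐ k (zeroPoint k).ideal (X 1 ^ n)} := by
    apply le_antisymm
    · rintro _ ⟨G, hG, rfl⟩
      have hG' : G.IsHomogeneous n := hG
      rw [Submodule.mem_span_singleton]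
      refine ⟨(dehomogenize G).eval 0, ?_⟩
      rw [← map_smul]
      change Ideal.Quotient.mk _ _ = Ideal.Quotient.mk _ _
      rw [Ideal.Quotient.eq, mem_zeroPoint_iff (n := n)]
      · simp [dehomogenize]
      · refine IsHomogeneous.sub ?_ hG'
        rw [smul_eq_C_mul]
        simpa using (isHomogeneous_C (Fin 2) ((dehomogenize G).eval 0)).mul
          (isHomogeneous_X_pow (R := k) (1 : Fin 2) n)
    · rw [Submodule.span_singleton_le_iff_mem]
      exact ⟨_, isHomogeneous_X_pow (R := k) (1 : Fin 2) n, rfl⟩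
  rw [ProjectiveVariety.Point.hilbertFunction, h, finrank_span_singleton]
  rw [Ne, Ideal.Quotient.mkₐ_eq_mk, Ideal.Quotient.eq_zero_iff_mem]
  exact hX

theorem degree_zeroPoint : (zeroPoint k).degree = 1 := by
  rw [ProjectiveVariety.Point.degree_eq_of_eventually (P := 1)]
  · simp
  · exact Eventually.of_forall fun n => by simp [hilbertFunction_zeroPoint]

end ProjectiveLine

end LocalLehmer

end

/-! ### The Kummer extension `y^E = X` and its totally ramified place. -/

noncomputable section

namespace LocalLehmer

set_option linter.unusedSectionVars false

namespace ProjectiveLine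

variable {k : Type*} [Field k]

theorem exists_zeroVal_sub_lt_one {z : RatFunc k} (hz : zeroVal k z ≤ 1) :
    ∃ c : k, zeroVal k (z - algebraMap k (RatFunc k) c) < 1 := by
  obtain ⟨f, g, hg, rfl⟩ := exists_eq_div_of_zeroVal_le_one hz
  have hg0 : algebraMap _ (RatFunc k) g ≠ 0 := by
    rw [Ne, map_eq_zero_iff _ (RatFunc.algebraMap_injective k)]
    rintro rfl
    simp at hg
  refine ⟨f.eval 0 / g.eval 0, ?_⟩
  have h : algebraMap _ (RatFunc k) f / algebraMap _ _ g -
      algebraMap k (RatFunc k) (f.eval 0 / g.eval 0) =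
      algebraMap _ _ (f - Polynomial.C (f.eval 0 / g.eval 0) * g) / algebraMap _ _ g := by
    rw [map_sub, map_mul, sub_div, mul_div_cancel_right₀ _ hg0]
    rfl
  rw [h, map_div₀, zeroVal_polynomial_eq_one hg, div_one, zeroVal_polynomial_lt_one_iff]
  simp [div_mul_cancel₀ _ hg]

section Expand

variable (k) (E : ℕ) [NeZero E]

theorem injective_expand :
    Function.Injective ((algebraMap (Polynomial k) (RatFunc k)).comp
      (Polynomial.expand k E).toRingHom) :=
  (RatFunc.algebraMap_injective k).comp (Polynomial.expand_injective (NeZero.pos E))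

/-- The endomorphism `X ↦ X ^ E` of the field of rational functions. -/
def expandRatFunc : RatFunc k →+* RatFunc k := IsFractionRing.lift (injective_expand k E)

theorem expandRatFunc_algebraMap (f : Polynomial k) :
    expandRatFunc k E (algebraMap _ _ f) = algebraMap _ _ (Polynomial.expand k E f) :=
  IsFractionRing.lift_algebraMap (injective_expand k E) f

/-- A polynomial `X^m g` with `g(0) ≠ 0` becomes `X^(Em) g(X^E)`, and the second factor is still a
unit at 0. -/
theorem zeroVal_expand (c : RatFunc k) : zeroVal k (expandRatFunc k E c) = zeroVal k c ^ E := by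
  have hpoly : ∀ f : Polynomial k, zeroVal k (expandRatFunc k E (algebraMap _ _ f)) =
      zeroVal k (algebraMap _ _ f) ^ E := by
    intro f
    by_cases hf : f = 0
    · rw [hf, map_zero, map_zero, map_zero, zero_pow (NeZero.ne E)]
    obtain ⟨g, hfg, hg⟩ := Polynomial.exists_eq_pow_rootMultiplicity_mul_and_not_dvd f hf 0
    rw [Polynomial.C_0, sub_zero, Polynomial.X_dvd_iff, Polynomial.coeff_zero_eq_eval_zero] at hg
    rw [Polynomial.C_0, sub_zero] at hfg
    have hg' : (Polynomial.expand k E g).eval 0 ≠ 0 := by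
      rw [Polynomial.expand_eval, zero_pow (NeZero.ne E)]
      exact hg
    rw [expandRatFunc_algebraMap, hfg]
    simp only [map_mul, map_pow, Polynomial.expand_X, zeroVal_polynomial_eq_one hg,
      zeroVal_polynomial_eq_one hg', mul_one]
    rw [← pow_mul, ← pow_mul, mul_comm]
  rw [← c.num_div_denom, map_div₀, map_div₀, map_div₀, hpoly, hpoly, div_pow]

end Expand

section Kummer

variable {L : Type*} [Field L] [Algebra (RatFunc k) L] [Algebra k L]
  [IsScalarTower k (RatFunc k) L] {E : ℕ} [NeZero E] {y : L}

theorem injective_aeval_root (hy : y ^ E = algebraMap (RatFunc k) L RatFunc.X) :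
    Function.Injective (Polynomial.aeval (R := k) y).toRingHom := by
  have h1 : Transcendental k y := by
    intro h
    have h2 := h.pow E
    rw [hy] at h2
    have h3 : Transcendental k (RatFunc.X : RatFunc k) := RatFunc.transcendental_X
    exact h3 ((isAlgebraic_algebraMap_iff (algebraMap (RatFunc k) L).injective).1 h2)
  exact transcendental_iff_injective.1 h1

/-- The isomorphism `X ↦ y` onto `k(X, y)` where `y ^ E = X`. -/
def ofRoot (hy : y ^ E = algebraMap (RatFunc k) L RatFunc.X) : RatFunc k →+* L :=
  IsFractionRing.lift (injective_aeval_root hy)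

variable (hy : y ^ E = algebraMap (RatFunc k) L RatFunc.X)

theorem ofRoot_algebraMap (f : Polynomial k) :
    ofRoot hy (algebraMap _ _ f) = Polynomial.aeval y f :=
  IsFractionRing.lift_algebraMap (injective_aeval_root hy) f

theorem ofRoot_X : ofRoot hy RatFunc.X = y := by
  rw [← RatFunc.algebraMap_X, ofRoot_algebraMap, Polynomial.aeval_X]

theorem ofRoot_expand (c : RatFunc k) :
    ofRoot hy (expandRatFunc k E c) = algebraMap (RatFunc k) L c := by
  have h : (ofRoot hy).comp (expandRatFunc k E) = algebraMap (RatFunc k) L := by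
    apply IsLocalization.ringHom_ext (nonZeroDivisors (Polynomial k))
    apply Polynomial.ringHom_ext
    · intro c
      simp only [RingHom.comp_apply]
      rw [expandRatFunc_algebraMap, ofRoot_algebraMap, Polynomial.expand_C, Polynomial.aeval_C,
        RatFunc.algebraMap_C, ← RatFunc.algebraMap_eq_C, ← IsScalarTower.algebraMap_apply]
    · simp only [RingHom.comp_apply]
      rw [expandRatFunc_algebraMap, ofRoot_algebraMap, Polynomial.expand_X, map_pow,
        Polynomial.aeval_X, hy, RatFunc.algebraMap_X]
  exact DFunLike.congr_fun h c

theorem bijective_ofRoot (hgen : IntermediateField.adjoin (RatFunc k) {y} = ⊤) :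
    Function.Bijective (ofRoot hy) := by
  refine ⟨(ofRoot hy).injective, fun z => ?_⟩
  have hz : z ∈ IntermediateField.adjoin (RatFunc k) {y} := by
    rw [hgen]
    exact IntermediateField.mem_top
  change z ∈ (ofRoot hy).fieldRange
  induction hz using IntermediateField.adjoin_induction with
  | mem x hx =>
    rw [Set.mem_singleton_iff] at hx
    exact ⟨RatFunc.X, by rw [ofRoot_X, hx]⟩
  | algebraMap x => exact ⟨_, ofRoot_expand hy x⟩
  | add x y _ _ hx hy => exact add_mem hx hy
  | inv x _ hx => exact inv_mem hx
  | mul x y _ _ hx hy => exact mul_mem hx hy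

/-- The totally ramified place above `(0 : 1)` of the Kummer extension `k(X, y)`,
where `y ^ E = X`. -/
theorem exists_kummer_place (hy : y ^ E = algebraMap (RatFunc k) L RatFunc.X)
    (hgen : IntermediateField.adjoin (RatFunc k) {y} = ⊤) :
    ∃ w : (line k).Place L, w.divisor = zeroPoint k ∧ w.base = zeroVal k ∧
      w.ramificationIndex = E ∧ w.residueDegree = 1 ∧ w.val y = WithZero.exp (-1) := by
  -- `L` is itself the field of rational functions in `y`, so the valuation at `y = 0` can be
  -- transported; seen from `L`, the base field is embedded by `X ↦ X^E`.
  let ψ : RatFunc k ≃+* L := RingEquiv.ofBijective (ofRoot hy) (bijective_ofRoot hy hgen)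
  let v : Valuation L (WithZero (Multiplicative ℤ)) := (zeroVal k).comap ψ.symm.toRingHom
  have hv : ∀ c, v (ofRoot hy c) = zeroVal k c := fun c => congrArg (zeroVal k) (ψ.symm_apply_apply c)
  have hve : ∀ c, v (algebraMap (RatFunc k) L c) = zeroVal k c ^ E := fun c => by
    rw [← ofRoot_expand hy, hv, zeroVal_expand]
  have hext : (zeroVal k).HasExtension v := ⟨by
    rw [Valuation.isEquiv_iff_val_le_one]
    intro c
    rw [Valuation.comap_apply, hve, pow_le_one_iff (NeZero.ne E)]⟩
  let w : (line k).Place L :=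
    { divisor := zeroPoint k
      isDivisor := isDivisor_zeroPoint
      base := zeroVal k
      base_surjective := (Polynomial.idealX k).valuation_surjective (RatFunc k)
      base_integer := integer_zeroVal
      val := v
      val_surjective := fun g => by
        obtain ⟨c, hc⟩ := (Polynomial.idealX k).valuation_surjective (RatFunc k) g
        exact ⟨ofRoot hy c, (hv c).trans hc⟩
      hasExtension := hext }
  refine ⟨w, rfl, rfl, w.ramificationIndex_eq (NeZero.pos E) hve, ?_, ?_⟩
  -- Both residue fields reduce to the constants `k`: an integral function differs from its value at
  -- 0 by a nonunit.
  · have hsurj : ∀ z : IsLocalRing.ResidueField v.valuationSubring,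
        ∃ c, algebraMap (IsLocalRing.ResidueField (zeroVal k).valuationSubring)
          (IsLocalRing.ResidueField v.valuationSubring) c = z := by
      intro z
      obtain ⟨⟨z, hz⟩, rfl⟩ := IsLocalRing.residue_surjective z
      obtain ⟨z, rfl⟩ := (bijective_ofRoot hy hgen).2 z
      rw [Valuation.mem_valuationSubring_iff, hv] at hz
      obtain ⟨c, hc⟩ := exists_zeroVal_sub_lt_one hz
      have hc1 : algebraMap k (RatFunc k) c ∈ (zeroVal k).valuationSubring := by
        rw [Valuation.mem_valuationSubring_iff, IsScalarTower.algebraMap_apply k (Polynomial k)]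
        exact zeroVal_polynomial_le_one _
      refine ⟨IsLocalRing.residue _ ⟨_, hc1⟩, ?_⟩
      rw [Valuation.HasExtension.algebraMap_residue_eq_residue_algebraMap, eq_comm,
        ← sub_eq_zero, ← map_sub, IsLocalRing.residue_eq_zero_iff, Valuation.mem_maximalIdeal_iff]
      change v (ofRoot hy z - algebraMap (RatFunc k) L (algebraMap k (RatFunc k) c)) < 1
      have h : algebraMap (RatFunc k) L (algebraMap k (RatFunc k) c) =
          ofRoot hy (algebraMap k (RatFunc k) c) := by
        rw [← IsScalarTower.algebraMap_apply, IsScalarTower.algebraMap_apply k (Polynomial k)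
          (RatFunc k), ofRoot_algebraMap, Polynomial.algebraMap_eq, Polynomial.aeval_C]
      rw [h, ← map_sub, hv]
      exact hc
    change Module.finrank (IsLocalRing.ResidueField (zeroVal k).valuationSubring)
      (IsLocalRing.ResidueField v.valuationSubring) = 1
    rw [finrank_eq_one_iff_of_nonzero' 1 one_ne_zero]
    intro z
    obtain ⟨c, rfl⟩ := hsurj z
    exact ⟨c, by rw [Algebra.smul_def, mul_one]⟩
  · change v y = _
    rw [← ofRoot_X hy, hv, zeroVal_X]

end Kummer

end ProjectiveLine

end LocalLehmer

end

/-! ### The extremal binomial: exact computation of an orbit. -/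

noncomputable section

namespace LocalLehmer

set_option linter.unusedSectionVars false

open Real

namespace TwistedPolynomial

variable {Fq K : Type*} [Field Fq] [Finite Fq] [Field K] [Algebra Fq K]

variable (Fq) in
/-- The twisted polynomial `τ ^ r - T ^ (1 - q ^ r₀) τ ^ r₀`. -/
def binomial (T : K) (r₀ r : ℕ) : TwistedPolynomial Fq K :=
  monomial r 1 - monomial r₀ (T ^ (1 - (Nat.card Fq : ℤ) ^ r₀))

variable {T : K} {r₀ r : ℕ}

theorem coeff_binomial (i : ℕ) : (binomial Fq T r₀ r).coeff i =
    (if r = i then 1 else 0) - (if r₀ = i then T ^ (1 - (Nat.card Fq : ℤ) ^ r₀) else 0) := by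
  rw [binomial, coeff_sub, coeff_monomial, coeff_monomial]

theorem coeff_binomial_right (h : r₀ < r) : (binomial Fq T r₀ r).coeff r = 1 := by
  rw [coeff_binomial, if_pos rfl, if_neg h.ne, sub_zero]

theorem coeff_binomial_left (h : r₀ < r) :
    (binomial Fq T r₀ r).coeff r₀ = -T ^ (1 - (Nat.card Fq : ℤ) ^ r₀) := by
  rw [coeff_binomial, if_pos rfl, if_neg h.ne', zero_sub]

theorem coeff_binomial_of_ne {i : ℕ} (h : i ≠ r) (h' : i ≠ r₀) :
    (binomial Fq T r₀ r).coeff i = 0 := by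
  rw [coeff_binomial, if_neg h.symm, if_neg h'.symm, sub_zero]

theorem binomial_ne_zero (h : r₀ < r) : binomial Fq T r₀ r ≠ 0 := fun h0 => by
  have := coeff_binomial_right (Fq := Fq) (T := T) h
  rw [h0] at this
  exact zero_ne_one this

theorem natDegree_binomial (h : r₀ < r) : (binomial Fq T r₀ r).natDegree = r :=
  natDegree_eq (by rw [coeff_binomial_right h]; exact one_ne_zero)
    fun m hm => coeff_binomial_of_ne hm.ne' (h.trans hm).ne'

variable {N : AbsoluteValue K ℝ} {L : Type*} [Field L] [Algebra K L] {NL : AbsoluteValue L ℝ}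

theorem term_binomial_right (h : r₀ < r) {θ : ℝ} :
    term N (binomial Fq T r₀ r) (exp (θ - 1)) r = exp ((Nat.card Fq : ℝ) ^ r * (θ - 1)) := by
  rw [term, coeff_binomial_right h, map_one, one_mul, ← exp_nat_mul]
  push_cast
  rfl

theorem term_binomial_left (h : r₀ < r) (hT : N T = exp (-1)) {θ : ℝ} :
    term N (binomial Fq T r₀ r) (exp (θ - 1)) r₀ = exp ((Nat.card Fq : ℝ) ^ r₀ * θ - 1) := by
  rw [term, coeff_binomial_left h, map_neg_eq_map, map_zpow₀, hT, ← exp_nat_mul, ← rpow_intCast,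
    ← exp_mul,
    ← exp_add]
  congr 1
  push_cast
  ring

section Height

variable (h0 : r₀ < r) (hNL : IsNonarchimedean NL) (hN : ∀ a, NL (algebraMap K L a) = N a)
  (hT : N T = exp (-1))

include h0 hNL hN hT

/-- In the coordinate `|y| = exp (θ - 1)` the fixed radius is `θ = 0`. The two terms tie at `(q^r -
q^r₀) θ = q^r - 1`; below that the lower term governs and `θ` becomes `q^r₀ θ`. -/
theorem abs_eval_binomial_of_lt {θ : ℝ} {y : L} (hy : NL y = exp (θ - 1))
    (h : ((Nat.card Fq : ℝ) ^ r - (Nat.card Fq : ℝ) ^ r₀) * θ < (Nat.card Fq : ℝ) ^ r - 1) :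
    NL ((binomial Fq T r₀ r).eval y) = exp ((Nat.card Fq : ℝ) ^ r₀ * θ - 1) := by
  rw [abs_eval_eq (i := r₀) hNL hN, hy, term_binomial_left h0 hT]
  intro j hj
  rw [hy, term_binomial_left h0 hT]
  by_cases hjr : j = r
  · rw [hjr, term_binomial_right h0, exp_lt_exp]
    linarith
  · rw [term_eq_zero (coeff_binomial_of_ne hjr hj)]
    exact exp_pos _

theorem abs_eval_binomial_of_gt {θ : ℝ} {y : L} (hy : NL y = exp (θ - 1))
    (h : (Nat.card Fq : ℝ) ^ r - 1 < ((Nat.card Fq : ℝ) ^ r - (Nat.card Fq : ℝ) ^ r₀) * θ) :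
    NL ((binomial Fq T r₀ r).eval y) = exp ((Nat.card Fq : ℝ) ^ r * (θ - 1)) := by
  rw [abs_eval_eq (i := r) hNL hN, hy, term_binomial_right h0]
  intro j hj
  rw [hy, term_binomial_right h0]
  by_cases hjr : j = r₀
  · rw [hjr, term_binomial_left h0 hT, exp_lt_exp]
    linarith
  · rw [term_eq_zero (coeff_binomial_of_ne hj hjr)]
    exact exp_pos _

/-- Past the tie the leading term governs the whole orbit, so the logarithm is multiplied by exactly
`q^r` at each step and Tate's sequence is constant. -/
theorem height_binomial_of_gt [Algebra Fq L] {θ : ℝ} {y : L} (hy : NL y = exp (θ - 1))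
    (h1 : 1 ≤ θ)
    (h : (Nat.card Fq : ℝ) ^ r - 1 < ((Nat.card Fq : ℝ) ^ r - (Nat.card Fq : ℝ) ^ r₀) * θ) :
    height NL (binomial Fq T r₀ r) y = θ - 1 := by
  have hq : (1 : ℝ) < Nat.card Fq := by exact_mod_cast one_lt_card Fq
  have hQ : (1 : ℝ) ≤ (Nat.card Fq : ℝ) ^ r := one_le_pow₀ hq.le
  have hQQ : (Nat.card Fq : ℝ) ^ r₀ < (Nat.card Fq : ℝ) ^ r := pow_lt_pow_right₀ hq h0
  have hdeg := natDegree_binomial (Fq := Fq) (T := T) h0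
  have hd : (binomial Fq T r₀ r).natDegree ≠ 0 := by omega
  have hit : ∀ n : ℕ, NL ((binomial Fq T r₀ r).eval^[n] y) =
      exp (((Nat.card Fq : ℝ) ^ r) ^ n * (θ - 1)) := by
    intro n
    induction n with
    | zero => simp [hy]
    | succ n ih =>
      rw [Function.iterate_succ_apply', abs_eval_binomial_of_gt h0 hNL hN hT
        (θ := ((Nat.card Fq : ℝ) ^ r) ^ n * (θ - 1) + 1) (by rw [ih]; ring_nf)]
      · congr 1
        ring
      · refine h.trans_le (mul_le_mul_of_nonneg_left ?_ (by linarith))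
        have : (1 : ℝ) * (θ - 1) ≤ ((Nat.card Fq : ℝ) ^ r) ^ n * (θ - 1) :=
          mul_le_mul_of_nonneg_right (one_le_pow₀ hQ) (by linarith)
        linarith
  refine tendsto_nhds_unique (tendsto_height (binomial_ne_zero h0) hd hNL hN y)
    (tendsto_const_nhds.congr fun n => ?_)
  have hpos : (0 : ℝ) < ((Nat.card Fq : ℝ) ^ r) ^ n := by positivity
  rw [hit, posLog_apply, log_exp, hdeg, max_eq_right (mul_nonneg hpos.le (by linarith)),
    mul_div_cancel_left₀ _ hpos.ne']

/-- From `θ = 1/E` the coordinate is multiplied by `Q₀ = q^r₀` until the first step `n` at which it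
passes the tie. The height is then exactly `(Q₀^n / E - 1) / Q^n`, with `Q = q^r`. Here `Q₀^n` lies
between `E` and `2 Q₀ E`, so `Q^n = (Q₀^n)^(r/r₀)` exceeds `E^(r/r₀)`. -/
theorem height_binomial [Algebra Fq L] (hr₀ : 1 ≤ r₀) {p f : ℕ} (hp : p.Prime)
    (hq : Nat.card Fq = p ^ f) {E : ℕ} (hE : ¬ p ∣ E) {x : L} (hx : NL x = exp (1 / E - 1)) :
    0 < height NL (binomial Fq T r₀ r) x ∧
      height NL (binomial Fq T r₀ r) x <
        2 * (Nat.card Fq : ℝ) ^ r₀ / (E : ℝ) ^ ((r : ℝ) / r₀) := by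
  have hqn : 1 < Nat.card Fq := one_lt_card Fq
  have hqr : (1 : ℝ) < Nat.card Fq := by exact_mod_cast hqn
  have hE0 : E ≠ 0 := fun h => hE (h ▸ dvd_zero p)
  have hE1 : (1 : ℝ) ≤ E := by exact_mod_cast Nat.one_le_iff_ne_zero.2 hE0
  have hE' : (0 : ℝ) < E := one_pos.trans_le hE1
  have hdeg := natDegree_binomial (Fq := Fq) (T := T) h0
  have hd : (binomial Fq T r₀ r).natDegree ≠ 0 := by omega
  set q : ℝ := (Nat.card Fq : ℝ) with hqdef
  set Q₀ := q ^ r₀ with hQ₀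
  set Q := q ^ r with hQdef
  have hQ₀1 : 1 < Q₀ := one_lt_pow₀ hqr (by omega)
  have hQQ : 2 * Q₀ ≤ Q := by
    have h2 : (2 : ℝ) ≤ q := by rw [hqdef]; exact_mod_cast hqn
    calc 2 * Q₀ ≤ q * q ^ r₀ := by gcongr
      _ = q ^ (r₀ + 1) := by ring
      _ ≤ q ^ r := pow_le_pow_right₀ hqr.le h0
  have hdiff : 0 < Q - Q₀ := by linarith
  -- An exact tie would make `p` divide `(q^r - 1) E`, whereas both factors are prime to `p`.
  have hne : ∀ n : ℕ, (Q - Q₀) * (Q₀ ^ n / E) ≠ Q - 1 := by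
    intro n hn
    rw [← mul_div_assoc, div_eq_iff hE'.ne'] at hn
    have h1 : ((Nat.card Fq : ℤ) ^ r - (Nat.card Fq : ℤ) ^ r₀) * ((Nat.card Fq : ℤ) ^ r₀) ^ n =
        ((Nat.card Fq : ℤ) ^ r - 1) * E := by
      apply Int.cast_injective (α := ℝ)
      push_cast
      exact hn
    have hf : f ≠ 0 := by
      rintro rfl
      rw [pow_zero] at hq
      omega
    have hpq : (p : ℤ) ∣ (Nat.card Fq : ℤ) := by
      rw [hq]
      exact_mod_cast dvd_pow_self p hf
    have hpr : ∀ {s : ℕ}, s ≠ 0 → (p : ℤ) ∣ (Nat.card Fq : ℤ) ^ s := fun hs =>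
      dvd_pow hpq hs
    have h2 : (p : ℤ) ∣ ((Nat.card Fq : ℤ) ^ r - 1) * E := by
      rw [← h1]
      exact Dvd.dvd.mul_right (dvd_sub (hpr (by omega)) (hpr (by omega))) _
    rcases (Nat.prime_iff_prime_int.1 hp).dvd_or_dvd h2 with h3 | h3
    · have h4 : (p : ℤ) ∣ 1 := by
        have := dvd_sub (hpr (s := r) (by omega)) h3
        rwa [sub_sub_cancel] at this
      exact (Nat.prime_iff_prime_int.1 hp).not_dvd_one h4
    · exact hE (by exact_mod_cast h3)
  have hex : ∃ n : ℕ, Q - 1 ≤ (Q - Q₀) * (Q₀ ^ n / E) := by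
    obtain ⟨n, hn⟩ := pow_unbounded_of_one_lt ((Q - 1) * E / (Q - Q₀)) hQ₀1
    refine ⟨n, ?_⟩
    rw [← mul_div_assoc, le_div_iff₀ hE']
    rw [div_lt_iff₀ hdiff] at hn
    linarith
  classical
  set n := Nat.find hex with hndef
  have hn : Q - 1 < (Q - Q₀) * (Q₀ ^ n / E) := lt_of_le_of_ne (Nat.find_spec hex) (hne n).symm
  have hmin : ∀ m < n, (Q - Q₀) * (Q₀ ^ m / E) < Q - 1 := fun m hm =>
    not_le.1 (Nat.find_min hex hm)
  have hit : ∀ m ≤ n, NL ((binomial Fq T r₀ r).eval^[m] x) = exp (Q₀ ^ m / E - 1) := by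
    intro m
    induction m with
    | zero => intro _; simp [hx]
    | succ m ih =>
      intro hm
      rw [Function.iterate_succ_apply', abs_eval_binomial_of_lt h0 hNL hN hT (ih (by omega))
        (hmin m (by omega))]
      congr 1
      rw [pow_succ]
      ring
  have hθ1 : 1 < Q₀ ^ n / E := by
    by_contra! h
    have := mul_le_mul_of_nonneg_left h hdiff.le
    linarith
  -- One step earlier the tie was not reached, so the coordinate was below 2, because `Q ≥ 2 Q₀`
  -- puts the tie below 2.
  have hθ2 : Q₀ ^ n / E < 2 * Q₀ := by
    have hn0 : n ≠ 0 := by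
      intro h
      rw [h, pow_zero] at hθ1
      rw [one_lt_div hE'] at hθ1
      linarith
    obtain ⟨m, hm⟩ := Nat.exists_eq_succ_of_ne_zero hn0
    have h1 := hmin m (by omega)
    rw [hm, pow_succ, mul_div_right_comm, mul_comm]
    have h2 : Q₀ ^ m / E < 2 := by
      by_contra! h
      have := mul_le_mul_of_nonneg_left h hdiff.le
      linarith
    rw [mul_comm 2]
    gcongr
  have hht := height_iterate (binomial_ne_zero h0) hd hNL hN n x
  rw [height_binomial_of_gt h0 hNL hN hT (hit n le_rfl) hθ1.le hn, hdeg] at hht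
  have hQn : 0 < Q ^ n := by positivity
  have hval : height NL (binomial Fq T r₀ r) x = (Q₀ ^ n / E - 1) / Q ^ n := by
    rw [hht, mul_div_cancel_left₀ _ hQn.ne']
  rw [hval]
  refine ⟨div_pos (by linarith) hQn, ?_⟩
  have hr₀' : (0 : ℝ) < r₀ := by exact_mod_cast hr₀
  have hr' : (0 : ℝ) < r := by exact_mod_cast (by omega : 0 < r)
  have hpow : (E : ℝ) ^ ((r : ℝ) / r₀) < Q ^ n := by
    have h1 : (E : ℝ) < Q₀ ^ n := by rwa [one_lt_div hE'] at hθ1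
    calc (E : ℝ) ^ ((r : ℝ) / r₀) < (Q₀ ^ n) ^ ((r : ℝ) / r₀) :=
          rpow_lt_rpow hE'.le h1 (div_pos hr' hr₀')
      _ = Q ^ n := by
          rw [hQ₀, hQdef, ← pow_mul, ← pow_mul, ← rpow_natCast, ← rpow_natCast,
            ← rpow_mul (by linarith)]
          congr 1
          push_cast
          field_simp
  have hEpos : 0 < (E : ℝ) ^ ((r : ℝ) / r₀) := rpow_pos_of_pos hE' _
  have hQ₀pos : 0 < Q₀ := by linarith
  calc (Q₀ ^ n / E - 1) / Q ^ n < 2 * Q₀ / Q ^ n := by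
        gcongr
        linarith
    _ ≤ 2 * Q₀ / (E : ℝ) ^ ((r : ℝ) / r₀) := by gcongr

end Height

end TwistedPolynomial

end LocalLehmer

end

/-! ### Optimality of the exponent, and the final theorem. -/

noncomputable section

namespace LocalLehmer

set_option linter.unusedSectionVars false

open Real TwistedPolynomial

theorem eq_top_of_gen_mem {K Ω : Type*} [Field K] [Field Ω] [Algebra K Ω] {x : Ω}
    {S : IntermediateField K (IntermediateField.adjoin K {x})}
    (h : IntermediateField.AdjoinSimple.gen K x ∈ S) : S = ⊤ := by
  rw [eq_top_iff]
  rintro ⟨z, hz⟩ -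
  induction hz using IntermediateField.adjoin_induction with
  | mem y hy =>
    rw [Set.mem_singleton_iff] at hy
    subst hy
    exact h
  | algebraMap c => exact S.algebraMap_mem c
  | add y z _ _ hy hz => exact S.add_mem hy hz
  | inv y _ hy => exact S.inv_mem hy
  | mul y z _ _ hy hz => exact S.mul_mem hy hz

namespace ProjectiveLine

theorem exists_localHeight_lt {p : ℕ} [Fact p.Prime] {Fq : Type*} [Field Fq] [Finite Fq]
    [CharP Fq p] {r₀ r : ℕ} (hr₀ : 1 ≤ r₀) (hr : r₀ < r)
    {A : Type*} [CommRing A] [IsDomain A] [Algebra Fq A] (hA : Algebra.trdeg Fq A ≤ 1)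
    (D : DrinfeldModule Fq A (RatFunc Fq)) {t : A}
    (ht : D.φ t = binomial Fq (RatFunc.X : RatFunc Fq) r₀ r) {κ : ℝ} (hκ : κ < (r : ℝ) / r₀)
    {C : ℝ} (hC : 0 < C) :
    ∃ (x : AlgebraicClosure (RatFunc Fq))
      (v : (line Fq).Place (IntermediateField.adjoin (RatFunc Fq) {x})),
      ¬ p ∣ v.ramificationIndex ∧ ∀ a : A, Transcendental Fq a →
        0 < v.localHeight D a (IntermediateField.AdjoinSimple.gen (RatFunc Fq) x) ∧
        v.localHeight D a (IntermediateField.AdjoinSimple.gen (RatFunc Fq) x) <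
          C / ((v.ramificationIndex : ℝ) ^ (κ - 1) *
            (Module.finrank (RatFunc Fq) (IntermediateField.adjoin (RatFunc Fq) {x}) : ℝ)) := by
  have hp : p.Prime := Fact.out
  obtain ⟨f, hq⟩ : ∃ f : ℕ, Nat.card Fq = p ^ f := by
    let _ := Fintype.ofFinite Fq
    obtain ⟨m, -, hm⟩ := FiniteField.card Fq p
    exact ⟨m, by rw [Nat.card_eq_fintype_card, hm]⟩
  have hδ : 0 < (r : ℝ) / r₀ - κ := sub_pos.2 hκ
  -- `E = p m + 1` is prime to `p` and arbitrarily large; a large `E` lets the gap `r/r₀ - κ` absorb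
  -- both the constant `2 q^r₀` and `C`.
  obtain ⟨E, hpE, hE⟩ : ∃ E : ℕ, ¬ p ∣ E ∧
      2 * (Nat.card Fq : ℝ) ^ r₀ ≤ C * (E : ℝ) ^ ((r : ℝ) / r₀ - κ) := by
    have h1 : Tendsto (fun m : ℕ => p * m + 1) atTop atTop :=
      tendsto_atTop_mono (fun m => (Nat.le_mul_of_pos_left m hp.pos).trans (Nat.le_succ _)) tendsto_id
    have h2 := ((tendsto_rpow_atTop hδ).comp
      ((tendsto_natCast_atTop_atTop (R := ℝ)).comp h1)).const_mul_atTop hC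
    obtain ⟨m, hm⟩ := (h2.eventually_ge_atTop (2 * (Nat.card Fq : ℝ) ^ r₀)).exists
    refine ⟨p * m + 1, fun h => ?_, hm⟩
    exact hp.one_lt.ne' (Nat.dvd_one.1 ((Nat.dvd_add_right (dvd_mul_right p m)).1 h))
  have hE0 : E ≠ 0 := fun h => hpE (h ▸ dvd_zero p)
  have : NeZero E := ⟨hE0⟩
  have hE' : (0 : ℝ) < E := by exact_mod_cast Nat.pos_of_ne_zero hE0
  obtain ⟨y, hy⟩ := IsAlgClosed.exists_pow_nat_eq
    (algebraMap (RatFunc Fq) (AlgebraicClosure (RatFunc Fq)) RatFunc.X) (Nat.pos_of_ne_zero hE0)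
  have hX0 : algebraMap (RatFunc Fq) (AlgebraicClosure (RatFunc Fq)) RatFunc.X ≠ 0 := by
    rw [Ne, map_eq_zero]
    exact RatFunc.X_ne_zero
  have hy0 : y ≠ 0 := by
    rintro rfl
    rw [zero_pow hE0] at hy
    exact hX0 hy.symm
  -- Its absolute value is `exp (1/E - 1)`, just above the fixed radius `exp (-1)`. Since `y = X /
  -- x`, it generates the same field as `y`.
  set x := y ^ (E - 1) with hx
  have hxy : x * y = algebraMap (RatFunc Fq) (AlgebraicClosure (RatFunc Fq)) RatFunc.X := by
    rw [hx, ← hy, ← pow_succ, Nat.sub_add_cancel (Nat.pos_of_ne_zero hE0)]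
  have hx0 : x ≠ 0 := pow_ne_zero _ hy0
  set g := IntermediateField.AdjoinSimple.gen (RatFunc Fq) x with hg
  have hgx : (g : AlgebraicClosure (RatFunc Fq)) = x := rfl
  have hg0 : g ≠ 0 := fun h => hx0 (by rw [← hgx, h]; rfl)
  set y' : IntermediateField.adjoin (RatFunc Fq) {x} :=
    algebraMap (RatFunc Fq) _ RatFunc.X / g with hy'
  have hyy' : (y' : AlgebraicClosure (RatFunc Fq)) = y := by
    change algebraMap (RatFunc Fq) (AlgebraicClosure (RatFunc Fq)) RatFunc.X / x = y
    rw [← hxy, mul_div_cancel_left₀ _ hx0]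
  have hy'E : y' ^ E = algebraMap (RatFunc Fq) _ RatFunc.X := by
    apply Subtype.ext
    change (y' : AlgebraicClosure (RatFunc Fq)) ^ E = _
    rw [hyy', hy]
    rfl
  have hgy : g = y' ^ (E - 1) := by
    apply Subtype.ext
    change x = (y' : AlgebraicClosure (RatFunc Fq)) ^ (E - 1)
    rw [hyy']
  have hgen : IntermediateField.adjoin (RatFunc Fq) {y'} = ⊤ := by
    apply eq_top_of_gen_mem
    rw [← hg, hgy]
    exact pow_mem (IntermediateField.mem_adjoin_simple_self _ _) _
  obtain ⟨w, hdiv, hbase, hram, hres, hval⟩ := exists_kummer_place (k := Fq) hy'E hgen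
  have hram0 : w.ramificationIndex ≠ 0 := by rw [hram]; exact hE0
  have hspec := w.ramificationIndex_spec hram0
  have hNT : intAbs w.base 1 RatFunc.X = exp (-1) := by
    rw [intAbs_apply _ _ RatFunc.X_ne_zero, hbase, zeroVal_X]
    simp
  have hNg : intAbs w.val w.ramificationIndex g = exp (1 / w.ramificationIndex - 1) := by
    rw [intAbs_apply _ _ hg0, hgy, map_pow, hval, hram, WithZero.log_pow, WithZero.log_exp]
    congr 1
    have h1 : ((E - 1 : ℕ) : ℝ) = E - 1 := by
      rw [Nat.cast_sub (Nat.one_le_iff_ne_zero.2 hE0), Nat.cast_one]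
    rw [nsmul_eq_mul]
    push_cast
    rw [h1]
    field_simp
    ring
  have hdeg := natDegree_binomial (Fq := Fq) (T := (RatFunc.X : RatFunc Fq)) hr
  have htd : (D.φ t).natDegree ≠ 0 := by rw [ht, hdeg]; omega
  obtain ⟨hpos, hlt⟩ := height_binomial hr (isNonarchimedean_intAbs w.val w.ramificationIndex)
    (intAbs_algebraMap w.val _ hram0 hspec) hNT hr₀ hp hq (by rwa [hram]) hNg
  have hfd : FiniteDimensional (RatFunc Fq) (IntermediateField.adjoin (RatFunc Fq) {x}) :=
    IntermediateField.adjoin.finiteDimensional (Algebra.IsIntegral.isIntegral x)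
  have hfin : (0 : ℝ) <
      Module.finrank (RatFunc Fq) (IntermediateField.adjoin (RatFunc Fq) {x}) := by
    exact_mod_cast Module.finrank_pos
  refine ⟨x, w, by rwa [hram], fun a ha => ?_⟩
  rw [w.localHeight_eq D (D.natDegree_ne_zero hA htd ha) htd hram0, hdiv, degree_zeroPoint, hres, ht]
  rw [hram] at hpos hlt ⊢
  set h := height (intAbs w.val E) (binomial Fq (RatFunc.X : RatFunc Fq) r₀ r) g
  generalize (Module.finrank (RatFunc Fq) (IntermediateField.adjoin (RatFunc Fq) {x}) : ℝ) = m at hfin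
  rw [Rat.cast_one, Nat.cast_one, mul_one, one_div, inv_mul_eq_div, ← div_div]
  refine ⟨div_pos (mul_pos hE' hpos) hfin, ?_⟩
  gcongr
  have hEα : 0 < (E : ℝ) ^ ((r : ℝ) / r₀) := rpow_pos_of_pos hE' _
  calc E * h < E * (2 * (Nat.card Fq : ℝ) ^ r₀ / (E : ℝ) ^ ((r : ℝ) / r₀)) := by gcongr
    _ ≤ E * (C * (E : ℝ) ^ ((r : ℝ) / r₀ - κ) / (E : ℝ) ^ ((r : ℝ) / r₀)) := by gcongr
    _ = C / (E : ℝ) ^ (κ - 1) := by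
      rw [rpow_sub hE', rpow_sub_one hE'.ne']
      have : 0 < (E : ℝ) ^ κ := rpow_pos_of_pos hE' _
      field_simp

end ProjectiveLine

end LocalLehmer

end

/-- First part: the lower bound for the local heights. Second part: the exponent `r / r₀` in it
cannot be lowered, as shown by `φ_t = τ ^ r - t ^ (1 - q ^ r₀) τ ^ r₀` over the function field
`Fq(t)` of the projective line. -/
theorem theoremT (p : ℕ) [Fact p.Prime] (Fq : Type*) [Field Fq] [Finite Fq] [CharP Fq p] :
    (∀ (F : Type*) [Field F] [Algebra Fq F] (_ : LocalLehmer.IsCurveFunctionField Fq F)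
        (infty : ValuationSubring F) (_ : LocalLehmer.IsClosedPoint Fq infty)
        (K : Type*) [Field K] [Algebra Fq K]
        (k : Type*) [Field k] [Finite k] [Algebra Fq k] [Algebra k K] [IsScalarTower Fq k K]
        (M : ℕ) (V : LocalLehmer.ProjectiveVariety k K M) (_ : V.IsNormal)
        (D : LocalLehmer.DrinfeldModule Fq (LocalLehmer.regularAway Fq infty) K)
        (_ : D.HasFiniteCharacteristic),
      ∃ C : ℝ, 0 < C ∧
        ∀ a : LocalLehmer.regularAway Fq infty, Transcendental Fq a →
        ∀ (t : LocalLehmer.regularAway Fq infty) (r₀ r : ℕ),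
          IsLeast {n : ℕ | (D.φ t).coeff n ≠ 0} r₀ →
          IsGreatest {n : ℕ | (D.φ t).coeff n ≠ 0} r →
          1 ≤ r₀ →
        ∀ (x : AlgebraicClosure K) (v : V.Place (IntermediateField.adjoin K {x})),
          ¬ p ∣ v.ramificationIndex →
          0 < v.localHeight D a (IntermediateField.AdjoinSimple.gen K x) →
          C / ((v.ramificationIndex : ℝ) ^ ((r : ℝ) / (r₀ : ℝ) - 1) *
              (Module.finrank K (IntermediateField.adjoin K {x}) : ℝ)) ≤
            v.localHeight D a (IntermediateField.AdjoinSimple.gen K x)) ∧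
    (∀ r₀ r : ℕ, 1 ≤ r₀ → r₀ < r →
      ∃ (infty : ValuationSubring (RatFunc Fq)) (_ : LocalLehmer.IsClosedPoint Fq infty)
        (V : LocalLehmer.ProjectiveVariety Fq (RatFunc Fq) 1)
        (D : LocalLehmer.DrinfeldModule Fq (LocalLehmer.regularAway Fq infty) (RatFunc Fq))
        (t : LocalLehmer.regularAway Fq infty),
        V.IsNormal ∧ V.coord = ![RatFunc.X, 1] ∧
        (t : RatFunc Fq) = RatFunc.X ∧ (t : RatFunc Fq) ∉ infty ∧
        D.φ t = LocalLehmer.TwistedPolynomial.monomial r 1 -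
          LocalLehmer.TwistedPolynomial.monomial r₀
            ((RatFunc.X : RatFunc Fq) ^ (1 - (Nat.card Fq : ℤ) ^ r₀)) ∧
        ∀ κ : ℝ, κ < (r : ℝ) / (r₀ : ℝ) → ∀ C : ℝ, 0 < C →
          ∃ (x : AlgebraicClosure (RatFunc Fq))
            (v : V.Place (IntermediateField.adjoin (RatFunc Fq) {x})),
            ¬ p ∣ v.ramificationIndex ∧
            ∀ a : LocalLehmer.regularAway Fq infty, Transcendental Fq a →
              0 < v.localHeight D a (IntermediateField.AdjoinSimple.gen (RatFunc Fq) x) ∧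
              v.localHeight D a (IntermediateField.AdjoinSimple.gen (RatFunc Fq) x) <
                C / ((v.ramificationIndex : ℝ) ^ (κ - 1) *
                  (Module.finrank (RatFunc Fq)
                    (IntermediateField.adjoin (RatFunc Fq) {x}) : ℝ))) := by
  constructor
  · intro F _ _ hF infty _ K _ _ k _ _ _ _ _ M V _ D _
    obtain ⟨C, hC, h⟩ := V.exists_localHeight_lower_bound (p := p)
      (LocalLehmer.trdeg_regularAway_le hF.2.le infty) D
    exact ⟨C, hC, fun a ha t r₀ r hr₀ hr h1 x v hv hx => h a ha t r₀ r hr₀ hr h1 _ v hv _ hx⟩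
  · intro r₀ r hr₀ hr
    have hP : (LocalLehmer.TwistedPolynomial.binomial Fq (RatFunc.X : RatFunc Fq) r₀ r).coeff 0 =
        0 :=
      LocalLehmer.TwistedPolynomial.coeff_binomial_of_ne (by omega) (by omega)
    exact ⟨LocalLehmer.ProjectiveLine.infty Fq, LocalLehmer.ProjectiveLine.isClosedPoint_infty Fq,
      LocalLehmer.ProjectiveLine.line Fq,
      LocalLehmer.ProjectiveLine.drinfeldOfPolynomial LocalLehmer.ProjectiveLine.polynomialEquiv
        (LocalLehmer.TwistedPolynomial.binomial Fq RatFunc.X r₀ r) hP,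
      LocalLehmer.ProjectiveLine.polynomialEquiv Polynomial.X,
      LocalLehmer.ProjectiveLine.isNormal_line, rfl, RatFunc.algebraMap_X,
      fun h => LocalLehmer.ProjectiveLine.X_notMem_infty Fq (RatFunc.algebraMap_X (K := Fq) ▸ h),
      LocalLehmer.ProjectiveLine.drinfeldOfPolynomial_X _ _ hP,
      fun κ hκ C hC => LocalLehmer.ProjectiveLine.exists_localHeight_lt hr₀ hr
        (LocalLehmer.ProjectiveLine.trdeg_regularAway Fq).le _
        (LocalLehmer.ProjectiveLine.drinfeldOfPolynomial_X _ _ hP) hκ hC⟩
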